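/- Let $I$ be a compact Hausdorff space with its Borel $\sigma$-algebra and let $m$ be a Borel probability measure on $I$; write $|Q|=m(Q)$. A \emph{good grid} is a sequence $\mathcal P=(\mathcal P^k)_{k\ge 0}$ of finite families of measurable sets of positive measure such that: the elements of each $\mathcal P^k$ are pairwise disjoint and cover $I$ up to a null set; every $Q\in\mathcal P^{k+1}$ is contained in some element of $\mathcal P^k$; $\bigcup_k\mathcal P^k$ generates the $\sigma$-algebra; and there are $\hat\lambda,\lambda\in(0,1)$ with $\hat\lambda\le |Q|/|P|\le\lambda$ whenever $Q\subset P$, $Q\in\mathcal P^{k+1}$, $P\in\mathcal P^k$. Let $\mathcal P$ be a good grid such that $\mathcal P^0=\{I\}$ and every $\mathcal P^k$ covers all of $I$, and put $\rho(x,y)=\inf\{|Q| : Q\in\bigcup_k\mathcal P^k,\ x,y\in Q\}$. A \emph{recalibration} of $\mathcal P$ is a good grid $\mathcal G$ with $\bigcup_k\mathcal G^k\subset\bigcup_k\mathcal P^k$ such that, with $\ell_k=\max_{Q\in\mathcal G^k}|Q|$ and $m_k=\min_{Q\in\mathcal G^k}|Q|$, one has $\ell_{k+1}<\ell_k$, $c_1\le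 \ell_{k+1}/\ell_k\le c_2$ and $1\le \ell_k/m_k\le 1/\delta$ for all $k$, for some $c_1,c_2,\delta\in(0,1)$. Let $p\in[1,\infty)$, $q\in[1,\infty]$ and $0<s<1/p$. Below, the usual modification (a supremum) is understood when $q=\infty$. \emph{Gu--Taibleson space.} For $f\in L^1$ let $f_k=\frac1{|Q|}\int_Q f\,dm$ on $Q\in\mathcal G^k$, $f_{-1}=0$ and $d_kf=f_k-f_{k-1}$. Then $B_{GT}(s,p,q)$ (for the recalibration $\mathcal G$) is the set of $f\in L^1$ with $|f|_{B_{GT}}=\big(\sum_{k\ge0}(\ell_k^{-s}\|d_kf\|_p)^q\big)^{1/q}<\infty$. \emph{Grid Besov space.} For a good grid $\mathcal W$, $\mathcal B^s_{p,q}(\mathcal W)$ is the set of $f\in L^p$ of the form $f=\sum_k\sum_{Q\in\mathcal W^k}c_Q a_Q$, with $a_Q=|Q|^{s-1/p}1_Q$, $c_Q\in\mathbb C$, with convergence in $L^p$, with $\sum_k\|\sum_{Q\in\mathcal W^k}c_Qa_Q\|_p<\infty$, and with $\big(\sum_k(\sum_{Q\in\mathcal W^k}|c_Q|^p)^{q/p}\big)^{1/q}<\infty$;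 its norm is the infimum of the last quantity over all such representations. \emph{Besov space of $(I,\rho,m)$.} A quasi-metric $d$ is \emph{$D$-Ahlfors regular} if there are $C,r_0>0$ with $r^D/C\le m(B_d(x,r))\le Cr^D$ for all $x\in I$ and $0<r\le r_0$, where $B_d(x,r)=\{y: d(x,y)<r\}$. A good grid $\mathcal W$ is \emph{adapted to a quasi-metric $\alpha$ with exponent $\eta>0$} if there are $C_1,C_2,C_3,C_4>0$, $\theta\in(0,1)$ and points $z_Q\in Q$ such that for all $k\ge1$, $Q\in\mathcal W^k$ and $t>0$: $B_\alpha(z_Q,C_1\theta^k)\subset Q$, $\operatorname{diam}_\alpha Q\le C_2\theta^k$, and $m\{x\in Q:\alpha(x,I\setminus Q)\le C_3t\theta^k\}\le C_4t^\eta|Q|$. The space $\mathbb B^s_{p,q}$ of $(I,\rho,m)$ is $\mathcal B^s_{p,q}(\mathcal W)$ for any good grid $\mathcal W$ that is adapted, with some exponent $\eta>sp$, to some $1$-Ahlfors regular quasi-metric $d$ that is equivalent to a positive power of $\rho$. \emph{Han--Lu--Yang space of $(I,\rho,m)$.} Let $\beta(x,y)=\inf\{m(B): B \text{ a } \rho\text{-ball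 containing } x,y\}$, let $K\ge1$ satisfy $\beta(x,w)\le K(\beta(x,y)+\beta(y,w))$, let $\mathcal W$ be a good grid adapted to $\beta$ with constants as above, and let $\gamma>s$ be such that $d_\gamma(x,y)=\inf\sum_i\beta(x_i,x_{i+1})^\gamma$ (infimum over finite chains from $x$ to $y$) is a metric equivalent to $\beta^\gamma$. A $\gamma$-block on $Q\in\mathcal W^k$ is a function $a_Q:I\to\mathbb C$ that vanishes outside $B_\beta(z_Q,3KC_2\theta^k)$, with $|a_Q|\le|Q|^{s-1/p}$ and $|a_Q(x)-a_Q(y)|\le|Q|^{s-1/p-\gamma}\beta(x,y)^\gamma$. The space $B_{HLY}(s,p,q)$ and its norm are defined as $\mathcal B^s_{p,q}(\mathcal W)$ and its norm, with arbitrary $\gamma$-blocks $a_Q$ in place of $|Q|^{s-1/p}1_Q$, the infimum running also over the blocks. \textbf{Theorem.} $(I,\rho,m)$ is a homogeneous space (that is, $\rho$ is a quasi-metric, and $m$ measures all $\rho$-open sets and all $\rho$-balls and is doubling for $\rho$) and $\rho$ is $1$-Ahlfors regular. For every recalibration $\mathcal G$ of $\mathcal P$: (a) for every other recalibration $\mathcal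 G'$ the spaces $B_{GT}(s,p,q)$ built from $\mathcal G$ and from $\mathcal G'$ coincide; (b) $B_{GT}(s,p,q)=\mathcal B^s_{p,q}(\mathcal G)$; (c) grids $\mathcal W$ as in the definition of $\mathbb B^s_{p,q}$ exist, and for each of them $B_{GT}(s,p,q)=\mathcal B^s_{p,q}(\mathcal W)$, that is, $B_{GT}(s,p,q)=\mathbb B^s_{p,q}$; (d) data $(\mathcal W,(z_Q)_Q,K,C_2,\theta,\gamma)$ as in the definition of $B_{HLY}(s,p,q)$ exist, and for each choice of them $B_{GT}(s,p,q)=B_{HLY}(s,p,q)$. In all cases equality means that the two spaces have the same elements and equivalent norms. -/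

import Mathlib

open MeasureTheory Set Filter Topology
open scoped ENNReal NNReal

namespace GridBesov

/-! ### Good grids and recalibrations -/

/-- A good grid on a measure space: finite families of measurable sets of positive measure, each of
which is a partition up to a null set, which are nested, which generate the sigma-algebra, and for
which the ratio of the measures of a child and its parent stays away from `0` and `1`. -/
structure IsGoodGrid {I : Type*} [mI : MeasurableSpace I] (m : Measure I)
    (P : ℕ → Finset (Set I)) : Prop where
  measurable : ∀ k, ∀ Q ∈ P k, MeasurableSet Q
  pos : ∀ k, ∀ Q ∈ P k, 0 < m Q
  disjoint : ∀ k, ∀ Q ∈ P k, ∀ R ∈ P k, Q ≠ R → Disjoint Q R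
  cover : ∀ k, m {x | ∀ Q ∈ P k, x ∉ Q} = 0
  nested : ∀ k, ∀ Q ∈ P (k + 1), ∃ R ∈ P k, Q ⊆ R
  generates : mI = MeasurableSpace.generateFrom {Q | ∃ k, Q ∈ P k}
  ratio : ∃ a b : ℝ, 0 < a ∧ a < 1 ∧ 0 < b ∧ b < 1 ∧
    ∀ k, ∀ Q ∈ P (k + 1), ∀ R ∈ P k, Q ⊆ R →
      a ≤ m.real Q / m.real R ∧ m.real Q / m.real R ≤ b

/-- The largest measure of an element of the `k`-th family. -/
noncomputable def maxSize {I : Type*} [MeasurableSpace I] (m : Measure I)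
    (G : ℕ → Finset (Set I)) (k : ℕ) : ℝ :=
  sSup ((fun Q : Set I => m.real Q) '' (G k : Set (Set I)))

/-- The smallest measure of an element of the `k`-th family. -/
noncomputable def minSize {I : Type*} [MeasurableSpace I] (m : Measure I)
    (G : ℕ → Finset (Set I)) (k : ℕ) : ℝ :=
  sInf ((fun Q : Set I => m.real Q) '' (G k : Set (Set I)))

/-- `G` is a recalibration of the grid `P`. -/
structure IsRecalibration {I : Type*} [MeasurableSpace I] (m : Measure I)
    (P G : ℕ → Finset (Set I)) : Prop where
  good : IsGoodGrid m G
  mem_grid : ∀ k, ∀ Q ∈ G k, ∃ j, Q ∈ P j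
  decreasing : ∀ k, maxSize m G (k + 1) < maxSize m G k
  geometric : ∃ c₁ c₂ : ℝ, 0 < c₁ ∧ c₁ < 1 ∧ 0 < c₂ ∧ c₂ < 1 ∧
    ∀ k, c₁ ≤ maxSize m G (k + 1) / maxSize m G k ∧
      maxSize m G (k + 1) / maxSize m G k ≤ c₂
  comparable : ∃ δ : ℝ, 0 < δ ∧ δ < 1 ∧
    ∀ k, 1 ≤ maxSize m G k / minSize m G k ∧ maxSize m G k / minSize m G k ≤ 1 / δ

/-! ### Quasi-metrics and homogeneous spaces -/

/-- The quasi-ball of centre `x` and radius `r`. -/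
def qball {I : Type*} (ρ : I → I → ℝ) (x : I) (r : ℝ) : Set I := {y | ρ x y < r}

structure IsQuasiMetric {I : Type*} (ρ : I → I → ℝ) : Prop where
  self_eq_zero : ∀ x, ρ x x = 0
  pos : ∀ x y, x ≠ y → 0 < ρ x y
  symm : ∀ x y, ρ x y = ρ y x
  triangle : ∃ K : ℝ, 1 ≤ K ∧ ∀ x y z, ρ x z ≤ K * (ρ x y + ρ y z)

structure IsMetric {I : Type*} (d : I → I → ℝ) : Prop where
  eq_zero_iff : ∀ x y, d x y = 0 ↔ x = y
  symm : ∀ x y, d x y = d y x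
  triangle : ∀ x y z, d x z ≤ d x y + d y z

/-- `d` is equivalent to a positive power of `ρ`. -/
def PowerLawEquiv {I : Type*} (d ρ : I → I → ℝ) : Prop :=
  ∃ θ C : ℝ, 0 < θ ∧ 1 ≤ C ∧ ∀ x y, d x y / C ≤ ρ x y ^ θ ∧ ρ x y ^ θ ≤ C * d x y

/-- A homogeneous space: a quasi-metric with a measure that is Borel (it measures every set that is
open for the quasi-metric) and doubling. -/
structure IsHomogeneousSpace {I : Type*} [MeasurableSpace I] (ρ : I → I → ℝ) (m : Measure I) :
    Prop where
  quasiMetric : IsQuasiMetric ρ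
  borel : ∀ U : Set I, (∀ x ∈ U, ∃ r > 0, qball ρ x r ⊆ U) → MeasurableSet U
  ball_measurable : ∀ x r, MeasurableSet (qball ρ x r)
  doubling : ∃ C : ℝ≥0, ∀ x, ∀ r : ℝ, 0 < r →
    0 < m (qball ρ x r) ∧ m (qball ρ x r) < C * m (qball ρ x (r / 2)) ∧
      C * m (qball ρ x (r / 2)) < ∞

/-- `(m, d, D)` is Ahlfors regular. -/
def IsAhlforsRegular {I : Type*} [MeasurableSpace I] (d : I → I → ℝ) (m : Measure I) (D : ℝ) :
    Prop :=
  ∃ C r₀ : ℝ, 0 < C ∧ 0 < r₀ ∧ ∀ x, ∀ r : ℝ, 0 < r → r ≤ r₀ →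
    r ^ D / C ≤ m.real (qball d x r) ∧ m.real (qball d x r) ≤ C * r ^ D

/-- The infimum of the measures of the grid elements that contain both points. -/
noncomputable def gridMetric {I : Type*} [MeasurableSpace I] (m : Measure I)
    (P : ℕ → Finset (Set I)) (x y : I) : ℝ :=
  sInf {t | ∃ k, ∃ Q ∈ P k, x ∈ Q ∧ y ∈ Q ∧ t = m.real Q}

/-- The infimum of the measures of the `ρ`-balls that contain both points. -/
noncomputable def measureMetric {I : Type*} [MeasurableSpace I] (ρ : I → I → ℝ) (m : Measure I)
    (x y : I) : ℝ :=
  sInf {t | ∃ z, ∃ r : ℝ, 0 < r ∧ x ∈ qball ρ z r ∧ y ∈ qball ρ z r ∧ t = m.real (qball ρ z r)}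

/-- The chain (pseudo-)metric: infimum over finite chains from `x` to `y` of the sum of the
`γ`-th powers of the steps. -/
noncomputable def chainMetric {I : Type*} (β : I → I → ℝ) (γ : ℝ) (x y : I) : ℝ :=
  sInf {t | ∃ (n : ℕ) (u : ℕ → I), u 0 = x ∧ u n = y ∧
    t = ∑ i ∈ Finset.range n, β (u i) (u (i + 1)) ^ γ}

/-- A good grid adapted to the quasi-metric `α`: for `k ≥ 1` each `Q` in the `k`-th family contains
a ball of radius `C₁ lam ^ k` around `z Q`, has diameter at most `C₂ lam ^ k`, and has collars
`{x ∈ Q : α(x, I \ Q) ≤ C₃ t lam ^ k}` of measure at most `C₄ t ^ η m(Q)`. -/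
structure IsAdaptedGrid {I : Type*} [MeasurableSpace I] (α : I → I → ℝ) (m : Measure I)
    (W : ℕ → Finset (Set I)) (z : Set I → I) (η C₁ C₂ C₃ C₄ lam : ℝ) : Prop where
  good : IsGoodGrid m W
  η_pos : 0 < η
  C₁_pos : 0 < C₁
  C₂_pos : 0 < C₂
  C₃_pos : 0 < C₃
  C₄_pos : 0 < C₄
  lam_pos : 0 < lam
  lam_lt_one : lam < 1
  center_mem : ∀ k, ∀ Q ∈ W k, z Q ∈ Q
  ball_subset : ∀ k, 1 ≤ k → ∀ Q ∈ W k, qball α (z Q) (C₁ * lam ^ k) ⊆ Q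
  diam_le : ∀ k, 1 ≤ k → ∀ Q ∈ W k, ∀ x ∈ Q, ∀ y ∈ Q, α x y ≤ C₂ * lam ^ k
  collar : ∀ k, 1 ≤ k → ∀ Q ∈ W k, ∀ t : ℝ, 0 < t →
    m {x | x ∈ Q ∧ sInf ((fun y => α x y) '' Qᶜ) ≤ C₃ * t * lam ^ k}
      ≤ ENNReal.ofReal (C₄ * t ^ η) * m Q

/-! ### Spaces given by atomic decompositions -/

/-- A space of functions given by its members and its (extended) norm. -/
structure FunctionSpace (I : Type*) where
  carrier : Set (I → ℂ)
  size : (I → ℂ) → ℝ≥0∞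

/-- Two function spaces have the same members and equivalent norms. -/
def SameSpace {I : Type*} (S T : FunctionSpace I) : Prop :=
  S.carrier = T.carrier ∧
    ∃ C : ℝ≥0, ∀ f ∈ S.carrier, S.size f ≤ C * T.size f ∧ T.size f ≤ C * S.size f

/-- The `ℓ^q` norm of a sequence, `1 ≤ q ≤ ∞`. -/
noncomputable def lqNorm (q : ℝ≥0∞) (a : ℕ → ℝ≥0∞) : ℝ≥0∞ :=
  if q = ∞ then ⨆ k, a k else (∑' k, a k ^ q.toReal) ^ (1 / q.toReal)

/-- `(∑_k (∑_{Q ∈ P^k} |c_Q|^p)^{q/p})^{1/q}`. -/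
noncomputable def coeffNorm {I : Type*} (P : ℕ → Finset (Set I)) (p : ℝ) (q : ℝ≥0∞)
    (c : ℕ → Set I → ℂ) : ℝ≥0∞ :=
  lqNorm q fun k => (∑ Q ∈ P k, ‖c k Q‖ₑ ^ p) ^ (1 / p)

/-- The function `∑_{Q ∈ P^k} c_Q a_Q`. -/
noncomputable def levelSum {I : Type*} (P : ℕ → Finset (Set I)) (c : ℕ → Set I → ℂ)
    (a : ℕ → Set I → I → ℂ) (k : ℕ) (x : I) : ℂ :=
  ∑ Q ∈ P k, c k Q * a k Q x

/-- `f = ∑_k ∑_{Q ∈ P^k} c_Q a_Q`, with absolute convergence in `L^p`, where `a_Q` is an atom of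
the class `A` for every `Q`. -/
structure IsRepresentation {I : Type*} [MeasurableSpace I] (m : Measure I)
    (P : ℕ → Finset (Set I)) (A : ℕ → Set I → Set (I → ℂ)) (p : ℝ) (f : I → ℂ)
    (c : ℕ → Set I → ℂ) (a : ℕ → Set I → I → ℂ) : Prop where
  atom : ∀ k, ∀ Q ∈ P k, a k Q ∈ A k Q
  absolute : ∑' k, eLpNorm (levelSum P c a k) (ENNReal.ofReal p) m < ∞
  tendsto : Tendsto (fun n => eLpNorm (fun x => f x - ∑ k ∈ Finset.range n, levelSum P c a k x)
    (ENNReal.ofReal p) m) atTop (𝓝 0)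

/-- The space of all `f` in `L^p` that have a representation by atoms of the class `A` with
`coeffNorm` finite; the norm is the infimum of `coeffNorm` over the representations. -/
noncomputable def atomicSpace {I : Type*} [MeasurableSpace I] (m : Measure I)
    (P : ℕ → Finset (Set I)) (A : ℕ → Set I → Set (I → ℂ)) (p : ℝ) (q : ℝ≥0∞) :
    FunctionSpace I where
  carrier := {f | MemLp f (ENNReal.ofReal p) m ∧
    ∃ c a, IsRepresentation m P A p f c a ∧ coeffNorm P p q c < ∞}
  size f := sInf {t | ∃ c a, IsRepresentation m P A p f c a ∧ t = coeffNorm P p q c}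

/-- The canonical Souza atom `|Q|^{s-1/p} 1_Q`. -/
noncomputable def souzaAtom {I : Type*} [MeasurableSpace I] (m : Measure I) (s p : ℝ)
    (Q : Set I) : I → ℂ :=
  Q.indicator fun _ => ((m.real Q ^ (s - 1 / p) : ℝ) : ℂ)

/-- The Besov space of the grid `P`. -/
noncomputable def gridBesov {I : Type*} [MeasurableSpace I] (m : Measure I)
    (P : ℕ → Finset (Set I)) (s p : ℝ) (q : ℝ≥0∞) : FunctionSpace I :=
  atomicSpace m P (fun _ Q => {souzaAtom m s p Q}) p q

/-- `W` is one of the grids that define the Besov space of the homogeneous space `(I, ρ, m)` with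
parameters `s, p`: it is adapted, with exponent `η > s p`, to a `1`-Ahlfors regular quasi-metric
that is power-law equivalent to `ρ`. -/
def IsBesovGrid {I : Type*} [MeasurableSpace I] (ρ : I → I → ℝ) (m : Measure I) (s p : ℝ)
    (W : ℕ → Finset (Set I)) : Prop :=
  ∃ d : I → I → ℝ, IsQuasiMetric d ∧ PowerLawEquiv d ρ ∧ IsAhlforsRegular d m 1 ∧
    ∃ (z : Set I → I) (η C₁ C₂ C₃ C₄ lam : ℝ),
      IsAdaptedGrid d m W z η C₁ C₂ C₃ C₄ lam ∧ s * p < η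

/-! ### Han-Lu-Yang blocks -/

/-- The data on which the Han-Lu-Yang space of `(I, ρ, m)` is built, with `β = measureMetric ρ m`:
a quasi-triangle constant `K` of `β`, a grid `W` adapted to `β` with centres `z`, diameter
constant `R` and ratio `lam`, and an exponent `γ > s` for which the chain metric is a metric
equivalent to `β ^ γ`. -/
structure IsHLYSetup {I : Type*} [MeasurableSpace I] (ρ : I → I → ℝ) (m : Measure I) (s : ℝ)
    (W : ℕ → Finset (Set I)) (z : Set I → I) (K R lam γ : ℝ) : Prop where
  one_le_K : 1 ≤ K
  triangle : ∀ x y w, measureMetric ρ m x w ≤ K * (measureMetric ρ m x y + measureMetric ρ m y w)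
  adapted : ∃ η C₁ C₃ C₄ : ℝ, IsAdaptedGrid (measureMetric ρ m) m W z η C₁ R C₃ C₄ lam
  γ_pos : 0 < γ
  s_lt_γ : s < γ
  chain_metric : IsMetric (chainMetric (measureMetric ρ m) γ)
  chain_equiv : ∃ C : ℝ, 1 ≤ C ∧ ∀ x y,
    chainMetric (measureMetric ρ m) γ x y / C ≤ measureMetric ρ m x y ^ γ ∧
      measureMetric ρ m x y ^ γ ≤ C * chainMetric (measureMetric ρ m) γ x y

/-- The Han-Lu-Yang `γ`-blocks associated to `Q`, an element of the `k`-th family. -/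
def hlyBlocks {I : Type*} [MeasurableSpace I] (ρ : I → I → ℝ) (m : Measure I) (s p : ℝ)
    (z : Set I → I) (K R lam γ : ℝ) (k : ℕ) (Q : Set I) : Set (I → ℂ) :=
  {a | Function.support a ⊆ qball (measureMetric ρ m) (z Q) (3 * K * R * lam ^ k) ∧
    (∀ x, ‖a x‖ ≤ m.real Q ^ (s - 1 / p)) ∧
    ∀ x y, ‖a x - a y‖ ≤ m.real Q ^ (s - 1 / p - γ) * measureMetric ρ m x y ^ γ}

/-- The Han-Lu-Yang Besov space of `(I, ρ, m)`. -/
noncomputable def hlyBesov {I : Type*} [MeasurableSpace I] (ρ : I → I → ℝ) (m : Measure I)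
    (W : ℕ → Finset (Set I)) (z : Set I → I) (K R lam γ : ℝ) (s p : ℝ) (q : ℝ≥0∞) :
    FunctionSpace I :=
  atomicSpace m W (hlyBlocks ρ m s p z K R lam γ) p q

/-! ### The Gu-Taibleson space -/

/-- The function equal to the mean of `f` over `Q` on each `Q` of the `k`-th family. -/
noncomputable def gridAverage {I : Type*} [MeasurableSpace I] (m : Measure I)
    (G : ℕ → Finset (Set I)) (f : I → ℂ) (k : ℕ) (x : I) : ℂ :=
  ∑ Q ∈ G k, Q.indicator (fun _ => ⨍ y in Q, f y ∂m) x

/-- The martingale differences `f_k - f_{k-1}`, with the convention `f_{-1} = 0`. -/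
noncomputable def martingaleDiff {I : Type*} [MeasurableSpace I] (m : Measure I)
    (G : ℕ → Finset (Set I)) (f : I → ℂ) : ℕ → I → ℂ
  | 0 => gridAverage m G f 0
  | k + 1 => fun x => gridAverage m G f (k + 1) x - gridAverage m G f k x

/-- The Gu-Taibleson recalibrated martingale Besov space of the recalibration `G`. -/
noncomputable def guTaibleson {I : Type*} [MeasurableSpace I] (m : Measure I)
    (G : ℕ → Finset (Set I)) (s p : ℝ) (q : ℝ≥0∞) : FunctionSpace I where
  carrier := {f | Integrable f m ∧
    lqNorm q (fun k => ENNReal.ofReal (maxSize m G k ^ (-s)) *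
      eLpNorm (martingaleDiff m G f k) (ENNReal.ofReal p) m) < ∞}
  size f := lqNorm q fun k => ENNReal.ofReal (maxSize m G k ^ (-s)) *
      eLpNorm (martingaleDiff m G f k) (ENNReal.ofReal p) m

end GridBesov

open GridBesov

/-! All the spaces are compared with one model, the Gu–Taibleson space `scaledGT` of a nested
sequence of partitions whose k-th cells have measure comparable to σ_k, with σ decaying
geometrically. The martingale differences d_k f are constant on the k-th cells, and s > 0 makes
their L^p norms summable. So f is the sum of its differences, and this sum is already a
representation by Souza atoms (`scaledGT_embeds_gridBesov`).

Conversely, let f = ∑ g_k, where g_k has scale τ_k and coefficient norm κ_k. If ‖d_j g_k‖_p is at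
most a constant times τ_k^s κ_k min(1, (σ_j/τ_k)^ν) with ν > s, then weighting by σ_j^(-s) leaves a
matrix dominated by min(τ_k/σ_j, σ_j/τ_k)^μ, and the Schur test bounds f
(`scaledGT_size_le_of_atoms`). The decay has two sources. A level sum of Souza atoms has no
martingale difference on cells contained in some Q of the level; the other cells fill a proportion
(σ_j/τ_k)^η of each Q, which gives ν = η/p, and η > sp is exactly what is needed
(`gridBesov_embeds_scaledGT`). The γ-blocks are Hölder, which gives ν = γ
(`hlyBesov_embeds_scaledGT`).

The geometry comes from the tree structure. Grid sets are nested or disjoint and measure drops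
strictly along the tree, so ρ is an ultrametric whose balls are exactly the grid sets, with measure
comparable to the radius up to radius 1. Hence homogeneity and regularity; moreover β = ρ, the chain
metric is ρ^γ, and a 1-regular quasi-metric equivalent to a power of ρ is equivalent to ρ. Grid sets
have no collar at scales well below their measure, so recalibrations satisfy the collar bound for
every η. An adapted grid need not consist of sets of P: only its sizes, diameters and collars enter.
Finally, indicators of ultrametric balls are Hölder, so differences along the partition into balls
of radius 2R lam^(k+1) are sums of blocks (`scaledGT_embeds_hlyBesov`). -/

namespace GridBesov

/-! ### Sequence spaces -/

/-- Hölder's inequality for counting measure after splitting w = w^(1/q') w^(1/q). This is the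
pointwise half of the Schur test. -/
theorem tsum_mul_rpow_le (w κ : ℕ → ℝ≥0∞) {q : ℝ} (hq : 1 ≤ q) :
    (∑' k, w k * κ k) ^ q ≤ (∑' k, w k) ^ (q - 1) * ∑' k, w k * κ k ^ q := by
  rcases hq.eq_or_lt with rfl | hq
  · simp
  have hq0 : 0 < q := by linarith
  have hc : (Real.conjExponent q).HolderConjugate q := (Real.HolderConjugate.conjExponent hq).symm
  have hr0 : 0 < Real.conjExponent q := hc.pos
  have key := ENNReal.lintegral_mul_le_Lp_mul_Lq (Measure.count : Measure ℕ) hc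
    (f := fun k => w k ^ (1 / Real.conjExponent q)) (g := fun k => w k ^ (1 / q) * κ k)
    (measurable_of_countable _).aemeasurable (measurable_of_countable _).aemeasurable
  simp only [lintegral_count, Pi.mul_apply] at key
  have e1 : ∀ k, w k ^ (1 / Real.conjExponent q) * (w k ^ (1 / q) * κ k) = w k * κ k := fun k => by
    rw [← mul_assoc, ← ENNReal.rpow_add_of_nonneg _ _ (by positivity) (by positivity)]
    have : 1 / Real.conjExponent q + 1 / q = 1 := by simpa using hc.inv_add_inv_eq_one
    rw [this, ENNReal.rpow_one]
  have e2 : ∀ k, (w k ^ (1 / Real.conjExponent q)) ^ Real.conjExponent q = w k := fun k => by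
    rw [← ENNReal.rpow_mul, one_div_mul_cancel hr0.ne', ENNReal.rpow_one]
  have e3 : ∀ k, (w k ^ (1 / q) * κ k) ^ q = w k * κ k ^ q := fun k => by
    rw [ENNReal.mul_rpow_of_nonneg _ _ hq0.le, ← ENNReal.rpow_mul, one_div_mul_cancel hq0.ne',
      ENNReal.rpow_one]
  simp only [e1, e2, e3] at key
  calc (∑' k, w k * κ k) ^ q
      ≤ ((∑' k, w k) ^ (1 / Real.conjExponent q) * (∑' k, w k * κ k ^ q) ^ (1 / q)) ^ q :=
        ENNReal.rpow_le_rpow key hq0.le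
    _ = _ := by
        rw [ENNReal.mul_rpow_of_nonneg _ _ hq0.le, ← ENNReal.rpow_mul, ← ENNReal.rpow_mul,
          one_div_mul_cancel hq0.ne', ENNReal.rpow_one]
        congr 2
        rw [Real.conjExponent]
        field_simp

theorem toReal_one_le {q : ℝ≥0∞} (hq : 1 ≤ q) (hq' : q ≠ ∞) : 1 ≤ q.toReal := by
  simpa using ENNReal.toReal_mono hq' hq

theorem le_lqNorm {q : ℝ≥0∞} (hq : 1 ≤ q) (a : ℕ → ℝ≥0∞) (k : ℕ) : a k ≤ lqNorm q a := by
  unfold lqNorm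
  split_ifs with h
  · exact le_iSup a k
  · have hq0 : 0 < q.toReal := lt_of_lt_of_le one_pos (toReal_one_le hq h)
    calc a k = (a k ^ q.toReal) ^ (1 / q.toReal) := by
          rw [← ENNReal.rpow_mul, mul_one_div_cancel hq0.ne', ENNReal.rpow_one]
      _ ≤ _ := ENNReal.rpow_le_rpow (ENNReal.le_tsum k) (by positivity)

theorem lqNorm_mono (q : ℝ≥0∞) {a b : ℕ → ℝ≥0∞} (h : ∀ k, a k ≤ b k) :
    lqNorm q a ≤ lqNorm q b := by
  unfold lqNorm
  split_ifs with hq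
  · exact iSup_mono h
  · exact ENNReal.rpow_le_rpow (ENNReal.tsum_le_tsum fun k =>
      ENNReal.rpow_le_rpow (h k) ENNReal.toReal_nonneg) (by positivity)

theorem lqNorm_const_mul {q : ℝ≥0∞} (hq : 1 ≤ q) (C : ℝ≥0∞) (a : ℕ → ℝ≥0∞) :
    lqNorm q (fun k => C * a k) = C * lqNorm q a := by
  unfold lqNorm
  split_ifs with h
  · rw [ENNReal.mul_iSup]
  · have hq0 : 0 < q.toReal := lt_of_lt_of_le one_pos (toReal_one_le hq h)
    simp only [ENNReal.mul_rpow_of_nonneg _ _ hq0.le, ENNReal.tsum_mul_left]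
    rw [ENNReal.mul_rpow_of_nonneg _ _ (by positivity), ← ENNReal.rpow_mul,
      mul_one_div_cancel hq0.ne', ENNReal.rpow_one]

/-- The norm of a sequence shifted to the right by one place. -/
theorem lqNorm_shift {q : ℝ≥0∞} (hq : 1 ≤ q) {a b : ℕ → ℝ≥0∞} (h0 : b 0 = 0)
    (hb : ∀ k, b (k + 1) = a k) : lqNorm q b = lqNorm q a := by
  unfold lqNorm
  split_ifs with h
  · apply le_antisymm
    · refine iSup_le fun k => ?_
      cases k with
      | zero => simp [h0]
      | succ k => rw [hb]; exact le_iSup a k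
    · exact iSup_le fun k => (hb k) ▸ le_iSup b (k + 1)
  · have hq0 : 0 < q.toReal := lt_of_lt_of_le one_pos (toReal_one_le hq h)
    rw [tsum_eq_zero_add' ENNReal.summable, h0, ENNReal.zero_rpow_of_pos hq0, zero_add]
    simp only [hb]

/-- The Schur test on `ℓ^q`. -/
theorem lqNorm_schur {q : ℝ≥0∞} (hq : 1 ≤ q) (M : ℕ → ℕ → ℝ≥0∞) (κ : ℕ → ℝ≥0∞) (C : ℝ≥0∞)
    (h1 : ∀ j, ∑' k, M j k ≤ C) (h2 : ∀ k, ∑' j, M j k ≤ C) :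
    lqNorm q (fun j => ∑' k, M j k * κ k) ≤ C * lqNorm q κ := by
  unfold lqNorm
  split_ifs with h
  · refine iSup_le fun j => ?_
    calc ∑' k, M j k * κ k ≤ ∑' k, M j k * ⨆ k, κ k :=
          ENNReal.tsum_le_tsum fun k => by gcongr; exact le_iSup κ k
      _ = (∑' k, M j k) * ⨆ k, κ k := ENNReal.tsum_mul_right
      _ ≤ _ := by gcongr; exact h1 j
  · have hq1 := toReal_one_le hq h
    have hq0 : 0 < q.toReal := lt_of_lt_of_le one_pos hq1
    set r := q.toReal
    have : ∑' j, (∑' k, M j k * κ k) ^ r ≤ C ^ r * ∑' k, κ k ^ r := by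
      calc ∑' j, (∑' k, M j k * κ k) ^ r
          ≤ ∑' j, C ^ (r - 1) * ∑' k, M j k * κ k ^ r := ENNReal.tsum_le_tsum fun j =>
            (tsum_mul_rpow_le _ _ hq1).trans (by
              gcongr; exact h1 j)
        _ = C ^ (r - 1) * ∑' k, (∑' j, M j k) * κ k ^ r := by
            rw [ENNReal.tsum_mul_left, ENNReal.tsum_comm]
            simp only [ENNReal.tsum_mul_right]
        _ ≤ C ^ (r - 1) * ∑' k, C * κ k ^ r := by
            gcongr with k; exact h2 k
        _ = C ^ (r - 1) * C ^ (1 : ℝ) * ∑' k, κ k ^ r := by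
            rw [ENNReal.tsum_mul_left, ENNReal.rpow_one, mul_assoc]
        _ = _ := by
            rw [← ENNReal.rpow_add_of_nonneg _ _ (by linarith) zero_le_one, sub_add_cancel]
    calc _ ≤ (C ^ r * ∑' k, κ k ^ r) ^ (1 / r) := ENNReal.rpow_le_rpow this (by positivity)
      _ = _ := by
          rw [ENNReal.mul_rpow_of_nonneg _ _ (by positivity), ← ENNReal.rpow_mul,
            mul_one_div_cancel hq0.ne', ENNReal.rpow_one]

/-! ### Geometric sequences of scales -/

/-- A positive sequence decaying at least geometrically. -/
def GeomDecay (τ : ℕ → ℝ) (c : ℝ) : Prop :=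
  0 < c ∧ c < 1 ∧ (∀ k, 0 < τ k) ∧ ∀ k, τ (k + 1) ≤ c * τ k

theorem GeomDecay.le_pow {τ : ℕ → ℝ} {c : ℝ} (h : GeomDecay τ c) (k n : ℕ) :
    τ (k + n) ≤ c ^ n * τ k := by
  induction n with
  | zero => simp
  | succ n ih =>
    calc τ (k + n + 1) ≤ c * τ (k + n) := h.2.2.2 _
      _ ≤ c * (c ^ n * τ k) := by have := h.1; gcongr
      _ = _ := by ring

theorem GeomDecay.tendsto_zero {τ : ℕ → ℝ} {c : ℝ} (h : GeomDecay τ c) :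
    Tendsto τ atTop (𝓝 0) := by
  have h1 : Tendsto (fun n => c ^ n * τ 0) atTop (𝓝 (0 * τ 0)) :=
    (tendsto_pow_atTop_nhds_zero_of_lt_one h.1.le h.2.1).mul_const _
  rw [zero_mul] at h1
  exact squeeze_zero (fun n => (h.2.2.1 n).le) (fun n => by simpa using h.le_pow 0 n) h1

/-- A bound on the sum of `min (τ_k / l, l / τ_k) ^ μ` that does not depend on `l`. -/
theorem GeomDecay.tsum_min_le {τ : ℕ → ℝ} {c : ℝ} (h : GeomDecay τ c) {μ : ℝ} (hμ : 0 < μ)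
    {l : ℝ} (hl : 0 < l) :
    ∑' k, ENNReal.ofReal (min (τ k / l) (l / τ k) ^ μ) ≤
      2 * (1 - ENNReal.ofReal (c ^ μ))⁻¹ := by
  classical
  obtain ⟨hc0, hc1, hpos, hdec⟩ := id h
  have hex : ∃ k, τ k < l := ((h.tendsto_zero).eventually (gt_mem_nhds hl)).exists
  -- K is the first index with τ_K < l. From K on, τ_k/l decays geometrically; going down from K -
  -- 1, l/τ_k does. Each half is dominated by one geometric series, whence the factor 2.
  set K := Nat.find hex with hK
  have hKl : τ K < l := Nat.find_spec hex
  have hbelow : ∀ k < K, l ≤ τ k := fun k hk => not_lt.1 (Nat.find_min hex hk)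
  set F : ℕ → ℝ≥0∞ := fun k => ENNReal.ofReal (min (τ k / l) (l / τ k) ^ μ) with hF
  set r := ENNReal.ofReal (c ^ μ) with hr
  have hpow : ∀ n : ℕ, ENNReal.ofReal ((c ^ n) ^ μ) = r ^ n := fun n => by
    rw [hr, ← ENNReal.ofReal_pow (by positivity)]
    congr 1
    rw [← Real.rpow_natCast, ← Real.rpow_natCast, ← Real.rpow_mul hc0.le, ← Real.rpow_mul hc0.le,
      mul_comm]
  have tail : ∀ n, F (n + K) ≤ r ^ n := fun n => by
    rw [← hpow]
    apply ENNReal.ofReal_le_ofReal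
    apply Real.rpow_le_rpow (le_min (div_nonneg (hpos _).le hl.le) (div_nonneg hl.le (hpos _).le))
      _ hμ.le
    refine (min_le_left _ _).trans ?_
    rw [div_le_iff₀ hl, add_comm]
    exact (h.le_pow K n).trans (by gcongr)
  have head : ∀ n ∈ Finset.range K, F (K - 1 - n) ≤ r ^ n := fun n hn => by
    have hn' : n < K := Finset.mem_range.1 hn
    rw [← hpow]
    apply ENNReal.ofReal_le_ofReal
    apply Real.rpow_le_rpow (le_min (div_nonneg (hpos _).le hl.le) (div_nonneg hl.le (hpos _).le))
      _ hμ.le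
    refine (min_le_right _ _).trans ?_
    rw [div_le_iff₀ (hpos _)]
    have := h.le_pow (K - 1 - n) n
    rw [Nat.sub_add_cancel (by omega)] at this
    exact (hbelow (K - 1) (by omega)).trans this
  calc ∑' k, F k = ∑ k ∈ Finset.range K, F k + ∑' n, F (n + K) :=
        (ENNReal.summable.sum_add_tsum_nat_add' ).symm
    _ ≤ ∑' n, r ^ n + ∑' n, r ^ n := by
        gcongr
        · rw [← Finset.sum_range_reflect]
          exact (Finset.sum_le_sum head).trans (ENNReal.sum_le_tsum _)
        · exact tail _
    _ = _ := by rw [ENNReal.tsum_geometric, two_mul]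

theorem GeomDecay.exists_tsum_min_le {τ : ℕ → ℝ} {c : ℝ} (h : GeomDecay τ c) {μ : ℝ}
    (hμ : 0 < μ) : ∃ C : ℝ≥0, ∀ l : ℝ, 0 < l →
      ∑' k, ENNReal.ofReal (min (τ k / l) (l / τ k) ^ μ) ≤ C := by
  have hlt : ENNReal.ofReal (c ^ μ) < 1 := by
    rw [ENNReal.ofReal_lt_one]; exact Real.rpow_lt_one h.1.le h.2.1 hμ
  have hfin : 2 * (1 - ENNReal.ofReal (c ^ μ))⁻¹ ≠ ∞ :=
    ENNReal.mul_ne_top (by simp) (ENNReal.inv_ne_top.2 (tsub_pos_of_lt hlt).ne')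
  refine ⟨(2 * (1 - ENNReal.ofReal (c ^ μ))⁻¹).toNNReal, fun l hl => ?_⟩
  rw [ENNReal.coe_toNNReal hfin]
  exact h.tsum_min_le hμ hl

theorem GeomDecay.tsum_rpow_lt_top {τ : ℕ → ℝ} {c : ℝ} (h : GeomDecay τ c) {s : ℝ}
    (hs : 0 < s) : ∑' k, ENNReal.ofReal (τ k ^ s) < ∞ := by
  have hlt : ENNReal.ofReal (c ^ s) < 1 := by
    rw [ENNReal.ofReal_lt_one]; exact Real.rpow_lt_one h.1.le h.2.1 hs
  have hc0 := h.1
  calc ∑' k, ENNReal.ofReal (τ k ^ s)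
      ≤ ∑' k, ENNReal.ofReal (τ 0 ^ s) * ENNReal.ofReal (c ^ s) ^ k :=
        ENNReal.tsum_le_tsum fun k => by
          rw [← ENNReal.ofReal_pow (by positivity), ← ENNReal.ofReal_mul
            (Real.rpow_nonneg (h.2.2.1 0).le _)]
          apply ENNReal.ofReal_le_ofReal
          have h1 := h.le_pow 0 k
          rw [zero_add] at h1
          calc τ k ^ s ≤ (c ^ k * τ 0) ^ s := Real.rpow_le_rpow (h.2.2.1 k).le h1 hs.le
            _ = τ 0 ^ s * (c ^ s) ^ k := by
                rw [Real.mul_rpow (by positivity) (h.2.2.1 0).le, mul_comm]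
                congr 1
                rw [← Real.rpow_natCast, ← Real.rpow_natCast, ← Real.rpow_mul hc0.le,
                  ← Real.rpow_mul hc0.le, mul_comm]
    _ = ENNReal.ofReal (τ 0 ^ s) * (1 - ENNReal.ofReal (c ^ s))⁻¹ := by
        rw [ENNReal.tsum_mul_left, ENNReal.tsum_geometric]
    _ < ∞ := ENNReal.mul_lt_top ENNReal.ofReal_lt_top
        (ENNReal.inv_lt_top.2 (tsub_pos_of_lt hlt))

/-! ### Continuous embeddings of function spaces -/

/-- `S` is contained in `T` with a continuous inclusion. -/
def Embeds {I : Type*} (S T : FunctionSpace I) : Prop :=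
  ∃ C : ℝ≥0, ∀ f ∈ S.carrier, f ∈ T.carrier ∧ T.size f ≤ C * S.size f

theorem Embeds.trans {I : Type*} {S T U : FunctionSpace I} (h1 : Embeds S T) (h2 : Embeds T U) :
    Embeds S U := by
  obtain ⟨C, hC⟩ := h1
  obtain ⟨D, hD⟩ := h2
  refine ⟨D * C, fun f hf => ⟨(hD f (hC f hf).1).1, ?_⟩⟩
  calc U.size f ≤ D * T.size f := (hD f (hC f hf).1).2
    _ ≤ D * (C * S.size f) := by gcongr; exact (hC f hf).2
    _ = _ := by rw [← mul_assoc]; push_cast; rfl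

theorem sameSpace_of_embeds {I : Type*} {S T : FunctionSpace I} (h1 : Embeds S T)
    (h2 : Embeds T S) : SameSpace S T := by
  obtain ⟨C, hC⟩ := h1
  obtain ⟨D, hD⟩ := h2
  refine ⟨Set.Subset.antisymm (fun f hf => (hC f hf).1) fun f hf => (hD f hf).1, max C D,
    fun f hf => ⟨((hD f (hC f hf).1).2).trans ?_, ((hC f hf).2).trans ?_⟩⟩ <;> gcongr
  · exact le_max_right _ _
  · exact le_max_left _ _

/-- An embedding of an atomic space may be checked on representations. -/
theorem embeds_of_representation {I : Type*} [MeasurableSpace I] {m : Measure I}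
    {P : ℕ → Finset (Set I)} {A : ℕ → Set I → Set (I → ℂ)} {p : ℝ} {q : ℝ≥0∞}
    {T : FunctionSpace I} (C : ℝ≥0) (hcar : ∀ f, MemLp f (ENNReal.ofReal p) m →
      ∀ c a, IsRepresentation m P A p f c a → coeffNorm P p q c < ∞ →
        f ∈ T.carrier ∧ T.size f ≤ C * coeffNorm P p q c) :
    Embeds (atomicSpace m P A p q) T := by
  refine ⟨C + 1, fun f hf => ?_⟩
  obtain ⟨hfp, c, a, hr, hc⟩ := hf
  refine ⟨(hcar f hfp c a hr hc).1, ?_⟩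
  -- The infimum also runs over representations of infinite coefficient norm. A nonzero constant
  -- makes the bound trivial for those, hence C + 1 instead of C.
  have hC0 : ((C + 1 : ℝ≥0) : ℝ≥0∞) ≠ 0 := by simp
  rw [← ENNReal.div_le_iff' hC0 ENNReal.coe_ne_top]
  refine le_sInf ?_
  rintro t ⟨c, a, hr, rfl⟩
  rw [ENNReal.div_le_iff' hC0 ENNReal.coe_ne_top]
  rcases eq_or_ne (coeffNorm P p q c) ∞ with h | h
  · rw [h, ENNReal.mul_top hC0]; exact le_top
  · refine (hcar f hfp c a hr h.lt_top).2.trans ?_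
    gcongr
    simp

theorem embeds_atomicSpace {I : Type*} [MeasurableSpace I] {m : Measure I}
    {P : ℕ → Finset (Set I)} {A : ℕ → Set I → Set (I → ℂ)} {p : ℝ} {q : ℝ≥0∞}
    {S : FunctionSpace I} (C : ℝ≥0) (h : ∀ f ∈ S.carrier, S.size f < ∞ ∧
      MemLp f (ENNReal.ofReal p) m ∧
      ∃ c a, IsRepresentation m P A p f c a ∧ coeffNorm P p q c ≤ C * S.size f) :
    Embeds S (atomicSpace m P A p q) := by
  refine ⟨C, fun f hf => ?_⟩
  obtain ⟨h0, h1, c, a, h2, h3⟩ := h f hf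
  exact ⟨⟨h1, c, a, h2, h3.trans_lt (ENNReal.mul_lt_top ENNReal.coe_lt_top h0)⟩,
    le_trans (sInf_le (show _ ∈ {t | ∃ c a, IsRepresentation m P A p f c a ∧
      t = coeffNorm P p q c} from ⟨c, a, h2, rfl⟩)) h3⟩

end GridBesov

namespace GridBesov

/-! ### Nested partitions -/

/-- A nested sequence of finite partitions up to null sets that generates the sigma-algebra. -/
structure IsPartitionGrid {I : Type*} [mI : MeasurableSpace I] (m : Measure I)
    (H : ℕ → Finset (Set I)) : Prop where
  measurable : ∀ k, ∀ Q ∈ H k, MeasurableSet Q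
  pos : ∀ k, ∀ Q ∈ H k, 0 < m Q
  disjoint : ∀ k, ∀ Q ∈ H k, ∀ R ∈ H k, Q ≠ R → Disjoint Q R
  cover : ∀ k, m {x | ∀ Q ∈ H k, x ∉ Q} = 0
  nested : ∀ k, ∀ Q ∈ H (k + 1), ∃ R ∈ H k, Q ⊆ R
  generates : mI = MeasurableSpace.generateFrom {Q | ∃ k, Q ∈ H k}

theorem IsGoodGrid.isPartitionGrid {I : Type*} [mI : MeasurableSpace I] {m : Measure I}
    {H : ℕ → Finset (Set I)} (h : IsGoodGrid m H) : IsPartitionGrid m H :=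
  ⟨h.measurable, h.pos, h.disjoint, h.cover, h.nested, h.generates⟩

namespace IsPartitionGrid

variable {I : Type*} [mI : MeasurableSpace I] {m : Measure I} {H : ℕ → Finset (Set I)}

theorem real_pos [IsFiniteMeasure m] (h : IsPartitionGrid m H) {k : ℕ} {Q : Set I}
    (hQ : Q ∈ H k) : 0 < m.real Q :=
  ENNReal.toReal_pos (h.pos k Q hQ).ne' (measure_ne_top _ _)

theorem eq_of_mem (h : IsPartitionGrid m H) {k : ℕ} {Q R : Set I} (hQ : Q ∈ H k) (hR : R ∈ H k)
    {x : I} (hx : x ∈ Q) (hx' : x ∈ R) : Q = R := by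
  by_contra hne
  exact Set.disjoint_left.1 (h.disjoint k Q hQ R hR hne) hx hx'

theorem ae_mem (h : IsPartitionGrid m H) (k : ℕ) : ∀ᵐ x ∂m, ∃ Q ∈ H k, x ∈ Q := by
  rw [ae_iff]
  simpa using h.cover k

theorem exists_ancestor (h : IsPartitionGrid m H) {j k : ℕ} (hjk : j ≤ k) {Q : Set I}
    (hQ : Q ∈ H k) : ∃ R ∈ H j, Q ⊆ R := by
  induction k, hjk using Nat.le_induction generalizing Q with
  | base => exact ⟨Q, hQ, Subset.rfl⟩
  | succ k _ ih =>
    obtain ⟨R, hR, hQR⟩ := h.nested k Q hQ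
    obtain ⟨S, hS, hRS⟩ := ih hR
    exact ⟨S, hS, hQR.trans hRS⟩

theorem subset_or_disjoint (h : IsPartitionGrid m H) {j k : ℕ} (hjk : j ≤ k) {Q R : Set I}
    (hQ : Q ∈ H k) (hR : R ∈ H j) : Q ⊆ R ∨ Disjoint Q R := by
  obtain ⟨S, hS, hQS⟩ := h.exists_ancestor hjk hQ
  by_cases hSR : S = R
  · exact Or.inl (hSR ▸ hQS)
  · exact Or.inr ((h.disjoint j S hS R hR hSR).mono_left hQS)

theorem pairwiseDisjoint (h : IsPartitionGrid m H) (k : ℕ) :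
    (H k : Set (Set I)).PairwiseDisjoint id :=
  fun Q hQ R hR hne => h.disjoint k Q hQ R hR hne

theorem restrict_biUnion (h : IsPartitionGrid m H) (k : ℕ) :
    m.restrict (⋃ Q ∈ H k, id Q) = m := by
  apply Measure.restrict_eq_self_of_ae_mem
  filter_upwards [h.ae_mem k] with x hx
  simpa using hx

theorem lintegral_eq_sum (h : IsPartitionGrid m H) (k : ℕ) (F : I → ℝ≥0∞) :
    ∫⁻ x, F x ∂m = ∑ Q ∈ H k, ∫⁻ x in Q, F x ∂m := by
  conv_lhs => rw [← h.restrict_biUnion k]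
  rw [lintegral_biUnion_finset (h.pairwiseDisjoint k) (h.measurable k)]
  rfl

theorem setIntegral_eq_sum (h : IsPartitionGrid m H) (k : ℕ) {F : I → ℂ} (hF : Integrable F m)
    {S : Set I} (hS : MeasurableSet S) :
    ∫ x in S, F x ∂m = ∑ Q ∈ H k, ∫ x in Q ∩ S, F x ∂m := by
  rw [← integral_indicator hS]
  conv_lhs => rw [← h.restrict_biUnion k]
  rw [integral_biUnion_finset (s := id) _ (h.measurable k) (h.pairwiseDisjoint k)
    fun _ _ => (hF.indicator hS).integrableOn]
  refine Finset.sum_congr rfl fun Q _ => ?_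
  rw [setIntegral_indicator hS]
  rfl

theorem exists_mem_inter (h : IsPartitionGrid m H) (k : ℕ) {S : Set I} (hS : 0 < m S) :
    ∃ Q ∈ H k, (Q ∩ S).Nonempty := by
  by_contra hcon
  push Not at hcon
  refine hS.ne' (measure_mono_null (fun x hx => ?_) (h.cover k))
  intro Q hQ hxQ
  exact (hcon Q hQ).subset ⟨hxQ, hx⟩

/-! ### Averages -/

theorem gridAverage_eq (h : IsPartitionGrid m H) (f : I → ℂ) {k : ℕ} {Q : Set I} (hQ : Q ∈ H k)
    {x : I} (hx : x ∈ Q) : gridAverage m H f k x = ⨍ y in Q, f y ∂m := by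
  unfold gridAverage
  rw [Finset.sum_eq_single_of_mem Q hQ, Set.indicator_of_mem hx]
  intro R hR hne
  exact Set.indicator_of_notMem (fun hxR => hne (h.eq_of_mem hR hQ hxR hx)) _

theorem measurable_gridAverage (h : IsPartitionGrid m H) (f : I → ℂ) (k : ℕ) :
    Measurable (gridAverage m H f k) :=
  Finset.measurable_sum _ fun Q hQ => measurable_const.indicator (h.measurable k Q hQ)

theorem measurable_martingaleDiff (h : IsPartitionGrid m H) (f : I → ℂ) (k : ℕ) :
    Measurable (martingaleDiff m H f k) := by
  cases k with
  | zero => exact h.measurable_gridAverage f 0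
  | succ k => exact (h.measurable_gridAverage f (k + 1)).sub (h.measurable_gridAverage f k)

/-- Jensen's inequality on Q, multiplied by m Q so that summing over a partition gives the L^p
contraction of the averaging operator. -/
theorem enorm_setAverage_rpow_le [IsFiniteMeasure m] {f : I → ℂ} (hf : AEStronglyMeasurable f m)
    {p : ℝ} (hp : 1 ≤ p) {Q : Set I} (hQ : 0 < m Q) :
    m Q * ‖⨍ y in Q, f y ∂m‖ₑ ^ p ≤ ∫⁻ y in Q, ‖f y‖ₑ ^ p ∂m := by
  have hp0 : 0 < p := by linarith
  have hQ' : m Q ≠ ∞ := measure_ne_top _ _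
  have e0 : ‖⨍ y in Q, f y ∂m‖ₑ ≤ (m Q)⁻¹ * ∫⁻ y in Q, ‖f y‖ₑ ∂m := by
    rw [setAverage_eq, enorm_smul]
    gcongr
    · rw [Real.enorm_eq_ofReal (by positivity), measureReal_def,
        ENNReal.ofReal_inv_of_pos (ENNReal.toReal_pos hQ.ne' hQ'), ENNReal.ofReal_toReal hQ']
    · exact enorm_integral_le_lintegral_enorm _
  have e1 := eLpNorm_le_eLpNorm_mul_rpow_measure_univ (μ := m.restrict Q) (p := 1)
    (q := ENNReal.ofReal p) (f := f) (by simpa using hp) hf.restrict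
  rw [eLpNorm_one_eq_lintegral_enorm, eLpNorm_eq_lintegral_rpow_enorm_toReal (by simpa using hp0)
    ENNReal.ofReal_ne_top, ENNReal.toReal_ofReal hp0.le, Measure.restrict_apply_univ] at e1
  set A := ∫⁻ y in Q, ‖f y‖ₑ ^ p ∂m
  calc m Q * ‖⨍ y in Q, f y ∂m‖ₑ ^ p
      ≤ m Q * ((m Q)⁻¹ * (A ^ (1 / p) * m Q ^ (1 - 1 / p))) ^ p := by
        gcongr
        refine e0.trans ?_
        gcongr
        simpa using e1
    _ = m Q * ((m Q) ^ (-1 : ℝ) * m Q ^ (1 - 1 / p)) ^ p * A := by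
        rw [ENNReal.rpow_neg_one, mul_comm (A ^ (1 / p)), ← mul_assoc,
          ENNReal.mul_rpow_of_nonneg _ (A ^ (1 / p)) hp0.le, ← ENNReal.rpow_mul,
          one_div_mul_cancel hp0.ne', ENNReal.rpow_one, mul_assoc]
    _ = A := by
        rw [← ENNReal.rpow_add _ _ hQ.ne' hQ', ← ENNReal.rpow_mul]
        nth_rw 1 [← ENNReal.rpow_one (m Q)]
        rw [← ENNReal.rpow_add _ _ hQ.ne' hQ']
        have : 1 + (-1 + (1 - 1 / p)) * p = 0 := by field_simp; ring
        rw [this, ENNReal.rpow_zero, one_mul]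

/-- Functions that are constant on the elements of a partition. -/
theorem lintegral_rpow_of_const (h : IsPartitionGrid m H) {u : I → ℂ} {k : ℕ} {v : Set I → ℂ}
    (hu : ∀ Q ∈ H k, ∀ x ∈ Q, u x = v Q) (p : ℝ) :
    ∫⁻ x, ‖u x‖ₑ ^ p ∂m = ∑ Q ∈ H k, m Q * ‖v Q‖ₑ ^ p := by
  rw [h.lintegral_eq_sum k]
  refine Finset.sum_congr rfl fun Q hQ => ?_
  rw [setLIntegral_congr_fun (h.measurable k Q hQ) (fun x hx => by rw [hu Q hQ x hx]),
    setLIntegral_const, mul_comm]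

theorem eLpNorm_gridAverage_le [IsFiniteMeasure m] (h : IsPartitionGrid m H) {f : I → ℂ}
    (hf : AEStronglyMeasurable f m) {p : ℝ} (hp : 1 ≤ p) (k : ℕ) :
    eLpNorm (gridAverage m H f k) (ENNReal.ofReal p) m ≤ eLpNorm f (ENNReal.ofReal p) m := by
  have hp0 : 0 < p := by linarith
  rw [eLpNorm_eq_lintegral_rpow_enorm_toReal (by simpa using hp0) ENNReal.ofReal_ne_top,
    eLpNorm_eq_lintegral_rpow_enorm_toReal (by simpa using hp0) ENNReal.ofReal_ne_top,
    ENNReal.toReal_ofReal hp0.le]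
  refine ENNReal.rpow_le_rpow ?_ (by positivity)
  rw [h.lintegral_rpow_of_const (fun Q hQ x hx => h.gridAverage_eq f hQ hx) p,
    h.lintegral_eq_sum k]
  exact Finset.sum_le_sum fun Q hQ => enorm_setAverage_rpow_le hf hp (h.pos k Q hQ)

theorem eLpNorm_martingaleDiff_le [IsFiniteMeasure m] (h : IsPartitionGrid m H) {f : I → ℂ}
    (hf : AEStronglyMeasurable f m) {p : ℝ} (hp : 1 ≤ p) (k : ℕ) :
    eLpNorm (martingaleDiff m H f k) (ENNReal.ofReal p) m ≤
      2 * eLpNorm f (ENNReal.ofReal p) m := by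
  cases k with
  | zero =>
    refine (h.eLpNorm_gridAverage_le hf hp 0).trans ?_
    rw [two_mul]
    exact le_self_add
  | succ k =>
    refine (eLpNorm_sub_le (h.measurable_gridAverage f (k + 1)).aestronglyMeasurable
      (h.measurable_gridAverage f k).aestronglyMeasurable (by simpa using hp)).trans ?_
    rw [two_mul]
    exact add_le_add (h.eLpNorm_gridAverage_le hf hp _) (h.eLpNorm_gridAverage_le hf hp _)

theorem _root_.GridBesov.gridAverage_add {f g : I → ℂ} (hf : Integrable f m)
    (hg : Integrable g m) (k : ℕ) (x : I) :
    gridAverage m H (fun x => f x + g x) k x = gridAverage m H f k x + gridAverage m H g k x := by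
  unfold gridAverage
  rw [← Finset.sum_add_distrib]
  refine Finset.sum_congr rfl fun Q _ => ?_
  by_cases hx : x ∈ Q
  · simp only [Set.indicator_of_mem hx, setAverage_eq]
    rw [integral_add hf.integrableOn hg.integrableOn, smul_add]
  · simp [Set.indicator_of_notMem hx]

theorem _root_.GridBesov.martingaleDiff_add {f g : I → ℂ} (hf : Integrable f m)
    (hg : Integrable g m) (k : ℕ) (x : I) :
    martingaleDiff m H (fun x => f x + g x) k x =
      martingaleDiff m H f k x + martingaleDiff m H g k x := by
  cases k with
  | zero => exact gridAverage_add hf hg 0 x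
  | succ k =>
    simp only [martingaleDiff, gridAverage_add hf hg]
    ring

theorem _root_.GridBesov.martingaleDiff_sum {g : ℕ → I → ℂ} (hg : ∀ n, Integrable (g n) m)
    (k n : ℕ) (x : I) :
    martingaleDiff m H (fun x => ∑ i ∈ Finset.range n, g i x) k x =
      ∑ i ∈ Finset.range n, martingaleDiff m H (g i) k x := by
  induction n with
  | zero =>
    cases k <;> simp [martingaleDiff, gridAverage]
  | succ n ih =>
    simp only [Finset.sum_range_succ]
    rw [martingaleDiff_add (integrable_finsetSum _ fun i _ => hg i) (hg n), ih]

/-- The value of a martingale difference. -/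
theorem martingaleDiff_succ_eq (h : IsPartitionGrid m H) (f : I → ℂ) {k : ℕ} {Q R : Set I}
    (hQ : Q ∈ H (k + 1)) (hR : R ∈ H k) (hQR : Q ⊆ R) {x : I} (hx : x ∈ Q) :
    martingaleDiff m H f (k + 1) x = (⨍ y in Q, f y ∂m) - ⨍ y in R, f y ∂m := by
  simp only [martingaleDiff]
  rw [h.gridAverage_eq f hQ hx, h.gridAverage_eq f hR (hQR hx)]

theorem _root_.GridBesov.setAverage_eq_of_const [IsFiniteMeasure m] {u : I → ℂ} {Q : Set I}
    (hQm : MeasurableSet Q) (hQ : 0 < m Q) {v : ℂ} (hu : ∀ x ∈ Q, u x = v) :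
    ⨍ y in Q, u y ∂m = v := by
  rw [setAverage_eq, setIntegral_congr_fun hQm hu, setIntegral_const, smul_smul,
    inv_mul_cancel₀ (show 0 < m.real Q from ENNReal.toReal_pos hQ.ne' (measure_ne_top _ _)).ne',
    one_smul]

theorem _root_.GridBesov.norm_setAverage_sub_le [IsFiniteMeasure m] {u : I → ℂ}
    (hu : Integrable u m) {Q : Set I} (hQ : 0 < m Q) {v : ℂ} {D : ℝ}
    (hD : ∀ x ∈ Q, ‖u x - v‖ ≤ D) : ‖(⨍ y in Q, u y ∂m) - v‖ ≤ D := by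
  have hpos : 0 < m.real Q := ENNReal.toReal_pos hQ.ne' (measure_ne_top _ _)
  have e : (⨍ y in Q, u y ∂m) - v = (m.real Q)⁻¹ • ∫ y in Q, (u y - v) ∂m := by
    rw [integral_sub hu.integrableOn (integrable_const _), setIntegral_const, smul_sub,
      smul_smul, inv_mul_cancel₀ hpos.ne', one_smul, setAverage_eq]
  rw [e, norm_smul, norm_inv, Real.norm_of_nonneg hpos.le, inv_mul_le_iff₀ hpos, mul_comm]
  exact norm_setIntegral_le_of_norm_le_const (measure_lt_top _ _) hD

/-! ### Convergence of the averages -/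

/-- The averages are the conditional expectations on the sigma-algebras generated by the first k
families. These exhaust the whole sigma-algebra by `generates`, so Lévy's upward theorem applies. -/
theorem ae_tendsto_gridAverage [IsFiniteMeasure m] (h : IsPartitionGrid m H) {f : I → ℂ}
    (hf : Integrable f m) : ∀ᵐ x ∂m, Tendsto (fun k => gridAverage m H f k x) atTop (𝓝 (f x)) := by
  let F : ℕ → MeasurableSpace I := fun k =>
    MeasurableSpace.generateFrom {Q | ∃ j ≤ k, Q ∈ H j}
  have hle : ∀ k, F k ≤ mI := fun k => MeasurableSpace.generateFrom_le fun Q ⟨j, _, hQ⟩ =>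
    h.measurable j Q hQ
  let ℱ : Filtration ℕ mI := ⟨F, fun i j hij => MeasurableSpace.generateFrom_mono
    fun Q ⟨l, hl, hQ⟩ => ⟨l, hl.trans hij, hQ⟩, hle⟩
  have hsup : ⨆ n, ℱ n = mI := by
    refine le_antisymm (iSup_le hle) ?_
    conv_lhs => rw [h.generates]
    refine MeasurableSpace.generateFrom_le fun Q ⟨k, hQ⟩ => ?_
    exact (le_iSup (fun n => ℱ n) k) _ (MeasurableSpace.measurableSet_generateFrom ⟨k, le_rfl, hQ⟩)
  -- The sets of H k behave as atoms of F k, so an integral over S in F k is a sum of integrals over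
  -- whole cells, where averaging changes nothing.
  have hatom : ∀ k, ∀ S, MeasurableSet[F k] S → ∀ Q ∈ H k, Q ⊆ S ∨ Disjoint Q S := by
    intro k S hS Q hQ
    induction S, hS using MeasurableSpace.generateFrom_induction with
    | hC S hS _ =>
      obtain ⟨j, hj, hS⟩ := hS
      exact h.subset_or_disjoint hj hQ hS
    | empty => exact Or.inr (disjoint_empty _)
    | compl S _ ih =>
      rcases ih with ih | ih
      · exact Or.inr (disjoint_compl_right_iff_subset.2 ih)
      · exact Or.inl (subset_compl_iff_disjoint_right.2 ih)
    | iUnion S _ ih =>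
      by_cases hex : ∃ n, Q ⊆ S n
      · obtain ⟨n, hn⟩ := hex
        exact Or.inl (hn.trans (subset_iUnion S n))
      · push Not at hex
        exact Or.inr (disjoint_iUnion_right.2 fun n => (ih n).resolve_left (hex n))
  have hint : ∀ k, Integrable (gridAverage m H f k) m := fun k =>
    integrable_finsetSum _ fun Q hQ => (integrable_const _).indicator (h.measurable k Q hQ)
  have hcond : ∀ k, gridAverage m H f k =ᵐ[m] m[f|F k] := fun k => by
    refine ae_eq_condExp_of_forall_setIntegral_eq (hle k) hf
      (fun S _ _ => (hint k).integrableOn) (fun S hS _ => ?_) ?_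
    · rw [h.setIntegral_eq_sum k (hint k) (hle k _ hS), h.setIntegral_eq_sum k hf (hle k _ hS)]
      refine Finset.sum_congr rfl fun Q hQ => ?_
      rcases hatom k S hS Q hQ with hQS | hQS
      · rw [inter_eq_left.2 hQS, setIntegral_congr_fun (h.measurable k Q hQ)
          (fun x hx => h.gridAverage_eq f hQ hx), setIntegral_const, setAverage_eq, smul_smul,
          mul_inv_cancel₀ (h.real_pos hQ).ne', one_smul]
      · rw [hQS.inter_eq]
        simp
    · refine StronglyMeasurable.aestronglyMeasurable ?_
      refine Finset.stronglyMeasurable_fun_sum _ fun Q hQ => ?_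
      exact stronglyMeasurable_const.indicator
        (MeasurableSpace.measurableSet_generateFrom ⟨k, le_rfl, hQ⟩)
  -- Real functionals commute with conditional expectation; convergence in ℂ follows from L = Re and
  -- L = Im.
  have key : ∀ L : ℂ →L[ℝ] ℝ,
      ∀ᵐ x ∂m, Tendsto (fun k => L (gridAverage m H f k x)) atTop (𝓝 (L (f x))) := fun L => by
    have h1 := MeasureTheory.tendsto_ae_condExp (ℱ := ℱ) (μ := m) (fun x => L (f x))
    have h2 : m[(fun x => L (f x))|⨆ n, ℱ n] =ᵐ[m] fun x => L (f x) := by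
      rw [hsup]
      exact condExp_of_aestronglyMeasurable' le_rfl (L.continuous.comp_aestronglyMeasurable hf.1)
        (L.integrable_comp hf)
    have h3 : ∀ᵐ x ∂m, ∀ k, m[(fun x => L (f x))|ℱ k] x = L (gridAverage m H f k x) := by
      rw [ae_all_iff]
      intro k
      filter_upwards [ContinuousLinearMap.comp_condExp_comm (m := F k) hf L, hcond k] with x hx hx'
      rw [hx']
      exact hx.symm
    filter_upwards [h1, h2, h3] with x h1 h2 h3
    rw [h2] at h1
    exact h1.congr h3
  filter_upwards [key Complex.reCLM, key Complex.imCLM] with x h1 h2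
  have h3 := ((Complex.continuous_ofReal.tendsto _).comp h1).add
    (((Complex.continuous_ofReal.tendsto _).comp h2).mul_const Complex.I)
  simpa [Function.comp_def, Complex.re_add_im] using h3

theorem _root_.GridBesov.sum_martingaleDiff (f : I → ℂ) (n : ℕ) (x : I) :
    ∑ k ∈ Finset.range (n + 1), martingaleDiff m H f k x = gridAverage m H f n x := by
  induction n with
  | zero => simp [martingaleDiff]
  | succ n ih => rw [Finset.sum_range_succ, ih]; simp [martingaleDiff]

/-- If the norms of the martingale differences are summable, `f` is the sum of its martingale
differences in `L^p`. -/
theorem tendsto_sum_martingaleDiff [IsFiniteMeasure m] (h : IsPartitionGrid m H) {f : I → ℂ}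
    (hf : Integrable f m) {p : ℝ} (hp : 1 ≤ p)
    (hsum : ∑' k, eLpNorm (martingaleDiff m H f k) (ENNReal.ofReal p) m < ∞) :
    Tendsto (fun n => eLpNorm (fun x => f x - ∑ k ∈ Finset.range n, martingaleDiff m H f k x)
      (ENNReal.ofReal p) m) atTop (𝓝 0) := by
  have hmeas := fun k => (h.measurable_martingaleDiff f k).aestronglyMeasurable (μ := m)
  refine tendsto_of_tendsto_of_tendsto_of_le_of_le tendsto_const_nhds
    (ENNReal.tendsto_sum_nat_add _ hsum.ne) (fun _ => zero_le) fun n => ?_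
  -- The remainder after n terms is the a.e. limit of the sums of later differences, so Fatou's
  -- lemma bounds its norm by the tail of the convergent series.
  refine Lp.eLpNorm_le_of_ae_tendsto (u := atTop)
    (f := fun N x => ∑ k ∈ Finset.range N, martingaleDiff m H f (k + n) x)
    (Eventually.of_forall fun N => ?_) (fun N => ?_) ?_
  · have := eLpNorm_sum_le (μ := m) (p := ENNReal.ofReal p) (s := Finset.range N)
      (f := fun k => martingaleDiff m H f (k + n)) (fun k _ => hmeas _) (by simpa using hp)
    refine le_trans (le_of_eq ?_) (this.trans (ENNReal.sum_le_tsum _))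
    congr 1
    ext x
    simp
  · exact (Finset.measurable_fun_sum _ fun k _ =>
      h.measurable_martingaleDiff f _).aestronglyMeasurable
  · filter_upwards [h.ae_tendsto_gridAverage hf] with x hx
    have h1 : Tendsto (fun N => ∑ k ∈ Finset.range (N + 1), martingaleDiff m H f k x) atTop
        (𝓝 (f x)) := by simpa only [sum_martingaleDiff] using hx
    have h2 := (tendsto_add_atTop_iff_nat
      (f := fun N => ∑ k ∈ Finset.range N, martingaleDiff m H f k x) 1).1 h1
    have h3 := ((tendsto_add_atTop_iff_nat n).2 h2).sub_const
      (∑ k ∈ Finset.range n, martingaleDiff m H f k x)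
    refine h3.congr fun N => ?_
    rw [add_comm N n, Finset.sum_range_add, add_sub_cancel_left]
    simp only [add_comm]

end IsPartitionGrid

end GridBesov

namespace GridBesov

/-! ### Scaled grids -/

/-- A nested sequence of partitions such that the elements of the `k`-th one have measure
comparable to `σ k`, where `σ` decays geometrically. -/
structure IsScaledGrid {I : Type*} [MeasurableSpace I] (m : Measure I)
    (H : ℕ → Finset (Set I)) (σ : ℕ → ℝ) : Prop extends IsPartitionGrid m H where
  decay : ∃ c, GeomDecay σ c
  growth : ∃ A : ℝ, 0 < A ∧ ∀ k, σ k ≤ A * σ (k + 1)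
  size : ∃ A : ℝ, 0 < A ∧ ∀ k, ∀ Q ∈ H k, σ k ≤ A * m.real Q ∧ m.real Q ≤ A * σ k

/-- The Gu-Taibleson space with an arbitrary sequence of scales. -/
noncomputable def scaledGT {I : Type*} [MeasurableSpace I] (m : Measure I)
    (H : ℕ → Finset (Set I)) (σ : ℕ → ℝ) (s p : ℝ) (q : ℝ≥0∞) : FunctionSpace I where
  carrier := {f | Integrable f m ∧
    lqNorm q (fun k => ENNReal.ofReal (σ k ^ (-s)) *
      eLpNorm (martingaleDiff m H f k) (ENNReal.ofReal p) m) < ∞}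
  size f := lqNorm q fun k => ENNReal.ofReal (σ k ^ (-s)) *
      eLpNorm (martingaleDiff m H f k) (ENNReal.ofReal p) m

variable {I : Type*} [mI : MeasurableSpace I] {m : Measure I}

theorem IsScaledGrid.scale_pos {H : ℕ → Finset (Set I)} {σ : ℕ → ℝ} (h : IsScaledGrid m H σ)
    (k : ℕ) : 0 < σ k := by
  obtain ⟨c, hc⟩ := h.decay
  exact hc.2.2.1 k

theorem eLpNorm_ofReal_eq {p : ℝ} (hp : 1 ≤ p) (u : I → ℂ) :
    eLpNorm u (ENNReal.ofReal p) m = (∫⁻ x, ‖u x‖ₑ ^ p ∂m) ^ (1 / p) := by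
  have hp0 : 0 < p := by linarith
  rw [eLpNorm_eq_lintegral_rpow_enorm_toReal (by simpa using hp0) ENNReal.ofReal_ne_top,
    ENNReal.toReal_ofReal hp0.le]

theorem eLpNorm_indicator_ofReal_eq {p : ℝ} (hp : 1 ≤ p) (u : I → ℂ) {B : Set I}
    (hB : MeasurableSet B) :
    eLpNorm (B.indicator u) (ENNReal.ofReal p) m = (∫⁻ x in B, ‖u x‖ₑ ^ p ∂m) ^ (1 / p) := by
  rw [eLpNorm_indicator_eq_eLpNorm_restrict hB, eLpNorm_ofReal_eq hp]

/-! ### Sums of Souza atoms -/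

section Souza

variable {W : ℕ → Finset (Set I)}

theorem levelSum_souza_eq (h : IsPartitionGrid m W) (s p : ℝ) (c : ℕ → Set I → ℂ) {k : ℕ}
    {Q : Set I} (hQ : Q ∈ W k) {x : I} (hx : x ∈ Q) :
    levelSum W c (fun _ Q => souzaAtom m s p Q) k x =
      c k Q * ((m.real Q ^ (s - 1 / p) : ℝ) : ℂ) := by
  unfold levelSum souzaAtom
  rw [Finset.sum_eq_single_of_mem Q hQ]
  · simp only [Set.indicator_of_mem hx]
  intro R hR hne
  simp only
  rw [Set.indicator_of_notMem (fun hxR => hne (h.eq_of_mem hR hQ hxR hx)), mul_zero]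

theorem measurable_levelSum_souza (h : IsPartitionGrid m W) (s p : ℝ) (c : ℕ → Set I → ℂ)
    (k : ℕ) : Measurable (levelSum W c (fun _ Q => souzaAtom m s p Q) k) :=
  Finset.measurable_fun_sum _ fun Q hQ =>
    ((measurable_const.indicator (h.measurable k Q hQ))).const_mul _

theorem lintegral_levelSum_souza [IsFiniteMeasure m] (h : IsPartitionGrid m W) (s : ℝ) {p : ℝ}
    (hp : 1 ≤ p) (c : ℕ → Set I → ℂ) (k : ℕ) {B : Set I} (hB : MeasurableSet B) :
    ∫⁻ x in B, ‖levelSum W c (fun _ Q => souzaAtom m s p Q) k x‖ₑ ^ p ∂m =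
      ∑ Q ∈ W k, ENNReal.ofReal (m.real Q ^ (s * p - 1)) * m (Q ∩ B) * ‖c k Q‖ₑ ^ p := by
  have hp0 : 0 < p := by linarith
  rw [← lintegral_indicator hB, h.lintegral_eq_sum k]
  refine Finset.sum_congr rfl fun Q hQ => ?_
  rw [setLIntegral_indicator hB, setLIntegral_congr_fun (hB.inter (h.measurable k Q hQ))
    (fun x hx => by rw [levelSum_souza_eq h s p c hQ hx.2]), setLIntegral_const, inter_comm B Q,
    enorm_mul, ENNReal.mul_rpow_of_nonneg _ _ hp0.le]
  have : ‖((m.real Q ^ (s - 1 / p) : ℝ) : ℂ)‖ₑ ^ p = ENNReal.ofReal (m.real Q ^ (s * p - 1)) := by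
    rw [← ofReal_norm, Complex.norm_real,
      Real.norm_of_nonneg (Real.rpow_nonneg measureReal_nonneg _),
      ENNReal.ofReal_rpow_of_nonneg (Real.rpow_nonneg measureReal_nonneg _) hp0.le,
      ← Real.rpow_mul measureReal_nonneg]
    congr 2
    field_simp
  rw [this]
  ring

theorem ofReal_rpow_mul_measure [IsFiniteMeasure m] {Q : Set I} (hQ : 0 < m.real Q) (t : ℝ) :
    ENNReal.ofReal (m.real Q ^ (t - 1)) * m Q = ENNReal.ofReal (m.real Q ^ t) := by
  rw [← ofReal_measureReal (measure_ne_top m Q), ← ENNReal.ofReal_mul (by positivity)]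
  congr 1
  nth_rw 2 [← Real.rpow_one (m.real Q)]
  rw [← Real.rpow_add hQ, sub_add_cancel]

/-- The `ℓ^p` norm of the coefficients of one level. -/
noncomputable def levelCoeff (W : ℕ → Finset (Set I)) (p : ℝ) (c : ℕ → Set I → ℂ) (k : ℕ) :
    ℝ≥0∞ := (∑ Q ∈ W k, ‖c k Q‖ₑ ^ p) ^ (1 / p)

/-- On Q the p-th power of an atom is |Q|^(sp-1), so its integral over Q ∩ B is at most ε |Q|^(sp).
The gain ε^(1/p) is the source of the decay exponent η/p for collars. -/
theorem eLpNorm_indicator_levelSum_souza_le [IsFiniteMeasure m] (h : IsPartitionGrid m W)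
    {s p : ℝ} (hs : 0 ≤ s) (hp : 1 ≤ p) (c : ℕ → Set I → ℂ) (k : ℕ) {B : Set I}
    (hB : MeasurableSet B) {M : ℝ} (hM : ∀ Q ∈ W k, m.real Q ≤ M) {ε : ℝ≥0∞}
    (hε : ∀ Q ∈ W k, m (Q ∩ B) ≤ ε * m Q) :
    eLpNorm (B.indicator (levelSum W c (fun _ Q => souzaAtom m s p Q) k)) (ENNReal.ofReal p) m ≤
      ε ^ (1 / p) * ENNReal.ofReal (M ^ s) * levelCoeff W p c k := by
  have hp0 : 0 < p := by linarith
  rcases (W k).eq_empty_or_nonempty with hW | ⟨Q₀, hQ₀⟩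
  · rw [eLpNorm_indicator_ofReal_eq hp _ hB, lintegral_levelSum_souza h s hp c k hB, hW]
    simp [hp0]
  have hM0 : 0 ≤ M := (h.real_pos hQ₀).le.trans (hM Q₀ hQ₀)
  rw [eLpNorm_indicator_ofReal_eq hp _ hB, lintegral_levelSum_souza h s hp c k hB]
  calc (∑ Q ∈ W k, ENNReal.ofReal (m.real Q ^ (s * p - 1)) * m (Q ∩ B) * ‖c k Q‖ₑ ^ p) ^ (1 / p)
      ≤ (∑ Q ∈ W k, ε * ENNReal.ofReal (M ^ (s * p)) * ‖c k Q‖ₑ ^ p) ^ (1 / p) := by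
        refine ENNReal.rpow_le_rpow (Finset.sum_le_sum fun Q hQ => ?_) (by positivity)
        refine mul_le_mul_left ?_ _
        calc ENNReal.ofReal (m.real Q ^ (s * p - 1)) * m (Q ∩ B)
            ≤ ENNReal.ofReal (m.real Q ^ (s * p - 1)) * (ε * m Q) := by gcongr; exact hε Q hQ
          _ = ε * (ENNReal.ofReal (m.real Q ^ (s * p - 1)) * m Q) := by ring
          _ = ε * ENNReal.ofReal (m.real Q ^ (s * p)) := by
              rw [ofReal_rpow_mul_measure (h.real_pos hQ)]
          _ ≤ _ := by gcongr; exact hM Q hQ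
    _ = _ := by
        rw [← Finset.mul_sum, ENNReal.mul_rpow_of_nonneg _ _ (by positivity),
          ENNReal.mul_rpow_of_nonneg _ _ (by positivity),
          ENNReal.ofReal_rpow_of_nonneg (by positivity) (by positivity), ← Real.rpow_mul hM0]
        congr 4
        field_simp

theorem mul_levelCoeff_le_eLpNorm_levelSum_souza [IsFiniteMeasure m] (h : IsPartitionGrid m W)
    {s p : ℝ} (hs : 0 ≤ s) (hp : 1 ≤ p) (c : ℕ → Set I → ℂ) (k : ℕ) {M : ℝ} (hM0 : 0 ≤ M)
    (hM : ∀ Q ∈ W k, M ≤ m.real Q) :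
    ENNReal.ofReal (M ^ s) * levelCoeff W p c k ≤
      eLpNorm (levelSum W c (fun _ Q => souzaAtom m s p Q) k) (ENNReal.ofReal p) m := by
  have hp0 : 0 < p := by linarith
  have e := lintegral_levelSum_souza h s hp c k MeasurableSet.univ
  rw [Measure.restrict_univ] at e
  rw [eLpNorm_ofReal_eq hp, e]
  have e2 : ENNReal.ofReal (M ^ s) = ENNReal.ofReal (M ^ (s * p)) ^ (1 / p) := by
    rw [ENNReal.ofReal_rpow_of_nonneg (by positivity) (by positivity), ← Real.rpow_mul hM0]
    congr 2
    field_simp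
  rw [e2, levelCoeff, ← ENNReal.mul_rpow_of_nonneg _ _ (by positivity), Finset.mul_sum]
  refine ENNReal.rpow_le_rpow (Finset.sum_le_sum fun Q hQ => ?_) (by positivity)
  rw [inter_univ, ofReal_rpow_mul_measure (h.real_pos hQ)]
  gcongr
  exact hM Q hQ

end Souza

/-! ### From martingale differences to Souza atoms -/

theorem IsPartitionGrid.martingaleDiff_const {H : ℕ → Finset (Set I)} (h : IsPartitionGrid m H)
    (f : I → ℂ) {k : ℕ} {Q : Set I} (hQ : Q ∈ H k) {x y : I} (hx : x ∈ Q) (hy : y ∈ Q) :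
    martingaleDiff m H f k x = martingaleDiff m H f k y := by
  cases k with
  | zero => simp only [martingaleDiff, h.gridAverage_eq f hQ hx, h.gridAverage_eq f hQ hy]
  | succ k =>
    obtain ⟨R, hR, hQR⟩ := h.nested k Q hQ
    rw [h.martingaleDiff_succ_eq f hQ hR hQR hx, h.martingaleDiff_succ_eq f hQ hR hQR hy]

/-- The value on `Q` of the `k`-th martingale difference. -/
noncomputable def diffValue (m : Measure I) (H : ℕ → Finset (Set I)) (f : I → ℂ) (k : ℕ)
    (Q : Set I) : ℂ := by
  -- The value 0 is never attained by default on a cell of H k, since cells have positive measure.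
  classical exact if hQ : Q.Nonempty then martingaleDiff m H f k hQ.some else 0

theorem IsPartitionGrid.martingaleDiff_eq_diffValue {H : ℕ → Finset (Set I)}
    (h : IsPartitionGrid m H) (f : I → ℂ) {k : ℕ} {Q : Set I} (hQ : Q ∈ H k) {x : I}
    (hx : x ∈ Q) : martingaleDiff m H f k x = diffValue m H f k Q := by
  have hne : Q.Nonempty := ⟨x, hx⟩
  rw [diffValue, dif_pos hne]
  exact h.martingaleDiff_const f hQ hx hne.some_mem

theorem eLpNorm_martingaleDiff_le_size {H : ℕ → Finset (Set I)} {σ : ℕ → ℝ}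
    (h : IsScaledGrid m H σ) {s p : ℝ} {q : ℝ≥0∞} (hq : 1 ≤ q) (f : I → ℂ) (k : ℕ) :
    eLpNorm (martingaleDiff m H f k) (ENNReal.ofReal p) m ≤
      ENNReal.ofReal (σ k ^ s) * (scaledGT m H σ s p q).size f := by
  have hpos := h.scale_pos k
  calc eLpNorm (martingaleDiff m H f k) (ENNReal.ofReal p) m
      = ENNReal.ofReal (σ k ^ s) * (ENNReal.ofReal (σ k ^ (-s)) *
          eLpNorm (martingaleDiff m H f k) (ENNReal.ofReal p) m) := by
        rw [← mul_assoc, ← ENNReal.ofReal_mul (by positivity), ← Real.rpow_add hpos,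
          add_neg_cancel, Real.rpow_zero, ENNReal.ofReal_one, one_mul]
    _ ≤ _ := by
        gcongr
        exact le_lqNorm hq (fun k => ENNReal.ofReal (σ k ^ (-s)) *
          eLpNorm (martingaleDiff m H f k) (ENNReal.ofReal p) m) k

/-- The k-th norm is at most σ_k^s times the norm of f, and σ_k^s is summable because s > 0. -/
theorem tsum_eLpNorm_martingaleDiff_lt_top {H : ℕ → Finset (Set I)} {σ : ℕ → ℝ}
    (h : IsScaledGrid m H σ) {s p : ℝ} {q : ℝ≥0∞} (hs : 0 < s) (hq : 1 ≤ q) {f : I → ℂ}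
    (hf : (scaledGT m H σ s p q).size f < ∞) :
    ∑' k, eLpNorm (martingaleDiff m H f k) (ENNReal.ofReal p) m < ∞ := by
  obtain ⟨c, hc⟩ := h.decay
  refine (ENNReal.tsum_le_tsum fun k =>
    eLpNorm_martingaleDiff_le_size (s := s) h hq f k).trans_lt ?_
  rw [ENNReal.tsum_mul_right]
  exact ENNReal.mul_lt_top (hc.tsum_rpow_lt_top hs) hf

/-- Membership gives only integrability of f; but some partial sum of the differences lies in L^p
and is at finite L^p distance from f. -/
theorem memLp_of_scaledGT [IsFiniteMeasure m] {H : ℕ → Finset (Set I)} {σ : ℕ → ℝ}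
    (h : IsScaledGrid m H σ) {s p : ℝ} {q : ℝ≥0∞} (hs : 0 < s) (hp : 1 ≤ p) (hq : 1 ≤ q)
    {f : I → ℂ} (hf : f ∈ (scaledGT m H σ s p q).carrier) : MemLp f (ENNReal.ofReal p) m := by
  have hsum := tsum_eLpNorm_martingaleDiff_lt_top h hs hq hf.2
  have ht := h.tendsto_sum_martingaleDiff hf.1 hp hsum
  obtain ⟨n, hn⟩ := (ht.eventually (gt_mem_nhds ENNReal.zero_lt_top)).exists
  have h2 : MemLp (fun x => ∑ k ∈ Finset.range n, martingaleDiff m H f k x)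
      (ENNReal.ofReal p) m := memLp_finsetSum _ fun k _ =>
    ⟨(h.measurable_martingaleDiff f k).aestronglyMeasurable,
      (ENNReal.le_tsum k).trans_lt hsum⟩
  have h1 : MemLp (fun x => f x - ∑ k ∈ Finset.range n, martingaleDiff m H f k x)
      (ENNReal.ofReal p) m := ⟨hf.1.1.sub h2.1, hn⟩
  have h3 := h1.add h2
  rwa [show ((fun x => f x - ∑ k ∈ Finset.range n, martingaleDiff m H f k x) +
    fun x => ∑ k ∈ Finset.range n, martingaleDiff m H f k x) = f from by ext x; simp] at h3

/-- Being constant on cells, d_k f is itself a level sum, with coefficient |Q|^(1/p-s) times its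
value on Q. Since |Q| ≥ σ_k/A, the ℓ^p norm of these coefficients is at most A^s σ_k^(-s) ‖d_k f‖_p.
-/
theorem scaledGT_embeds_gridBesov [IsFiniteMeasure m] {H : ℕ → Finset (Set I)} {σ : ℕ → ℝ}
    (h : IsScaledGrid m H σ) {s p : ℝ} {q : ℝ≥0∞} (hs : 0 < s) (hp : 1 ≤ p) (hq : 1 ≤ q) :
    Embeds (scaledGT m H σ s p q) (gridBesov m H s p q) := by
  obtain ⟨A, hA, hsize⟩ := h.size
  refine embeds_atomicSpace (A ^ s).toNNReal fun f hf => ⟨hf.2,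
    memLp_of_scaledGT h hs hp hq hf, ?_⟩
  have hsum := tsum_eLpNorm_martingaleDiff_lt_top h hs hq hf.2
  set c : ℕ → Set I → ℂ := fun k Q =>
    ((m.real Q ^ (1 / p - s) : ℝ) : ℂ) * diffValue m H f k Q with hc
  have hlev : ∀ k, levelSum H c (fun _ Q => souzaAtom m s p Q) k =ᵐ[m]
      martingaleDiff m H f k := fun k => by
    filter_upwards [h.ae_mem k] with x ⟨Q, hQ, hx⟩
    rw [levelSum_souza_eq h.toIsPartitionGrid s p c hQ hx,
      h.martingaleDiff_eq_diffValue f hQ hx, hc]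
    have : ((m.real Q ^ (1 / p - s) : ℝ) : ℂ) * ((m.real Q ^ (s - 1 / p) : ℝ) : ℂ) = 1 := by
      rw [← Complex.ofReal_mul, ← Real.rpow_add (h.real_pos hQ)]
      simp
    linear_combination (diffValue m H f k Q) * this
  refine ⟨c, fun _ Q => souzaAtom m s p Q, ⟨fun _ _ _ => rfl, ?_, ?_⟩, ?_⟩
  · simpa only [eLpNorm_congr_ae (hlev _)] using hsum
  · refine (h.tendsto_sum_martingaleDiff hf.1 hp hsum).congr fun n => eLpNorm_congr_ae ?_
    filter_upwards [ae_all_iff.2 hlev] with x hx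
    simp only [hx]
  · change lqNorm q (levelCoeff H p c) ≤ _ * lqNorm q _
    rw [← lqNorm_const_mul hq]
    refine lqNorm_mono q fun k => ?_
    have hpos := h.scale_pos k
    have key := mul_levelCoeff_le_eLpNorm_levelSum_souza h.toIsPartitionGrid hs.le hp c k
      (M := σ k / A) (by positivity) fun Q hQ => by
        rw [div_le_iff₀' hA]; exact (hsize k Q hQ).1
    rw [eLpNorm_congr_ae (hlev k)] at key
    calc levelCoeff H p c k = ENNReal.ofReal (A ^ s) * (ENNReal.ofReal (σ k ^ (-s)) *
          (ENNReal.ofReal ((σ k / A) ^ s) * levelCoeff H p c k)) := by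
          rw [← mul_assoc, ← mul_assoc, ← ENNReal.ofReal_mul (by positivity),
            ← ENNReal.ofReal_mul (by positivity), Real.div_rpow hpos.le hA.le,
            Real.rpow_neg hpos.le]
          have : A ^ s * (σ k ^ s)⁻¹ * (σ k ^ s / A ^ s) = 1 := by field_simp
          rw [this, ENNReal.ofReal_one, one_mul]
      _ ≤ _ := by
          gcongr
          exact le_of_eq rfl

/-! ### From atoms to martingale differences -/

/-- The uniform bound on d_j g_k is used for τ_k ≤ σ_j, the bound with decay for σ_j ≤ τ_k. After
multiplication by σ_j^(-s) they leave (τ_k/σ_j)^s and (σ_j/τ_k)^(ν-s), both with positive exponent,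
so the Schur test applies. -/
theorem scaledGT_size_le_of_atoms [IsFiniteMeasure m] {H : ℕ → Finset (Set I)} {σ : ℕ → ℝ}
    (h : IsScaledGrid m H σ) {τ : ℕ → ℝ} (hτ : ∃ c, GeomDecay τ c) {s p ν : ℝ} {q : ℝ≥0∞}
    (hs : 0 < s) (hp : 1 ≤ p) (hq : 1 ≤ q) (hν : s < ν) (C : ℝ) (hC : 0 ≤ C) :
    ∃ C' : ℝ≥0, ∀ (f : I → ℂ) (g : ℕ → I → ℂ) (κ : ℕ → ℝ≥0∞), MemLp f (ENNReal.ofReal p) m →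
      (∀ k, MemLp (g k) (ENNReal.ofReal p) m) →
      Tendsto (fun n => eLpNorm (fun x => f x - ∑ k ∈ Finset.range n, g k x)
        (ENNReal.ofReal p) m) atTop (𝓝 0) →
      (∀ j k, eLpNorm (martingaleDiff m H (g k) j) (ENNReal.ofReal p) m ≤
        ENNReal.ofReal (C * τ k ^ s) * κ k) →
      (∀ j k, eLpNorm (martingaleDiff m H (g k) (j + 1)) (ENNReal.ofReal p) m ≤
        ENNReal.ofReal (C * (τ k ^ s * (σ j / τ k) ^ ν)) * κ k) →
      (scaledGT m H σ s p q).size f ≤ C' * lqNorm q κ := by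
  obtain ⟨c, hσ⟩ := h.decay
  obtain ⟨d, hτ⟩ := hτ
  obtain ⟨A, hA, hgrow⟩ := h.growth
  have hσp := hσ.2.2.1
  have hτp := hτ.2.2.1
  have hν0 : 0 < ν := hs.trans hν
  set μ := min s (ν - s) with hμ
  have hμ0 : 0 < μ := lt_min hs (by linarith)
  obtain ⟨C₁, hC₁⟩ := hτ.exists_tsum_min_le hμ0
  obtain ⟨C₂, hC₂⟩ := hσ.exists_tsum_min_le hμ0
  -- The first term serves the uniform bound. The second pays for σ_j ≤ A σ_(j+1), as the decay
  -- hypothesis concerns d_(j+1). The third covers d_0, which has no decay hypothesis but satisfies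
  -- σ_0/τ_k ≥ σ_0/τ_0.
  set D := C + C * A ^ ν + C * (τ 0 / σ 0) ^ ν with hD
  have hτ0 := hτp 0
  have hσ0 := hσp 0
  have hD1 : C ≤ D := by
    have : 0 ≤ C * A ^ ν := by positivity
    have : 0 ≤ C * (τ 0 / σ 0) ^ ν := by positivity
    linarith
  have hD2 : C * A ^ ν ≤ D := by
    have : 0 ≤ C * (τ 0 / σ 0) ^ ν := by positivity
    linarith
  have hD3 : C * (τ 0 / σ 0) ^ ν ≤ D := by
    have : 0 ≤ C * A ^ ν := by positivity
    linarith
  have hD0 : 0 ≤ D := hC.trans hD1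
  refine ⟨D.toNNReal * (max C₁ C₂), fun f g κ hf hg hlim h1 h2 => ?_⟩
  have hp1 : (1 : ℝ≥0∞) ≤ ENNReal.ofReal p := by simpa using hp
  have hgi : ∀ k, Integrable (g k) m := fun k => (hg k).integrable hp1
  -- Since d_j has norm at most 2 on L^p, it can be applied to f minus a partial sum, and the error
  -- vanishes in the limit.
  have hdiff : ∀ j, eLpNorm (martingaleDiff m H f j) (ENNReal.ofReal p) m ≤
      ∑' k, eLpNorm (martingaleDiff m H (g k) j) (ENNReal.ofReal p) m := fun j => by
    have hb : ∀ n, eLpNorm (martingaleDiff m H f j) (ENNReal.ofReal p) m ≤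
        2 * eLpNorm (fun x => f x - ∑ k ∈ Finset.range n, g k x) (ENNReal.ofReal p) m +
        ∑' k, eLpNorm (martingaleDiff m H (g k) j) (ENNReal.ofReal p) m := fun n => by
      have hS : Integrable (fun x => ∑ k ∈ Finset.range n, g k x) m :=
        integrable_finsetSum _ fun k _ => hgi k
      have hR : Integrable (fun x => f x - ∑ k ∈ Finset.range n, g k x) m :=
        (hf.integrable hp1).sub hS
      have e : martingaleDiff m H f j = fun x =>
          martingaleDiff m H (fun x => f x - ∑ k ∈ Finset.range n, g k x) j x +
          ∑ k ∈ Finset.range n, martingaleDiff m H (g k) j x := by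
        ext x
        rw [← martingaleDiff_sum hgi, ← martingaleDiff_add hR hS]
        simp
      rw [e]
      refine (eLpNorm_add_le (h.measurable_martingaleDiff _ j).aestronglyMeasurable
        (Finset.measurable_fun_sum _ fun k _ =>
          h.measurable_martingaleDiff _ j).aestronglyMeasurable hp1).trans ?_
      refine add_le_add (h.eLpNorm_martingaleDiff_le hR.1 hp j) ?_
      have := eLpNorm_sum_le (μ := m) (p := ENNReal.ofReal p) (s := Finset.range n)
        (f := fun k => martingaleDiff m H (g k) j)
        (fun k _ => (h.measurable_martingaleDiff _ j).aestronglyMeasurable) hp1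
      refine le_trans (le_of_eq ?_) (this.trans (ENNReal.sum_le_tsum _))
      congr 1
      ext x
      simp
    have hlim2 := (ENNReal.Tendsto.const_mul hlim (a := 2) (Or.inr (by simp))).add_const
      (∑' k, eLpNorm (martingaleDiff m H (g k) j) (ENNReal.ofReal p) m)
    rw [mul_zero, zero_add] at hlim2
    exact ge_of_tendsto' hlim2 hb
  have h3 : ∀ j k, eLpNorm (martingaleDiff m H (g k) j) (ENNReal.ofReal p) m ≤
      ENNReal.ofReal (D * (τ k ^ s * (σ j / τ k) ^ ν)) * κ k := fun j k => by
    have hτk := hτp k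
    cases j with
    | zero =>
      refine (h1 0 k).trans ?_
      gcongr ENNReal.ofReal ?_ * _
      have hle : τ k ≤ τ 0 := by
        have := hτ.le_pow 0 k
        rw [zero_add] at this
        refine this.trans (mul_le_of_le_one_left hτ0.le (pow_le_one₀ hτ.1.le hτ.2.1.le))
      have : 1 ≤ (τ 0 / σ 0) ^ ν * (σ 0 / τ k) ^ ν := by
        rw [← Real.mul_rpow (by positivity) (by positivity)]
        apply Real.one_le_rpow _ hν0.le
        have : τ 0 / σ 0 * (σ 0 / τ k) = τ 0 / τ k := by field_simp
        rw [this, one_le_div hτk]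
        exact hle
      calc C * τ k ^ s = C * τ k ^ s * 1 := by ring
        _ ≤ C * τ k ^ s * ((τ 0 / σ 0) ^ ν * (σ 0 / τ k) ^ ν) := by gcongr
        _ = C * (τ 0 / σ 0) ^ ν * (τ k ^ s * (σ 0 / τ k) ^ ν) := by ring
        _ ≤ _ := by gcongr
    | succ j =>
      have hσj := hσp j
      have hσj1 := hσp (j + 1)
      refine (h2 j k).trans ?_
      gcongr ENNReal.ofReal ?_ * _
      calc C * (τ k ^ s * (σ j / τ k) ^ ν)
          ≤ C * (τ k ^ s * (A * σ (j + 1) / τ k) ^ ν) := by gcongr; exact hgrow j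
        _ = C * A ^ ν * (τ k ^ s * (σ (j + 1) / τ k) ^ ν) := by
            rw [mul_div_assoc, Real.mul_rpow (by positivity) (by positivity)]; ring
        _ ≤ _ := by gcongr
  set M : ℕ → ℕ → ℝ≥0∞ := fun j k => ENNReal.ofReal (min (τ k / σ j) (σ j / τ k) ^ μ) with hM
  have h4 : ∀ j k, ENNReal.ofReal (σ j ^ (-s)) *
      eLpNorm (martingaleDiff m H (g k) j) (ENNReal.ofReal p) m ≤
        D.toNNReal * (M j k * κ k) := fun j k => by
    have hτk := hτp k
    have hσj := hσp j
    rcases le_total (τ k) (σ j) with hle | hle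
    · calc _ ≤ ENNReal.ofReal (σ j ^ (-s)) * (ENNReal.ofReal (C * τ k ^ s) * κ k) := by
            gcongr; exact h1 j k
        _ = ENNReal.ofReal (C * (τ k / σ j) ^ s) * κ k := by
            rw [← mul_assoc, ← ENNReal.ofReal_mul (by positivity), Real.rpow_neg hσj.le,
              Real.div_rpow hτk.le hσj.le]
            congr 2
            field_simp
        _ ≤ ENNReal.ofReal (D * min (τ k / σ j) (σ j / τ k) ^ μ) * κ k := by
            have hx : τ k / σ j ≤ 1 := (div_le_one hσj).2 hle
            have hy : 1 ≤ σ j / τ k := (one_le_div hτk).2 hle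
            rw [min_eq_left (hx.trans hy)]
            gcongr ENNReal.ofReal (?_ * ?_) * _
            exact Real.rpow_le_rpow_of_exponent_ge (by positivity) hx (min_le_left _ _)
        _ = _ := by
            rw [ENNReal.ofReal_mul hD0, mul_assoc]
            rfl
    · calc _ ≤ ENNReal.ofReal (σ j ^ (-s)) *
              (ENNReal.ofReal (D * (τ k ^ s * (σ j / τ k) ^ ν)) * κ k) := by
            gcongr; exact h3 j k
        _ = ENNReal.ofReal (D * (σ j / τ k) ^ (ν - s)) * κ k := by
            rw [← mul_assoc, ← ENNReal.ofReal_mul (by positivity), Real.rpow_neg hσj.le,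
              Real.rpow_sub (by positivity), Real.div_rpow hσj.le hτk.le s]
            congr 2
            field_simp
        _ ≤ ENNReal.ofReal (D * min (τ k / σ j) (σ j / τ k) ^ μ) * κ k := by
            have hx : σ j / τ k ≤ 1 := (div_le_one hτk).2 hle
            have hy : 1 ≤ τ k / σ j := (one_le_div hσj).2 hle
            rw [min_eq_right (hx.trans hy)]
            gcongr ENNReal.ofReal (?_ * ?_) * _
            exact Real.rpow_le_rpow_of_exponent_ge (by positivity) hx (min_le_right _ _)
        _ = _ := by
            rw [ENNReal.ofReal_mul hD0, mul_assoc]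
            rfl
  calc (scaledGT m H σ s p q).size f
      ≤ lqNorm q (fun j => D.toNNReal * ∑' k, M j k * κ k) := lqNorm_mono q fun j => by
        calc _ ≤ ENNReal.ofReal (σ j ^ (-s)) *
              ∑' k, eLpNorm (martingaleDiff m H (g k) j) (ENNReal.ofReal p) m := by
              gcongr; exact hdiff j
          _ ≤ _ := by
              rw [← ENNReal.tsum_mul_left, ← ENNReal.tsum_mul_left]
              exact ENNReal.tsum_le_tsum (h4 j)
    _ ≤ D.toNNReal * (((max C₁ C₂ : ℝ≥0) : ℝ≥0∞) * lqNorm q κ) := by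
        rw [lqNorm_const_mul hq]
        gcongr
        refine lqNorm_schur hq M κ _ (fun j => (hC₁ (σ j) (hσp j)).trans ?_) fun k => ?_
        · exact_mod_cast le_max_left _ _
        · refine le_trans (le_of_eq ?_) ((hC₂ (τ k) (hτp k)).trans
            (by exact_mod_cast le_max_right C₁ C₂))
          simp only [hM, min_comm]
    _ = _ := by rw [← mul_assoc]; push_cast; rfl

/-- The elements of `H j` that are not contained in `Q ∈ W k` cover a small part of `Q`. -/
def CollarBound (m : Measure I) (H W : ℕ → Finset (Set I)) (σ τ : ℕ → ℝ) (η : ℝ) : Prop :=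
  ∃ A : ℝ, 0 < A ∧ ∀ j k, ∀ Q ∈ W k,
    m {x | x ∈ Q ∧ ∃ R ∈ H j, x ∈ R ∧ ¬ R ⊆ Q} ≤ ENNReal.ofReal (A * (σ j / τ k) ^ η) * m Q

/-- The difference at level j + 1 is local to each R in H j. It does not see the truncation when R ⊆
B, and where u is constant on R both sides vanish there. -/
theorem IsPartitionGrid.martingaleDiff_indicator_ae [IsFiniteMeasure m]
    {H : ℕ → Finset (Set I)} (h : IsPartitionGrid m H) {u : I → ℂ} {B : Set I} {j : ℕ}
    (hB : ∀ R ∈ H j, R ⊆ B ∨ (Disjoint R B ∧ ∃ v, ∀ x ∈ R, u x = v)) :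
    martingaleDiff m H u (j + 1) =ᵐ[m] martingaleDiff m H (B.indicator u) (j + 1) := by
  filter_upwards [h.ae_mem (j + 1)] with x ⟨Q, hQ, hx⟩
  obtain ⟨R, hR, hQR⟩ := h.nested j Q hQ
  rw [h.martingaleDiff_succ_eq _ hQ hR hQR hx, h.martingaleDiff_succ_eq _ hQ hR hQR hx]
  have hQm := h.measurable _ Q hQ
  have hRm := h.measurable _ R hR
  rcases hB R hR with hRB | ⟨hRB, v, hv⟩
  · simp only [setAverage_eq]
    rw [setIntegral_congr_fun hQm (g := u)
        (fun y hy => Set.indicator_of_mem (hRB (hQR hy)) u),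
      setIntegral_congr_fun hRm (g := u) (fun y hy => Set.indicator_of_mem (hRB hy) u)]
  · have h0 : ∀ y ∈ R, B.indicator u y = 0 := fun y hy =>
      Set.indicator_of_notMem (Set.disjoint_left.1 hRB hy) u
    rw [setAverage_eq_of_const hQm (h.pos _ Q hQ) (fun y hy => hv y (hQR hy)),
      setAverage_eq_of_const hRm (h.pos _ R hR) hv,
      setAverage_eq_of_const hQm (h.pos _ Q hQ) (fun y hy => h0 y (hQR hy)),
      setAverage_eq_of_const hRm (h.pos _ R hR) h0, sub_self, sub_self]

/-- The k-th level sum is constant on every R in H j contained in some Q of W k, so d_(j+1) only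
sees the remaining R. These occupy a proportion at most A (σ_j/τ_k)^η of each Q, and taking p-th
roots gives decay with exponent η/p > s. -/
theorem gridBesov_embeds_scaledGT [IsFiniteMeasure m] {H W : ℕ → Finset (Set I)} {σ τ : ℕ → ℝ}
    (h : IsScaledGrid m H σ) (hW : IsScaledGrid m W τ) {s p η : ℝ} {q : ℝ≥0∞} (hs : 0 < s)
    (hp : 1 ≤ p) (hq : 1 ≤ q) (hη : s * p < η) (hcol : CollarBound m H W σ τ η) :
    Embeds (gridBesov m W s p q) (scaledGT m H σ s p q) := by
  have hp0 : 0 < p := by linarith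
  obtain ⟨A, hA, hcol⟩ := hcol
  obtain ⟨A', hA', hsize⟩ := hW.size
  have hp1 : (1 : ℝ≥0∞) ≤ ENNReal.ofReal p := by simpa using hp
  -- The 2 is the norm of d_j, A' compares |Q| with τ_k, and the two summands serve the uniform and
  -- the collar estimate.
  set C : ℝ := 2 * A' ^ s * (1 + A ^ (1 / p)) with hC
  obtain ⟨C', hC'⟩ := scaledGT_size_le_of_atoms h hW.decay (ν := η / p) (q := q) hs hp hq
    (by rwa [lt_div_iff₀ hp0]) C (by positivity)
  refine embeds_of_representation C' fun f hf c a hr hc => ?_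
  set g : ℕ → I → ℂ := levelSum W c (fun _ Q => souzaAtom m s p Q) with hg
  have hga : levelSum W c a = g := by
    ext k x
    simp only [hg, levelSum]
    refine Finset.sum_congr rfl fun Q hQ => ?_
    rw [show a k Q = souzaAtom m s p Q from hr.atom k Q hQ]
  have habs := hr.absolute
  have hlim := hr.tendsto
  rw [hga] at habs
  simp only [hga] at hlim
  have hgm : ∀ k, Measurable (g k) := measurable_levelSum_souza hW.toIsPartitionGrid s p c
  have hgp : ∀ k, MemLp (g k) (ENNReal.ofReal p) m := fun k =>
    ⟨(hgm k).aestronglyMeasurable, (ENNReal.le_tsum k).trans_lt habs⟩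
  have hbound : ∀ k, ∀ B, MeasurableSet B → ∀ ε : ℝ, 0 ≤ ε →
      (∀ Q ∈ W k, m (Q ∩ B) ≤ ENNReal.ofReal ε * m Q) →
      eLpNorm (B.indicator (g k)) (ENNReal.ofReal p) m ≤
        ENNReal.ofReal (ε ^ (1 / p) * (A' * τ k) ^ s) * levelCoeff W p c k := by
    intro k B hB ε hε hQB
    refine (eLpNorm_indicator_levelSum_souza_le hW.toIsPartitionGrid hs.le hp c k hB
      (fun Q hQ => (hsize k Q hQ).2) hQB).trans (le_of_eq ?_)
    rw [ENNReal.ofReal_rpow_of_nonneg hε (by positivity), ← ENNReal.ofReal_mul (by positivity)]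
  have hsz : (scaledGT m H σ s p q).size f ≤ C' * coeffNorm W p q c := by
    refine hC' f g (levelCoeff W p c) hf hgp hlim (fun j k => ?_) fun j k => ?_
    · have hτk := hW.scale_pos k
      refine (h.eLpNorm_martingaleDiff_le (hgp k).1 hp j).trans ?_
      have := hbound k univ MeasurableSet.univ 1 zero_le_one (by simp)
      rw [indicator_univ] at this
      calc _ ≤ ENNReal.ofReal 2 * (ENNReal.ofReal ((1 : ℝ) ^ (1 / p) * (A' * τ k) ^ s) *
            levelCoeff W p c k) := by
            rw [ENNReal.ofReal_ofNat]; gcongr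
        _ ≤ _ := by
            rw [← mul_assoc, ← ENNReal.ofReal_mul (by positivity), Real.one_rpow, one_mul,
              Real.mul_rpow hA'.le hτk.le]
            gcongr ENNReal.ofReal ?_ * _
            rw [hC]
            have : 0 ≤ 2 * A' ^ s * A ^ (1 / p) * τ k ^ s := by positivity
            linarith
    · have hτk := hW.scale_pos k
      have hσj := h.scale_pos j
      classical
      set S := (H j).filter fun R => ∀ Q ∈ W k, ¬ R ⊆ Q with hS
      set B : Set I := ⋃ R ∈ S, R with hBdef
      have hBm : MeasurableSet B := Finset.measurableSet_biUnion _ fun R hR =>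
        h.measurable j R (Finset.mem_filter.1 hR).1
      have hae : martingaleDiff m H (g k) (j + 1) =ᵐ[m]
          martingaleDiff m H (B.indicator (g k)) (j + 1) := by
        refine h.martingaleDiff_indicator_ae fun R hR => ?_
        by_cases hbad : ∀ Q ∈ W k, ¬ R ⊆ Q
        · exact Or.inl (Set.subset_biUnion_of_mem (u := fun R : Set I => R)
            (Finset.mem_filter.2 ⟨hR, hbad⟩))
        · push Not at hbad
          obtain ⟨Q, hQ, hRQ⟩ := hbad
          refine Or.inr ⟨?_, _, fun x hx =>
            levelSum_souza_eq hW.toIsPartitionGrid s p c hQ (hRQ hx)⟩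
          refine Set.disjoint_iUnion₂_right.2 fun R' hR' => h.disjoint j R hR R'
            (Finset.mem_filter.1 hR').1 ?_
          rintro rfl
          exact (Finset.mem_filter.1 hR').2 Q hQ hRQ
      rw [eLpNorm_congr_ae hae]
      refine (h.eLpNorm_martingaleDiff_le ((hgp k).1.indicator hBm) hp (j + 1)).trans ?_
      have := hbound k B hBm (A * (σ j / τ k) ^ η) (by positivity) fun Q hQ => by
        refine le_trans (measure_mono ?_) (hcol j k Q hQ)
        rintro x ⟨hxQ, hxB⟩
        obtain ⟨R, hR, hxR⟩ := Set.mem_iUnion₂.1 hxB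
        obtain ⟨hR, hbad⟩ := Finset.mem_filter.1 hR
        exact ⟨hxQ, R, hR, hxR, hbad Q hQ⟩
      calc _ ≤ ENNReal.ofReal 2 * (ENNReal.ofReal ((A * (σ j / τ k) ^ η) ^ (1 / p) *
            (A' * τ k) ^ s) * levelCoeff W p c k) := by
            rw [ENNReal.ofReal_ofNat]; gcongr
        _ ≤ _ := by
            rw [← mul_assoc, ← ENNReal.ofReal_mul (by positivity),
              Real.mul_rpow hA.le (by positivity), Real.mul_rpow hA'.le hτk.le,
              ← Real.rpow_mul (by positivity), mul_one_div]
            gcongr ENNReal.ofReal ?_ * _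
            rw [hC]
            have : 0 ≤ 2 * A' ^ s * τ k ^ s * (σ j / τ k) ^ (η / p) := by positivity
            linarith
  exact ⟨⟨hf.integrable hp1, hsz.trans_lt (ENNReal.mul_lt_top ENNReal.coe_lt_top hc)⟩, hsz⟩

end GridBesov

namespace GridBesov

/-! ### The ultrametric of a grid -/

/-- A good grid whose partitions are exact, with the whole space as root, and which separates
points. -/
structure IsRootedGrid {I : Type*} [MeasurableSpace I] (m : Measure I)
    (P : ℕ → Finset (Set I)) : Prop extends IsPartitionGrid m P where
  top : P 0 = {Set.univ}
  covers : ∀ k, ∀ x : I, ∃ Q ∈ P k, x ∈ Q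
  separates : ∀ x y : I, x ≠ y → ∃ k, ∃ Q ∈ P k, x ∈ Q ∧ y ∉ Q
  ratio : ∃ a b : ℝ, 0 < a ∧ a < 1 ∧ 0 < b ∧ b < 1 ∧
    ∀ k, ∀ Q ∈ P (k + 1), ∀ R ∈ P k, Q ⊆ R → a * m.real R ≤ m.real Q ∧ m.real Q ≤ b * m.real R

/-- Points that lie in the same grid sets lie in the same measurable sets, because the grid
generates. In a Hausdorff space singletons are Borel, so such points coincide. -/
theorem IsGoodGrid.isRootedGrid {I : Type*} [TopologicalSpace I] [T2Space I]
    [mI : MeasurableSpace I] [BorelSpace I] {m : Measure I} [IsFiniteMeasure m]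
    {P : ℕ → Finset (Set I)} (hP : IsGoodGrid m P) (hP_top : P 0 = {Set.univ})
    (hP_cover : ∀ k, ∀ x : I, ∃ Q ∈ P k, x ∈ Q) : IsRootedGrid m P := by
  refine ⟨hP.isPartitionGrid, hP_top, hP_cover, fun x y hxy => ?_, ?_⟩
  · by_contra hcon
    push Not at hcon
    have hiff : ∀ k, ∀ Q ∈ P k, (x ∈ Q ↔ y ∈ Q) := fun k Q hQ => by
      refine ⟨hcon k Q hQ, fun hy => ?_⟩
      obtain ⟨R, hR, hxR⟩ := hP_cover k x
      rwa [hP.isPartitionGrid.eq_of_mem hQ hR hy (hcon k R hR hxR)]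
    have key : ∀ S : Set I, MeasurableSet[MeasurableSpace.generateFrom {Q | ∃ k, Q ∈ P k}] S →
        (x ∈ S ↔ y ∈ S) := by
      intro S hS
      induction S, hS using MeasurableSpace.generateFrom_induction with
      | hC S hS _ => obtain ⟨k, hS⟩ := hS; exact hiff k S hS
      | empty => simp
      | compl S _ ih => simp [ih]
      | iUnion S _ ih => simp [ih]
    have hm : MeasurableSet ({x} : Set I) := measurableSet_singleton x
    have := key {x} (by rw [← hP.generates]; exact hm)
    simp only [mem_singleton_iff, true_iff] at this
    exact hxy this.symm
  · obtain ⟨a, b, ha, ha1, hb, hb1, h⟩ := hP.ratio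
    refine ⟨a, b, ha, ha1, hb, hb1, fun k Q hQ R hR hQR => ?_⟩
    have hpos := hP.isPartitionGrid.real_pos hR
    obtain ⟨h1, h2⟩ := h k Q hQ R hR hQR
    exact ⟨(le_div_iff₀ hpos).1 h1, (div_le_iff₀ hpos).1 h2⟩

namespace IsRootedGrid

variable {I : Type*} [mI : MeasurableSpace I] {m : Measure I} [IsProbabilityMeasure m]
  {P : ℕ → Finset (Set I)}

theorem real_lt_of_lt (h : IsRootedGrid m P) {j k : ℕ} (hjk : j < k) {Q R : Set I} (hQ : Q ∈ P j)
    (hR : R ∈ P k) (hRQ : R ⊆ Q) : m.real R < m.real Q := by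
  obtain ⟨a, b, ha, ha1, hb, hb1, hr⟩ := h.ratio
  obtain ⟨k, rfl⟩ : ∃ k', k = k' + 1 := ⟨k - 1, by omega⟩
  obtain ⟨S, hS, hRS⟩ := h.nested k R hR
  have hSQ : S ⊆ Q := by
    refine (h.subset_or_disjoint (by omega) hS hQ).resolve_right fun hd => ?_
    have : R = ∅ := Set.subset_eq_empty (fun x hx =>
      (Set.disjoint_left.1 hd (hRS hx) (hRQ hx)).elim) rfl
    exact (h.pos _ R hR).ne' (by rw [this]; simp)
  calc m.real R ≤ b * m.real S := (hr k R hR S hS hRS).2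
    _ < m.real S := mul_lt_of_lt_one_left (h.real_pos hS) hb1
    _ ≤ m.real Q := measureReal_mono hSQ

/-- Two grid sets with a common point are nested, and measure strictly decreases with the level, so
comparing measures decides which contains which. -/
theorem subset_of_real_le (h : IsRootedGrid m P) {j k : ℕ} {Q R : Set I} (hQ : Q ∈ P j)
    (hR : R ∈ P k) {x : I} (hxQ : x ∈ Q) (hxR : x ∈ R) (hle : m.real Q ≤ m.real R) : Q ⊆ R := by
  rcases le_or_gt k j with hkj | hkj
  · exact (h.subset_or_disjoint hkj hQ hR).resolve_right
      (Set.not_disjoint_iff.2 ⟨x, hxQ, hxR⟩)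
  · have := (h.subset_or_disjoint hkj.le hR hQ).resolve_right
      (Set.not_disjoint_iff.2 ⟨x, hxR, hxQ⟩)
    exact absurd (h.real_lt_of_lt hkj hQ hR this) (not_lt.2 hle)

theorem exists_real_le_pow (h : IsRootedGrid m P) : ∃ b : ℝ, 0 < b ∧ b < 1 ∧
    ∀ k, ∀ Q ∈ P k, m.real Q ≤ b ^ k := by
  obtain ⟨a, b, ha, ha1, hb, hb1, hr⟩ := h.ratio
  refine ⟨b, hb, hb1, fun k => ?_⟩
  induction k with
  | zero => intro Q _; simp
  | succ k ih =>
    intro Q hQ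
    obtain ⟨R, hR, hQR⟩ := h.nested k Q hQ
    calc m.real Q ≤ b * m.real R := (hr k Q hQ R hR hQR).2
      _ ≤ b * b ^ k := by gcongr; exact ih R hR
      _ = _ := by ring

theorem exists_level_lt (h : IsRootedGrid m P) {r : ℝ} (hr : 0 < r) :
    ∃ N, ∀ Q ∈ P N, m.real Q < r := by
  obtain ⟨b, hb, hb1, hle⟩ := h.exists_real_le_pow
  obtain ⟨N, hN⟩ := exists_pow_lt_of_lt_one hr hb1
  exact ⟨N, fun Q hQ => (hle N Q hQ).trans_lt hN⟩

theorem gridMetric_nonneg (m : Measure I) (P : ℕ → Finset (Set I)) (x y : I) :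
    0 ≤ gridMetric m P x y :=
  Real.sInf_nonneg (by rintro _ ⟨k, Q, _, _, _, rfl⟩; exact measureReal_nonneg)

omit [IsProbabilityMeasure m] in
theorem gridMetric_le {k : ℕ} {Q : Set I} (hQ : Q ∈ P k) {x y : I} (hx : x ∈ Q) (hy : y ∈ Q) :
    gridMetric m P x y ≤ m.real Q :=
  csInf_le ⟨0, by rintro _ ⟨k, Q, _, _, _, rfl⟩; exact measureReal_nonneg⟩ ⟨k, Q, hQ, hx, hy, rfl⟩

omit [IsProbabilityMeasure m] in
theorem gridMetric_lt_iff (h : IsRootedGrid m P) {x y : I} {r : ℝ} :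
    gridMetric m P x y < r ↔ ∃ k, ∃ Q ∈ P k, x ∈ Q ∧ y ∈ Q ∧ m.real Q < r := by
  constructor
  · intro hlt
    unfold gridMetric at hlt
    obtain ⟨t, ⟨k, Q, hQ, hx, hy, rfl⟩, ht⟩ := exists_lt_of_csInf_lt
      (by exact ⟨m.real univ, 0, univ, by simp [h.top], mem_univ _, mem_univ _, rfl⟩) hlt
    exact ⟨k, Q, hQ, hx, hy, ht⟩
  · rintro ⟨k, Q, hQ, hx, hy, ht⟩
    exact (gridMetric_le hQ hx hy).trans_lt ht

theorem gridMetric_le_one (h : IsRootedGrid m P) (x y : I) : gridMetric m P x y ≤ 1 := by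
  have := gridMetric_le (m := m) (P := P) (k := 0) (Q := univ) (by simp [h.top])
    (mem_univ x) (mem_univ y)
  simpa using this

theorem gridMetric_self (h : IsRootedGrid m P) (x : I) : gridMetric m P x x = 0 := by
  refine le_antisymm (le_of_forall_pos_lt_add fun ε hε => ?_) (gridMetric_nonneg m P x x)
  obtain ⟨N, hN⟩ := h.exists_level_lt hε
  obtain ⟨Q, hQ, hx⟩ := h.covers N x
  rw [zero_add]
  exact (gridMetric_le hQ hx hx).trans_lt (hN Q hQ)

omit [IsProbabilityMeasure m] in
theorem gridMetric_comm (x y : I) : gridMetric m P x y = gridMetric m P y x := by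
  unfold gridMetric
  congr 1
  ext t
  constructor <;> (rintro ⟨k, Q, hQ, hx, hy, rfl⟩; exact ⟨k, Q, hQ, hy, hx, rfl⟩)

/-- A grid set of smaller measure containing x lies inside Q and hence misses y. -/
theorem real_le_gridMetric (h : IsRootedGrid m P) {k : ℕ} {Q : Set I} (hQ : Q ∈ P k) {x y : I}
    (hx : x ∈ Q) (hy : y ∉ Q) : m.real Q ≤ gridMetric m P x y := by
  by_contra! hlt
  obtain ⟨j, R, hR, hxR, hyR, hlt⟩ := h.gridMetric_lt_iff.1 hlt
  exact hy (h.subset_of_real_le hR hQ hxR hx hlt.le hyR)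

/-- Sets witnessing the two distances share y, so they are nested and the larger one contains all
three points. -/
theorem gridMetric_ultra (h : IsRootedGrid m P) (x y z : I) :
    gridMetric m P x z ≤ max (gridMetric m P x y) (gridMetric m P y z) := by
  refine le_of_forall_gt fun r hr => ?_
  obtain ⟨h1, h2⟩ := max_lt_iff.1 hr
  obtain ⟨j, Q, hQ, hxQ, hyQ, hlQ⟩ := h.gridMetric_lt_iff.1 h1
  obtain ⟨k, R, hR, hyR, hzR, hlR⟩ := h.gridMetric_lt_iff.1 h2
  rcases le_total (m.real Q) (m.real R) with hle | hle
  · exact h.gridMetric_lt_iff.2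
      ⟨k, R, hR, h.subset_of_real_le hQ hR hyQ hyR hle hxQ, hzR, hlR⟩
  · exact h.gridMetric_lt_iff.2
      ⟨j, Q, hQ, hxQ, h.subset_of_real_le hR hQ hyR hyQ hle hzR, hlQ⟩

theorem isQuasiMetric (h : IsRootedGrid m P) : IsQuasiMetric (gridMetric m P) where
  self_eq_zero := h.gridMetric_self
  pos x y hxy := by
    obtain ⟨k, Q, hQ, hx, hy⟩ := h.separates x y hxy
    exact (h.real_pos hQ).trans_le (h.real_le_gridMetric hQ hx hy)
  symm := gridMetric_comm
  triangle := ⟨1, le_rfl, fun x y z => by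
    rw [one_mul]
    exact (h.gridMetric_ultra x y z).trans (max_le_add_of_nonneg (gridMetric_nonneg _ _ _ _)
      (gridMetric_nonneg _ _ _ _))⟩

/-! ### Balls of the ultrametric -/

/-- Balls are elements of the grid. -/
theorem exists_qball_eq (h : IsRootedGrid m P) {a b : ℝ} (ha : 0 < a) (ha1 : a < 1)
    (hr : ∀ k, ∀ Q ∈ P (k + 1), ∀ R ∈ P k, Q ⊆ R →
      a * m.real R ≤ m.real Q ∧ m.real Q ≤ b * m.real R) (x : I) {r : ℝ} {N : ℕ}
    (hN : ∀ Q ∈ P N, m.real Q < r) :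
    ∃ k ≤ N, ∃ Q ∈ P k, qball (gridMetric m P) x r = Q ∧ m.real Q < r ∧
      a * min r 1 ≤ m.real Q := by
  classical
  -- The ball is the set around x at the first level where the measure is below r. Its parent has
  -- measure at least r, which bounds it from below by a r; if it has no parent it is the whole
  -- space, whence the minimum with 1.
  have hex : ∃ k, ∃ Q ∈ P k, x ∈ Q ∧ m.real Q < r := by
    obtain ⟨Q, hQ, hx⟩ := h.covers N x
    exact ⟨N, Q, hQ, hx, hN Q hQ⟩
  obtain ⟨Q, hQ, hx, hQr⟩ := Nat.find_spec hex
  refine ⟨Nat.find hex, ?_, Q, hQ, ?_, hQr, ?_⟩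
  · obtain ⟨Q, hQ, hx⟩ := h.covers N x
    exact Nat.find_min' hex ⟨Q, hQ, hx, hN Q hQ⟩
  · ext y
    simp only [qball, mem_ofPred_eq]
    rw [h.gridMetric_lt_iff]
    constructor
    · rintro ⟨j, R, hR, hxR, hyR, hlt⟩
      exact (h.subset_or_disjoint (Nat.find_min' hex ⟨R, hR, hxR, hlt⟩) hR hQ).resolve_right
        (Set.not_disjoint_iff.2 ⟨x, hxR, hx⟩) hyR
    · exact fun hy => ⟨_, Q, hQ, hx, hy, hQr⟩
  · rcases Nat.eq_zero_or_eq_succ_pred (Nat.find hex) with h0 | h0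
    · rw [h0, h.top, Finset.mem_singleton] at hQ
      rw [hQ, probReal_univ]
      calc a * min r 1 ≤ a * 1 := by gcongr; exact min_le_right _ _
        _ ≤ 1 := by linarith
    · rw [h0] at hQ
      obtain ⟨R, hR, hQR⟩ := h.nested _ Q hQ
      have hRr : r ≤ m.real R := by
        by_contra! hlt
        have := Nat.find_min' hex ⟨R, hR, hQR hx, hlt⟩
        have : (Nat.find hex).pred < Nat.find hex := by omega
        omega
      calc a * min r 1 ≤ a * m.real R := by gcongr; exact (min_le_left _ _).trans hRr
        _ ≤ _ := (hr _ Q hQ R hR hQR).1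

theorem qball_mem (h : IsRootedGrid m P) (x : I) {r : ℝ} (hr : 0 < r) :
    ∃ k, qball (gridMetric m P) x r ∈ P k := by
  obtain ⟨a, b, ha, ha1, hb, hb1, hab⟩ := h.ratio
  obtain ⟨N, hN⟩ := h.exists_level_lt hr
  obtain ⟨k, _, Q, hQ, hQr, _⟩ := h.exists_qball_eq ha ha1 hab x hN
  exact ⟨k, hQr ▸ hQ⟩

theorem mem_qball_self (h : IsRootedGrid m P) (x : I) {r : ℝ} (hr : 0 < r) :
    x ∈ qball (gridMetric m P) x r := by
  simpa [qball, h.gridMetric_self] using hr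

theorem exists_real_qball (h : IsRootedGrid m P) : ∃ a : ℝ, 0 < a ∧ a < 1 ∧
    ∀ x, ∀ r : ℝ, 0 < r → a * min r 1 ≤ m.real (qball (gridMetric m P) x r) ∧
      m.real (qball (gridMetric m P) x r) < r := by
  obtain ⟨a, b, ha, ha1, hb, hb1, hab⟩ := h.ratio
  refine ⟨a, ha, ha1, fun x r hr => ?_⟩
  obtain ⟨N, hN⟩ := h.exists_level_lt hr
  obtain ⟨k, _, Q, hQ, hQr, h1, h2⟩ := h.exists_qball_eq ha ha1 hab x hN
  rw [hQr]
  exact ⟨h2, h1⟩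

/-- In an ultrametric space every point of a ball is a centre of it, so balls of equal radius are
equal or disjoint. -/
theorem qball_eq_of_mem (h : IsRootedGrid m P) {x y : I} {r : ℝ}
    (hy : y ∈ qball (gridMetric m P) x r) :
    qball (gridMetric m P) y r = qball (gridMetric m P) x r := by
  simp only [qball, mem_ofPred_eq] at hy
  ext z
  simp only [qball, mem_ofPred_eq]
  constructor
  · intro hz
    exact (h.gridMetric_ultra x y z).trans_lt (max_lt hy hz)
  · intro hz
    refine (h.gridMetric_ultra y x z).trans_lt (max_lt ?_ hz)
    rwa [gridMetric_comm]

omit [IsProbabilityMeasure m] in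
theorem qball_subset_qball (x : I) {r r' : ℝ} (hr : r ≤ r') :
    qball (gridMetric m P) x r ⊆ qball (gridMetric m P) x r' := fun _ hy =>
  lt_of_lt_of_le hy hr

theorem measurableSet_qball (h : IsRootedGrid m P) (x : I) (r : ℝ) :
    MeasurableSet (qball (gridMetric m P) x r) := by
  rcases le_or_gt r 0 with hr | hr
  · have : qball (gridMetric m P) x r = ∅ := by
      ext y
      simp only [qball, mem_ofPred_eq, mem_empty_iff_false, iff_false, not_lt]
      exact hr.trans (gridMetric_nonneg _ _ _ _)
    rw [this]
    exact MeasurableSet.empty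
  · obtain ⟨k, hk⟩ := h.qball_mem x hr
    exact h.measurable k _ hk

/-- A ρ-open set is the union of the grid sets it contains, and there are countably many of them. -/
theorem measurableSet_of_open (h : IsRootedGrid m P) {U : Set I}
    (hU : ∀ x ∈ U, ∃ r > 0, qball (gridMetric m P) x r ⊆ U) : MeasurableSet U := by
  have : U = ⋃ k, ⋃ Q ∈ P k, ⋃ (_ : Q ⊆ U), Q := by
    ext x
    simp only [mem_iUnion]
    constructor
    · intro hx
      obtain ⟨r, hr, hrU⟩ := hU x hx
      obtain ⟨k, hk⟩ := h.qball_mem x hr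
      exact ⟨k, _, hk, hrU, h.mem_qball_self x hr⟩
    · rintro ⟨k, Q, _, hQU, hx⟩
      exact hQU hx
  rw [this]
  exact MeasurableSet.iUnion fun k => Finset.measurableSet_biUnion _ fun Q hQ =>
    MeasurableSet.iUnion fun _ => h.measurable k Q hQ

theorem isAhlforsRegular (h : IsRootedGrid m P) : IsAhlforsRegular (gridMetric m P) m 1 := by
  obtain ⟨a, ha, ha1, hb⟩ := h.exists_real_qball
  refine ⟨1 / a, 1, by positivity, one_pos, fun x r hr hr1 => ?_⟩
  obtain ⟨h1, h2⟩ := hb x r hr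
  rw [min_eq_left hr1] at h1
  rw [Real.rpow_one]
  refine ⟨by rw [div_div_eq_mul_div, div_one]; linarith, h2.le.trans ?_⟩
  rw [div_mul_eq_mul_div, one_mul, le_div_iff₀ ha]
  nlinarith

theorem isHomogeneousSpace (h : IsRootedGrid m P) : IsHomogeneousSpace (gridMetric m P) m where
  quasiMetric := h.isQuasiMetric
  borel _ hU := h.measurableSet_of_open hU
  ball_measurable := h.measurableSet_qball
  doubling := by
    obtain ⟨a, ha, ha1, hb⟩ := h.exists_real_qball
    -- The ball of radius r has measure below r and at most 1, hence strictly below 4 min(r/2, 1),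
    -- while the half ball has measure at least a min(r/2, 1). The slack in 4 gives the strict
    -- inequality.
    refine ⟨(4 / a).toNNReal, fun x r hr => ⟨?_, ?_, ?_⟩⟩
    · obtain ⟨k, hk⟩ := h.qball_mem x hr
      exact h.pos k _ hk
    · rw [← ofReal_measureReal (measure_ne_top m (qball (gridMetric m P) x r)),
        ← ofReal_measureReal (measure_ne_top m (qball (gridMetric m P) x (r / 2)))]
      change _ < ENNReal.ofReal (4 / a) * _
      obtain ⟨h1, _⟩ := hb x (r / 2) (by positivity)
      obtain ⟨_, h2⟩ := hb x r hr
      have h3 : m.real (qball (gridMetric m P) x r) ≤ 1 := measureReal_le_one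
      have h0 : 0 < a * min (r / 2) 1 := mul_pos ha (lt_min (by positivity) one_pos)
      rw [← ENNReal.ofReal_mul (by positivity)]
      refine (ENNReal.ofReal_lt_ofReal_iff (mul_pos (by positivity) (h0.trans_le h1))).2 ?_
      calc m.real (qball (gridMetric m P) x r) < 4 * min (r / 2) 1 := by
            rcases min_cases (r / 2) 1 with ⟨e, _⟩ | ⟨e, _⟩ <;> rw [e] <;> linarith
        _ = 4 / a * (a * min (r / 2) 1) := by field_simp
        _ ≤ _ := by gcongr
    · exact ENNReal.mul_lt_top ENNReal.coe_lt_top (measure_lt_top _ _)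

/-- Elements of the grid are balls. -/
theorem exists_qball_eq_of_mem (h : IsRootedGrid m P) {k : ℕ} {Q : Set I} (hQ : Q ∈ P k) {x : I}
    (hx : x ∈ Q) : ∃ r : ℝ, 0 < r ∧ qball (gridMetric m P) x r = Q := by
  obtain ⟨a, b, ha, ha1, hb, hb1, hab⟩ := h.ratio
  have hpos := h.real_pos hQ
  -- A grid set from an earlier level that contains x contains the parent of Q, hence has measure at
  -- least |Q|/b; and |Q| itself is below |Q|/b.
  refine ⟨m.real Q / b, by positivity, ?_⟩
  ext y
  simp only [qball, mem_ofPred_eq]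
  constructor
  · intro hlt
    obtain ⟨j, R, hR, hxR, hyR, hlt⟩ := h.gridMetric_lt_iff.1 hlt
    rcases le_or_gt k j with hkj | hkj
    · exact (h.subset_or_disjoint hkj hR hQ).resolve_right
        (Set.not_disjoint_iff.2 ⟨x, hxR, hx⟩) hyR
    · exfalso
      obtain ⟨k, rfl⟩ : ∃ k', k = k' + 1 := ⟨k - 1, by omega⟩
      obtain ⟨S, hS, hQS⟩ := h.nested k Q hQ
      have hSR : S ⊆ R := (h.subset_or_disjoint (by omega) hS hR).resolve_right
        (Set.not_disjoint_iff.2 ⟨x, hQS hx, hxR⟩)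
      have h1 := (hab k Q hQ S hS hQS).2
      have h2 : m.real S ≤ m.real R := measureReal_mono hSR
      rw [lt_div_iff₀ hb] at hlt
      nlinarith
  · intro hy
    refine (gridMetric_le hQ hx hy).trans_lt ?_
    rw [lt_div_iff₀ hb]
    nlinarith

/-- Balls and grid sets are the same sets, so both infima are over the same numbers. Thus β = ρ for
the Han–Lu–Yang data. -/
theorem measureMetric_eq (h : IsRootedGrid m P) :
    measureMetric (gridMetric m P) m = gridMetric m P := by
  ext x y
  conv_rhs => unfold gridMetric
  unfold measureMetric
  congr 1
  ext t
  constructor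
  · rintro ⟨z, r, hr, hx, hy, rfl⟩
    obtain ⟨k, hk⟩ := h.qball_mem z hr
    exact ⟨k, _, hk, hx, hy, rfl⟩
  · rintro ⟨k, Q, hQ, hx, hy, rfl⟩
    obtain ⟨r, hr, he⟩ := h.exists_qball_eq_of_mem hQ hx
    exact ⟨x, r, hr, by rwa [he], by rwa [he], by rw [he]⟩

/-- Every positive power of an ultrametric satisfies the triangle inequality, so no chain is shorter
than the direct step. -/
theorem chainMetric_eq (h : IsRootedGrid m P) {γ : ℝ} (hγ : 0 < γ) (x y : I) :
    chainMetric (gridMetric m P) γ x y = gridMetric m P x y ^ γ := by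
  have hnn := gridMetric_nonneg m P
  have hchain : ∀ (u : ℕ → I) (n : ℕ), gridMetric m P (u 0) (u n) ^ γ ≤
      ∑ i ∈ Finset.range n, gridMetric m P (u i) (u (i + 1)) ^ γ := fun u n => by
    induction n with
    | zero => simp [h.gridMetric_self, hγ.ne']
    | succ n ih =>
      rw [Finset.sum_range_succ]
      have h1 : 0 ≤ gridMetric m P (u 0) (u n) ^ γ := Real.rpow_nonneg (hnn _ _) _
      have h2 : 0 ≤ gridMetric m P (u n) (u (n + 1)) ^ γ := Real.rpow_nonneg (hnn _ _) _
      rcases le_max_iff.1 (h.gridMetric_ultra (u 0) (u n) (u (n + 1))) with hle | hle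
      · have := Real.rpow_le_rpow (hnn _ _) hle hγ.le
        linarith
      · have := Real.rpow_le_rpow (hnn _ _) hle hγ.le
        linarith
  refine le_antisymm (csInf_le ⟨0, ?_⟩ ⟨1, fun i => if i = 0 then x else y, by simp⟩)
    (le_csInf ⟨_, 1, fun i => if i = 0 then x else y, by simp, by simp, rfl⟩ ?_)
  · rintro _ ⟨n, u, _, _, rfl⟩
    exact Finset.sum_nonneg fun i _ => Real.rpow_nonneg (hnn _ _) _
  · rintro _ ⟨n, u, rfl, rfl, rfl⟩
    exact hchain u n

/-! ### The partitions into balls of a fixed radius -/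

/-- The partition into the balls of radius `r`. -/
noncomputable def _root_.GridBesov.ballPartition (m : Measure I) (P : ℕ → Finset (Set I))
    (r : ℝ) : Finset (Set I) := by
  classical exact if h : {B : Set I | ∃ x, qball (gridMetric m P) x r = B}.Finite then
    h.toFinset else ∅

/-- Balls of radius r are grid sets of level at most N, where all sets of level N have measure below
r. There are finitely many, so the default ∅ does not occur for r > 0. -/
theorem mem_ballPartition (h : IsRootedGrid m P) {r : ℝ} (hr : 0 < r) {B : Set I} :
    B ∈ ballPartition m P r ↔ ∃ x, qball (gridMetric m P) x r = B := by
  classical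
  have hfin : {B : Set I | ∃ x, qball (gridMetric m P) x r = B}.Finite := by
    obtain ⟨a, b, ha, ha1, hb, hb1, hab⟩ := h.ratio
    obtain ⟨N, hN⟩ := h.exists_level_lt hr
    refine ((Finset.range (N + 1)).biUnion P).finite_toSet.subset ?_
    rintro B ⟨x, rfl⟩
    obtain ⟨k, hk, Q, hQ, hQr, _⟩ := h.exists_qball_eq ha ha1 hab x hN
    rw [hQr]
    simp only [Finset.coe_biUnion, mem_iUnion, Finset.mem_coe, Finset.mem_range]
    exact ⟨k, by omega, hQ⟩
  rw [ballPartition, dif_pos hfin, Set.Finite.mem_toFinset]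
  rfl

/-- Equal-radius balls of an ultrametric form a partition, and geometric radii make these partitions
nested with the right sizes. Consecutive partitions may share cells, which a good grid would forbid.
-/
theorem isScaledGrid_ballPartition (h : IsRootedGrid m P) {c lam : ℝ} (hc : 0 < c)
    (hlam : 0 < lam) (hlam1 : lam < 1) :
    IsScaledGrid m (fun k => ballPartition m P (c * lam ^ k)) (fun k => c * lam ^ k) := by
  have hr : ∀ k : ℕ, 0 < c * lam ^ k := fun k => by positivity
  have hmem : ∀ k : ℕ, ∀ B, B ∈ ballPartition m P (c * lam ^ k) ↔
      ∃ x, qball (gridMetric m P) x (c * lam ^ k) = B := fun k B => h.mem_ballPartition (hr k)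
  have hmeas : ∀ k : ℕ, ∀ B ∈ ballPartition m P (c * lam ^ k), MeasurableSet B := fun k B hB => by
    obtain ⟨x, rfl⟩ := (hmem k B).1 hB
    exact h.measurableSet_qball _ _
  refine ⟨⟨hmeas, fun k B hB => ?_, fun k B hB B' hB' hne => ?_, fun k => ?_, fun k B hB => ?_,
    le_antisymm ?_ ?_⟩, ⟨lam, hlam, hlam1, hr, fun k => ?_⟩, ⟨1 / lam, by positivity, fun k => ?_⟩,
    ?_⟩
  · obtain ⟨x, rfl⟩ := (hmem k B).1 hB
    obtain ⟨j, hj⟩ := h.qball_mem x (hr k)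
    exact h.pos j _ hj
  · obtain ⟨x, rfl⟩ := (hmem k B).1 hB
    obtain ⟨y, rfl⟩ := (hmem k B').1 hB'
    refine Set.disjoint_left.2 fun z hz hz' => hne ?_
    rw [← h.qball_eq_of_mem hz, ← h.qball_eq_of_mem hz']
  · have : {x | ∀ Q ∈ ballPartition m P (c * lam ^ k), x ∉ Q} = ∅ := by
      ext x
      simp only [mem_ofPred_eq, mem_empty_iff_false, iff_false, not_forall, not_not]
      exact ⟨_, (hmem k _).2 ⟨x, rfl⟩, h.mem_qball_self x (hr k)⟩
    rw [this, measure_empty]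
  · obtain ⟨x, rfl⟩ := (hmem (k + 1) B).1 hB
    refine ⟨_, (hmem k _).2 ⟨x, rfl⟩, qball_subset_qball x ?_⟩
    have : lam ^ (k + 1) ≤ lam ^ k := pow_le_pow_of_le_one hlam.le hlam1.le (by omega)
    gcongr
  · conv_lhs => rw [h.generates]
    refine MeasurableSpace.generateFrom_le fun Q ⟨j, hQ⟩ => ?_
    -- No point outside Q is closer than |Q| to a point of Q, so Q is a union of balls of any radius
    -- below |Q|.
    obtain ⟨k, hk⟩ := exists_pow_lt_of_lt_one (div_pos (h.real_pos hQ) hc) hlam1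
    rw [lt_div_iff₀ hc, mul_comm] at hk
    have hQe : Q = ⋃ B ∈ ballPartition m P (c * lam ^ k), ⋃ (_ : B ⊆ Q), B := by
      ext x
      simp only [mem_iUnion]
      constructor
      · intro hx
        refine ⟨_, (hmem k _).2 ⟨x, rfl⟩, fun y hy => ?_, h.mem_qball_self x (hr k)⟩
        by_contra hyQ
        exact absurd (h.real_le_gridMetric hQ hx hyQ) (not_le.2 (lt_trans hy hk))
      · rintro ⟨B, _, hBQ, hx⟩
        exact hBQ hx
    rw [hQe]
    refine @Finset.measurableSet_biUnion _ _ (_) _ _ fun B hB => ?_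
    exact @MeasurableSet.iUnion _ _ (_) _ _ fun _ =>
      MeasurableSpace.measurableSet_generateFrom ⟨k, hB⟩
  · exact MeasurableSpace.generateFrom_le fun Q ⟨k, hQ⟩ => hmeas k Q hQ
  · simp only [pow_succ]
    linarith
  · simp only [pow_succ]
    field_simp
    exact le_rfl
  · obtain ⟨a, ha, ha1, hb⟩ := h.exists_real_qball
    refine ⟨max c 1 / a + 1, by positivity, fun k B hB => ?_⟩
    obtain ⟨x, rfl⟩ := (hmem k B).1 hB
    obtain ⟨h1, h2⟩ := hb x _ (hr k)
    -- Radii above 1 occur when c > 1; since they never exceed c, the factor `max c 1` absorbs the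
    -- truncation at 1.
    have hrc : c * lam ^ k ≤ max c 1 * min (c * lam ^ k) 1 := by
      have hle : c * lam ^ k ≤ c := mul_le_of_le_one_right hc.le (pow_le_one₀ hlam.le hlam1.le)
      rcases min_cases (c * lam ^ k) 1 with ⟨e, _⟩ | ⟨e, _⟩ <;> rw [e]
      · exact le_mul_of_one_le_left (hr k).le (le_max_right _ _)
      · rw [mul_one]
        exact hle.trans (le_max_left _ _)
    constructor
    · calc c * lam ^ k ≤ max c 1 * min (c * lam ^ k) 1 := hrc
        _ = max c 1 / a * (a * min (c * lam ^ k) 1) := by field_simp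
        _ ≤ max c 1 / a * m.real (qball (gridMetric m P) x (c * lam ^ k)) := by gcongr
        _ ≤ _ := by
            rw [add_mul, one_mul]
            exact le_add_of_nonneg_right measureReal_nonneg
    · have : 0 ≤ max c 1 / a * (c * lam ^ k) := by positivity
      linarith

/-- There are grids adapted to the ultrametric, with any collar exponent. -/
theorem exists_isAdaptedGrid (h : IsRootedGrid m P) : ∃ (W : ℕ → Finset (Set I)) (z : Set I → I)
    (lam : ℝ), ∀ η : ℝ, 0 < η →
      IsAdaptedGrid (gridMetric m P) m W z η 1 1 (1 / 2) 1 lam := by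
  classical
  obtain ⟨a, ha, ha1, hb⟩ := h.exists_real_qball
  have hne : Nonempty I := nonempty_of_isProbabilityMeasure m
  -- With this ratio a child has measure below lam^(k+1) = (1/2) a lam^k, at most half the measure
  -- of its parent, so the partitions really refine.
  set lam := a / 2 with hlam
  have hl0 : 0 < lam := by positivity
  have hl1 : lam < 1 := by linarith
  have hS := h.isScaledGrid_ballPartition one_pos hl0 hl1
  simp only [one_mul] at hS
  have hpow : ∀ k : ℕ, lam ^ k ≤ 1 := fun k => pow_le_one₀ hl0.le hl1.le
  have hmem : ∀ k : ℕ, ∀ B, B ∈ ballPartition m P (lam ^ k) ↔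
      ∃ x, qball (gridMetric m P) x (lam ^ k) = B := fun k B => h.mem_ballPartition (by positivity)
  set z : Set I → I := fun Q => if hQ : Q.Nonempty then hQ.some else Classical.arbitrary I with hz
  have hzmem : ∀ k : ℕ, ∀ Q ∈ ballPartition m P (lam ^ k), z Q ∈ Q := fun k Q hQ => by
    obtain ⟨x, rfl⟩ := (hmem k Q).1 hQ
    have hne : (qball (gridMetric m P) x (lam ^ k)).Nonempty :=
      ⟨x, h.mem_qball_self x (by positivity)⟩
    simp only [hz]
    rw [dif_pos hne]
    exact hne.some_mem
  have hball : ∀ k : ℕ, ∀ Q ∈ ballPartition m P (lam ^ k), ∀ x ∈ Q,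
      qball (gridMetric m P) x (lam ^ k) = Q := fun k Q hQ x hx => by
    obtain ⟨y, rfl⟩ := (hmem k Q).1 hQ
    exact h.qball_eq_of_mem hx
  have hreal : ∀ k : ℕ, ∀ Q ∈ ballPartition m P (lam ^ k),
      a * lam ^ k ≤ m.real Q ∧ m.real Q < lam ^ k := fun k Q hQ => by
    obtain ⟨x, rfl⟩ := (hmem k Q).1 hQ
    have := hb x (lam ^ k) (by positivity)
    rwa [min_eq_left (hpow k)] at this
  refine ⟨fun k => ballPartition m P (lam ^ k), z, lam, fun η hη => ⟨⟨hS.measurable, hS.pos,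
    hS.disjoint, hS.cover, hS.nested, hS.generates, ⟨a * lam, 1 / 2, by positivity, ?_,
    by norm_num, by norm_num, fun k Q hQ R hR hQR => ?_⟩⟩, hη, one_pos, one_pos, by norm_num,
    one_pos, hl0, hl1, hzmem, fun k _ Q hQ => ?_, fun k _ Q hQ x hx y hy => ?_,
    fun k hk Q hQ t ht => ?_⟩⟩
  · nlinarith
  · obtain ⟨h1, h2⟩ := hreal (k + 1) Q hQ
    obtain ⟨h3, h4⟩ := hreal k R hR
    have hpos : 0 < m.real R := hS.real_pos hR
    rw [pow_succ] at h1 h2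
    rw [le_div_iff₀ hpos, div_le_iff₀ hpos]
    constructor
    · calc a * lam * m.real R ≤ a * lam * lam ^ k := by gcongr
        _ ≤ _ := by linarith
    · have : lam ^ k * lam = 1 / 2 * (a * lam ^ k) := by
        conv_lhs => rw [mul_comm, hlam]
        ring
      linarith
  · rw [one_mul, hball k Q hQ _ (hzmem k Q hQ)]
  · rw [← hball k Q hQ x hx] at hy
    rw [one_mul]
    exact le_of_lt hy
  -- Points of Q are at distance at least lam^k from the complement, so the collar is empty for t ≤
  -- 1. For t > 1 the bound is trivial as t^η ≥ 1. Hence every η is allowed.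
  · rcases le_or_gt t 1 with ht1 | ht1
    -- The infimum over an empty complement would be 0 by convention, so Q has to be a proper
    -- subset.
    · have hQc : Qᶜ.Nonempty := by
        rw [Set.nonempty_compl]
        rintro rfl
        have := (hreal k _ hQ).2
        rw [probReal_univ] at this
        linarith [hpow k]
      have : {x | x ∈ Q ∧ sInf ((fun y => gridMetric m P x y) '' Qᶜ) ≤ 1 / 2 * t * lam ^ k}
          = ∅ := by
        ext x
        simp only [mem_ofPred_eq, mem_empty_iff_false, iff_false, not_and, not_le]
        intro hx
        have hpk : 0 < lam ^ k := by positivity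
        have h1 : lam ^ k ≤ sInf ((fun y => gridMetric m P x y) '' Qᶜ) := by
          refine le_csInf (hQc.image _) ?_
          rintro _ ⟨y, hy, rfl⟩
          rw [← hball k Q hQ x hx] at hy
          exact not_lt.1 hy
        nlinarith
      rw [this, measure_empty]
      exact zero_le
    · refine (measure_mono fun x hx => hx.1).trans ?_
      have : (1 : ℝ≥0∞) ≤ ENNReal.ofReal (1 * t ^ η) := by
        rw [one_mul, ← ENNReal.ofReal_one]
        exact ENNReal.ofReal_le_ofReal (Real.one_le_rpow ht1.le hη.le)
      calc m Q = 1 * m Q := (one_mul _).symm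
        _ ≤ _ := by gcongr

theorem exists_isHLYSetup (h : IsRootedGrid m P) (s : ℝ) (hs : 0 < s) :
    ∃ (W : ℕ → Finset (Set I)) (z : Set I → I) (K R lam γ : ℝ),
      IsHLYSetup (gridMetric m P) m s W z K R lam γ := by
  obtain ⟨W, z, lam, hW⟩ := h.exists_isAdaptedGrid
  have hq := h.isQuasiMetric
  have hs1 : 0 < s + 1 := by linarith
  refine ⟨W, z, 1, 1, lam, s + 1, le_rfl, ?_, ⟨1, 1, 1 / 2, 1, ?_⟩, by linarith, by linarith,
    ?_, ⟨1, le_rfl, ?_⟩⟩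
  all_goals rw [h.measureMetric_eq]
  · intro x y w
    rw [one_mul]
    exact (h.gridMetric_ultra x y w).trans (max_le_add_of_nonneg (gridMetric_nonneg _ _ _ _)
      (gridMetric_nonneg _ _ _ _))
  · exact hW 1 one_pos
  · refine ⟨fun x y => ?_, fun x y => ?_, fun x y w => ?_⟩
    · rw [h.chainMetric_eq hs1, Real.rpow_eq_zero (gridMetric_nonneg _ _ _ _) hs1.ne']
      constructor
      · intro h0
        by_contra hne
        exact (hq.pos x y hne).ne' h0
      · rintro rfl
        exact hq.self_eq_zero x
    · rw [h.chainMetric_eq hs1, h.chainMetric_eq hs1, gridMetric_comm]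
    · simp only [h.chainMetric_eq hs1]
      have h1 := Real.rpow_nonneg (gridMetric_nonneg m P x y) (s + 1)
      have h2 := Real.rpow_nonneg (gridMetric_nonneg m P y w) (s + 1)
      rcases le_max_iff.1 (h.gridMetric_ultra x y w) with hle | hle
      · have := Real.rpow_le_rpow (gridMetric_nonneg m P _ _) hle hs1.le
        linarith
      · have := Real.rpow_le_rpow (gridMetric_nonneg m P _ _) hle hs1.le
        linarith
  · intro x y
    rw [h.chainMetric_eq hs1]
    simp

theorem exists_isBesovGrid (h : IsRootedGrid m P) {s p : ℝ} (hs : 0 < s) (hp : 1 ≤ p) :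
    ∃ W, IsBesovGrid (gridMetric m P) m s p W := by
  obtain ⟨W, z, lam, hW⟩ := h.exists_isAdaptedGrid
  refine ⟨W, gridMetric m P, h.isQuasiMetric, ⟨1, 1, one_pos, le_rfl, fun x y => by simp⟩,
    h.isAhlforsRegular, z, s * p + 1, 1, 1, 1 / 2, 1, lam, hW _ (by positivity), by linarith⟩

end IsRootedGrid

end GridBesov

/-! ### Comparison of quasi-metrics, diameters and collars. -/

namespace GridBesov

/-- The elements of the `j`-th family have diameter at most a multiple of `σ j`. -/
def DiamBound {I : Type*} (ρ : I → I → ℝ) (H : ℕ → Finset (Set I)) (σ : ℕ → ℝ) : Prop :=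
  ∃ A : ℝ, 0 < A ∧ ∀ j, ∀ R ∈ H j, ∀ x ∈ R, ∀ y ∈ R, ρ x y ≤ A * σ j

/-- If a < b, then r^(b-a) tends to 0 with r, which contradicts 1 ≤ K r^(b-a). -/
theorem exponent_le_of_rpow_le {a b K r₁ : ℝ} (hr₁ : 0 < r₁)
    (h : ∀ r : ℝ, 0 < r → r ≤ r₁ → r ^ a ≤ K * r ^ b) : b ≤ a := by
  by_contra! hab
  have hpos : 0 < b - a := by linarith
  have ht : Tendsto (fun r : ℝ => K * r ^ (b - a)) (𝓝 0) (𝓝 (K * (0 : ℝ) ^ (b - a))) :=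
    ((Real.continuous_rpow_const hpos.le).tendsto 0).const_mul K
  rw [Real.zero_rpow hpos.ne', mul_zero] at ht
  have h1 : ∀ᶠ r in 𝓝[>] (0 : ℝ), K * r ^ (b - a) < 1 :=
    (ht.mono_left nhdsWithin_le_nhds).eventually (gt_mem_nhds one_pos)
  have h2 : ∀ᶠ r in 𝓝[>] (0 : ℝ), r ≤ r₁ :=
    nhdsWithin_le_nhds (ge_mem_nhds hr₁)
  obtain ⟨r, ⟨hr1, hr2⟩, hr0⟩ := ((h1.and h2).and self_mem_nhdsWithin).exists
  have hr0 : 0 < r := hr0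
  have := h r hr0 hr2
  rw [Real.rpow_sub hr0, mul_div_assoc', div_lt_one (by positivity)] at hr1
  linarith

variable {I : Type*} [mI : MeasurableSpace I] {m : Measure I} [IsProbabilityMeasure m]
  {P : ℕ → Finset (Set I)}

/-- Two functions on pairs are comparable up to constants. -/
def MetricEquiv (d ρ : I → I → ℝ) : Prop :=
  ∃ C : ℝ, 0 < C ∧ ∀ x y, d x y ≤ C * ρ x y ∧ ρ x y ≤ C * d x y

/-- A `1`-Ahlfors regular quasi-metric that is equivalent to a power of the ultrametric of the
grid is equivalent to the ultrametric itself. -/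
theorem IsRootedGrid.metricEquiv_of_powerLawEquiv (h : IsRootedGrid m P) {d : I → I → ℝ}
    (hpow : PowerLawEquiv d (gridMetric m P)) (hreg : IsAhlforsRegular d m 1) :
    MetricEquiv d (gridMetric m P) := by
  obtain ⟨θ, C, hθ, hC, hd⟩ := hpow
  obtain ⟨C', r₀, hC', hr₀, hreg⟩ := hreg
  obtain ⟨a, ha, ha1, hb⟩ := h.exists_real_qball
  have hC0 : 0 < C := by linarith
  have hnn := IsRootedGrid.gridMetric_nonneg m P
  obtain ⟨x⟩ := nonempty_of_isProbabilityMeasure m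
  -- A d-ball of radius r has measure comparable to r by regularity, and to r^(1/θ) by comparison
  -- with ρ-balls. Letting r → 0 in both directions identifies the exponents.
  have hθe : θ⁻¹ = 1 := by
    apply le_antisymm
    · refine exponent_le_of_rpow_le (K := C' * C ^ θ⁻¹) hr₀ fun r hr hrr => ?_
      have h1 := (hreg x r hr hrr).1
      have hsub : qball d x r ⊆ qball (gridMetric m P) x ((C * r) ^ θ⁻¹) := fun y hy => by
        rw [qball, mem_ofPred_eq, Real.lt_rpow_inv_iff_of_pos (hnn _ _) (by positivity) hθ]
        refine (hd x y).2.trans_lt ?_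
        have : d x y < r := hy
        gcongr
      have h2 := (measureReal_mono (μ := m) hsub).trans (hb x _ (by positivity)).2.le
      rw [Real.mul_rpow hC0.le hr.le] at h2
      have h3 := h1.trans h2
      rw [div_le_iff₀ hC'] at h3
      linarith
    · refine exponent_le_of_rpow_le (K := C' * C ^ θ⁻¹ / a) (lt_min hr₀ one_pos)
        fun r hr hrr => ?_
      have h1 := (hreg x r hr (hrr.trans (min_le_left _ _))).2
      have hsub : qball (gridMetric m P) x ((r / C) ^ θ⁻¹) ⊆ qball d x r := fun y hy => by
        rw [qball, mem_ofPred_eq, Real.lt_rpow_inv_iff_of_pos (hnn _ _) (by positivity) hθ] at hy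
        have := ((hd x y).1).trans_lt hy
        exact (div_lt_div_iff_of_pos_right hC0).1 this
      have h2 := (hb x ((r / C) ^ θ⁻¹) (by positivity)).1.trans
        (measureReal_mono (μ := m) hsub)
      have hle : (r / C) ^ θ⁻¹ ≤ 1 := Real.rpow_le_one (by positivity)
        ((div_le_one hC0).2 ((hrr.trans (min_le_right _ _)).trans hC)) (by positivity)
      rw [min_eq_left hle, Real.div_rpow hr.le hC0.le] at h2
      have h3 := h2.trans h1
      have hCp : 0 < C ^ θ⁻¹ := by positivity
      rw [← mul_div_assoc, div_le_iff₀ hCp] at h3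
      rw [div_mul_eq_mul_div, le_div_iff₀ ha]
      linarith
  have hθ1 : θ = 1 := by rw [← inv_inv θ, hθe, inv_one]
  subst hθ1
  refine ⟨C, hC0, fun x y => ?_⟩
  have := hd x y
  rw [Real.rpow_one, div_le_iff₀ hC0] at this
  exact ⟨by linarith [this.1], this.2⟩

theorem IsRootedGrid.exists_le_real_qball (h : IsRootedGrid m P) {c : ℝ} (hc : 0 < c) :
    ∃ A : ℝ, 0 < A ∧ ∀ x, ∀ t : ℝ, 0 < t → t ≤ 1 →
      t ≤ A * m.real (qball (gridMetric m P) x (c * t)) := by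
  obtain ⟨a, ha, ha1, hb⟩ := h.exists_real_qball
  refine ⟨max c 1 / (c * a), by positivity, fun x t ht ht1 => ?_⟩
  have h1 := (hb x (c * t) (by positivity)).1
  have h2 : c * t ≤ max c 1 * min (c * t) 1 := by
    rcases min_cases (c * t) 1 with ⟨e, _⟩ | ⟨e, _⟩ <;> rw [e]
    · exact le_mul_of_one_le_left (by positivity) (le_max_right _ _)
    · rw [mul_one]
      exact (mul_le_of_le_one_right hc.le ht1).trans (le_max_left _ _)
  calc t = c * t / c := by field_simp
    _ ≤ max c 1 * min (c * t) 1 / c := by gcongr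
    _ = max c 1 / (c * a) * (a * min (c * t) 1) := by field_simp
    _ ≤ _ := by gcongr

/-! ### Adapted grids as scaled grids with small collars. -/

section Adapted

variable {W : ℕ → Finset (Set I)} {d : I → I → ℝ} {z : Set I → I} {η C₁ C₂ C₃ C₄ lam : ℝ}

theorem IsAdaptedGrid.diamBound (h : IsRootedGrid m P)
    (hW : IsAdaptedGrid d m W z η C₁ C₂ C₃ C₄ lam) (hd : MetricEquiv d (gridMetric m P)) :
    DiamBound (gridMetric m P) W (fun k => lam ^ k) := by
  obtain ⟨C, hC, hd⟩ := hd
  have hC₂ := hW.C₂_pos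
  have hl := hW.lam_pos
  refine ⟨C * C₂ + 1, by positivity, fun k Q hQ x hx y hy => ?_⟩
  -- Adaptedness says nothing about diameters at level 0; there ρ ≤ 1 suffices.
  rcases Nat.eq_zero_or_pos k with rfl | hk
  · have := h.gridMetric_le_one x y
    have : 0 < C * C₂ := by positivity
    simp only [pow_zero]
    linarith
  · calc gridMetric m P x y ≤ C * d x y := (hd x y).2
      _ ≤ C * (C₂ * lam ^ k) := by gcongr; exact hW.diam_le k hk Q hQ x hx y hy
      _ ≤ _ := by
        have : 0 < lam ^ k := by positivity
        linarith

/-- The inner ball bounds |Q| from below and the diameter bounds it from above, because ρ-balls have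
measure comparable to their radius. -/
theorem IsAdaptedGrid.isScaledGrid (h : IsRootedGrid m P)
    (hW : IsAdaptedGrid d m W z η C₁ C₂ C₃ C₄ lam) (hd : MetricEquiv d (gridMetric m P)) :
    IsScaledGrid m W (fun k => lam ^ k) := by
  have hg := hW.good.isPartitionGrid
  obtain ⟨D, hD, hdiam⟩ := hW.diamBound h hd
  obtain ⟨C, hC, hd⟩ := hd
  have hC₁ := hW.C₁_pos
  have hl := hW.lam_pos
  have hl1 := hW.lam_lt_one
  obtain ⟨a, ha, ha1, hb⟩ := h.exists_real_qball
  obtain ⟨A, hA, hlow⟩ := h.exists_le_real_qball (c := C₁ / C) (by positivity)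
  have hlow' : ∀ k, 1 ≤ k → ∀ Q ∈ W k, lam ^ k ≤ A * m.real Q := fun k hk Q hQ => by
    refine (hlow (z Q) (lam ^ k) (by positivity) (pow_le_one₀ hl.le hl1.le)).trans ?_
    refine mul_le_mul_of_nonneg_left ?_ hA.le
    refine measureReal_mono (Set.Subset.trans (fun y hy => ?_) (hW.ball_subset k hk Q hQ))
    have hy : gridMetric m P (z Q) y < C₁ / C * lam ^ k := hy
    calc d (z Q) y ≤ C * gridMetric m P (z Q) y := (hd _ _).1
      _ < C * (C₁ / C * lam ^ k) := by gcongr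
      _ = _ := by field_simp
  refine ⟨hg, ⟨lam, hl, hl1, fun k => by positivity, fun k => (pow_succ' lam k).le⟩,
    ⟨1 / lam, by positivity, fun k => by simp only [pow_succ]; field_simp; exact le_rfl⟩,
    ⟨A + A / lam + (D + 1), by positivity, fun k Q hQ => ⟨?_, ?_⟩⟩⟩
  · have hQ0 := hg.real_pos hQ
    rcases Nat.eq_zero_or_pos k with rfl | hk
    -- At level 0 no inner ball is given; a level 1 set inside Q supplies the lower bound, at the
    -- cost of a factor 1/lam.
    · obtain ⟨Q', hQ', hne⟩ := hg.exists_mem_inter 1 (hg.pos 0 Q hQ)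
      have hsub : Q' ⊆ Q := (hg.subset_or_disjoint (by omega) hQ' hQ).resolve_right
        (Set.not_disjoint_iff_nonempty_inter.2 hne)
      have h1 := hlow' 1 le_rfl Q' hQ'
      have h2 : m.real Q' ≤ m.real Q := measureReal_mono hsub
      rw [pow_one] at h1
      calc lam ^ 0 = lam / lam := by field_simp
        _ ≤ A * m.real Q / lam := by gcongr; exact h1.trans (by gcongr)
        _ = A / lam * m.real Q := by ring
        _ ≤ _ := by gcongr; linarith
    · refine (hlow' k hk Q hQ).trans ?_
      gcongr
      have : 0 < A / lam := by positivity
      linarith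
  · have hlk : 0 < lam ^ k := by positivity
    calc m.real Q ≤ m.real (qball (gridMetric m P) (z Q) ((D + 1) * lam ^ k)) := by
          refine measureReal_mono fun y hy => ?_
          refine (hdiam k Q hQ (z Q) (hW.center_mem k Q hQ) y hy).trans_lt ?_
          linarith
      _ ≤ (D + 1) * lam ^ k := (hb _ _ (by positivity)).2.le
      _ ≤ _ := by
          have : 0 < A / lam := by positivity
          exact mul_le_mul_of_nonneg_right (by linarith) hlk.le

omit [IsProbabilityMeasure m] in
-- A point x of Q in some R not contained in Q is within d-distance C D σ_j of the complement, since
-- R has ρ-diameter at most D σ_j. So it lies in the collar with t = C D σ_j / (C₃ lam^k).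
theorem IsAdaptedGrid.collarBound (hW : IsAdaptedGrid d m W z η C₁ C₂ C₃ C₄ lam)
    (hd0 : ∀ x y, 0 ≤ d x y) (hd : MetricEquiv d (gridMetric m P)) {H : ℕ → Finset (Set I)}
    {σ : ℕ → ℝ} (hσ : ∀ j, 0 < σ j) (hH : DiamBound (gridMetric m P) H σ) :
    CollarBound m H W σ (fun k => lam ^ k) η := by
  have hg := hW.good.isPartitionGrid
  obtain ⟨C, hC, hd⟩ := hd
  obtain ⟨D, hD, hdiam⟩ := hH
  have hC₃ := hW.C₃_pos
  have hC₄ := hW.C₄_pos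
  have hl := hW.lam_pos
  have hη := hW.η_pos
  set A := C₄ * (C * D / C₃) ^ η with hA
  have hA0 : 0 < A := by positivity
  have key : ∀ j k, 1 ≤ k → ∀ Q ∈ W k, m {x | x ∈ Q ∧ ∃ R ∈ H j, x ∈ R ∧ ¬ R ⊆ Q} ≤
      ENNReal.ofReal (A * (σ j / lam ^ k) ^ η) * m Q := fun j k hk Q hQ => by
    have hσj := hσ j
    have hlk : 0 < lam ^ k := by positivity
    have e : A * (σ j / lam ^ k) ^ η = C₄ * (C * D * σ j / (C₃ * lam ^ k)) ^ η := by
      rw [hA, mul_assoc, ← Real.mul_rpow (by positivity) (by positivity)]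
      congr 2
      field_simp
    rw [e]
    refine le_trans (measure_mono ?_) (hW.collar k hk Q hQ _ (by positivity))
    rintro x ⟨hxQ, R, hR, hxR, hRQ⟩
    obtain ⟨y, hyR, hyQ⟩ := Set.not_subset.1 hRQ
    refine ⟨hxQ, ?_⟩
    calc sInf ((fun y => d x y) '' Qᶜ) ≤ d x y :=
          csInf_le ⟨0, by rintro _ ⟨y, _, rfl⟩; exact hd0 x y⟩ ⟨y, hyQ, rfl⟩
      _ ≤ C * gridMetric m P x y := (hd x y).1
      _ ≤ C * (D * σ j) := by gcongr; exact hdiam j R hR x hxR y hyR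
      _ = _ := by field_simp
  refine ⟨A * (1 / lam) ^ η + A, by positivity, fun j k Q hQ => ?_⟩
  have hσj := hσ j
  rcases Nat.eq_zero_or_pos k with rfl | hk
  -- Level 0 has no collar hypothesis. A cell not contained in Q is not contained in any level 1 set
  -- inside Q, so the level 1 estimates add up; the change of scale costs (1/lam)^η.
  · set S := {x | x ∈ Q ∧ ∃ R ∈ H j, x ∈ R ∧ ¬ R ⊆ Q} with hS
    set ε := ENNReal.ofReal (A * (σ j / lam ^ 1) ^ η) with hε
    have h1 : m S ≤ ∑ Q' ∈ W 1, m (Q' ∩ S) := by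
      refine le_trans (measure_mono_ae ?_) (measure_biUnion_finset_le (W 1) fun Q' => Q' ∩ S)
      filter_upwards [hg.ae_mem 1] with x ⟨Q', hQ', hx⟩ hxS
      exact Set.mem_iUnion₂.2 ⟨Q', hQ', hx, hxS⟩
    have h2 : ∀ Q' ∈ W 1, m (Q' ∩ S) ≤ ε * m (Q' ∩ Q) := fun Q' hQ' => by
      rcases hg.subset_or_disjoint zero_le_one hQ' hQ with hsub | hdis
      · rw [inter_eq_left.2 hsub]
        refine le_trans (measure_mono ?_) (key j 1 le_rfl Q' hQ')
        rintro x ⟨hx, _, R, hR, hxR, hRQ⟩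
        exact ⟨hx, R, hR, hxR, fun hRQ' => hRQ (hRQ'.trans hsub)⟩
      · have : Q' ∩ S = ∅ := by
          ext x
          simp only [mem_inter_iff, mem_empty_iff_false, iff_false, not_and]
          exact fun hx hxS => Set.disjoint_left.1 hdis hx hxS.1
        rw [this, measure_empty]
        exact zero_le
    have h3 : ∑ Q' ∈ W 1, m (Q' ∩ Q) = m Q := by
      have hQm := hg.measurable 0 Q hQ
      have := hg.lintegral_eq_sum 1 (Q.indicator 1)
      rw [lintegral_indicator_one hQm] at this
      rw [this]
      refine Finset.sum_congr rfl fun Q' hQ' => ?_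
      rw [lintegral_indicator_one hQm, Measure.restrict_apply hQm, inter_comm]
    calc m S ≤ ∑ Q' ∈ W 1, ε * m (Q' ∩ Q) := h1.trans (Finset.sum_le_sum h2)
      _ = ε * m Q := by rw [← Finset.mul_sum, h3]
      _ ≤ _ := by
          gcongr
          apply ENNReal.ofReal_le_ofReal
          have e : A * (σ j / lam ^ 1) ^ η = A * (1 / lam) ^ η * (σ j / lam ^ 0) ^ η := by
            have : (σ j / lam ^ 1) ^ η = (1 / lam) ^ η * (σ j / lam ^ 0) ^ η := by
              rw [← Real.mul_rpow (by positivity) (by positivity)]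
              congr 1
              field_simp
            rw [this]
            ring
          rw [e, add_mul]
          have : 0 ≤ A * (σ j / lam ^ 0) ^ η := by positivity
          linarith
  · refine (key j k hk Q hQ).trans ?_
    gcongr
    have : 0 ≤ A * (1 / lam) ^ η := by positivity
    linarith

end Adapted

/-! ### Grids made of sets of `P`, and recalibrations. -/

omit [IsProbabilityMeasure m] in
theorem diamBound_of_mem_grid {H : ℕ → Finset (Set I)} {σ : ℕ → ℝ} (hH : IsScaledGrid m H σ)
    (hmem : ∀ k, ∀ Q ∈ H k, ∃ j, Q ∈ P j) : DiamBound (gridMetric m P) H σ := by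
  obtain ⟨A, hA, hsize⟩ := hH.size
  refine ⟨A, hA, fun k R hR x hx y hy => ?_⟩
  obtain ⟨j, hj⟩ := hmem k R hR
  exact (IsRootedGrid.gridMetric_le hj hx hy).trans (hsize k R hR).2

/-- Elements of the grid have empty collars at scales smaller than their measure. -/
theorem IsRootedGrid.collarBound (h : IsRootedGrid m P) {H W : ℕ → Finset (Set I)}
    {σ τ : ℕ → ℝ} (hσ : ∀ j, 0 < σ j) (hH : DiamBound (gridMetric m P) H σ)
    (hW : IsScaledGrid m W τ) (hmem : ∀ k, ∀ Q ∈ W k, ∃ j, Q ∈ P j) {η : ℝ} (hη : 0 < η) :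
    CollarBound m H W σ τ η := by
  obtain ⟨D, hD, hdiam⟩ := hH
  obtain ⟨A, hA, hsize⟩ := hW.size
  refine ⟨(A * D) ^ η, by positivity, fun j k Q hQ => ?_⟩
  have hσj := hσ j
  have hτk := hW.scale_pos k
  rcases Set.eq_empty_or_nonempty {x | x ∈ Q ∧ ∃ R ∈ H j, x ∈ R ∧ ¬ R ⊆ Q} with he | hne
  · rw [he, measure_empty]
    exact zero_le
  · obtain ⟨x, hxQ, R, hR, hxR, hRQ⟩ := hne
    obtain ⟨y, hyR, hyQ⟩ := Set.not_subset.1 hRQ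
    obtain ⟨i, hi⟩ := hmem k Q hQ
    -- Leaving the grid set Q from inside costs a distance of at least |Q|, so a nonempty collar
    -- forces σ_j to be at least a constant times τ_k, and the claimed bound is then trivial.
    have h1 : τ k ≤ A * (D * σ j) := (hsize k Q hQ).1.trans (by
      gcongr
      exact (h.real_le_gridMetric hi hxQ hyQ).trans (hdiam j R hR x hxR y hyR))
    have h2 : (1 : ℝ≥0∞) ≤ ENNReal.ofReal ((A * D) ^ η * (σ j / τ k) ^ η) := by
      rw [← Real.mul_rpow (by positivity) (by positivity), ← ENNReal.ofReal_one]
      refine ENNReal.ofReal_le_ofReal (Real.one_le_rpow ?_ hη.le)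
      rw [← mul_div_assoc, one_le_div hτk]
      linarith
    calc m {x | x ∈ Q ∧ ∃ R ∈ H j, x ∈ R ∧ ¬ R ⊆ Q} ≤ m Q := measure_mono fun x hx => hx.1
      _ = 1 * m Q := (one_mul _).symm
      _ ≤ _ := by gcongr

theorem IsRecalibration.isScaledGrid {G : ℕ → Finset (Set I)} (hG : IsRecalibration m P G) :
    IsScaledGrid m G (maxSize m G) := by
  have hg := hG.good.isPartitionGrid
  have hfin : ∀ k, ((fun Q : Set I => m.real Q) '' (G k : Set (Set I))).Finite := fun k =>
    (G k).finite_toSet.image _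
  have hne : ∀ k, ((fun Q : Set I => m.real Q) '' (G k : Set (Set I))).Nonempty := fun k => by
    obtain ⟨Q, hQ, _⟩ := hg.exists_mem_inter k (S := univ) (by simp)
    exact ⟨_, Q, hQ, rfl⟩
  have hmax : ∀ k, ∀ Q ∈ G k, m.real Q ≤ maxSize m G k := fun k Q hQ =>
    le_csSup (hfin k).bddAbove ⟨Q, hQ, rfl⟩
  have hmin : ∀ k, ∀ Q ∈ G k, minSize m G k ≤ m.real Q := fun k Q hQ =>
    csInf_le (hfin k).bddBelow ⟨Q, hQ, rfl⟩
  have hmaxpos : ∀ k, 0 < maxSize m G k := fun k => by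
    obtain ⟨Q, hQ, e⟩ := (hne k).csSup_mem (hfin k)
    rw [maxSize, ← e]
    exact hg.real_pos hQ
  have hminpos : ∀ k, 0 < minSize m G k := fun k => by
    obtain ⟨Q, hQ, e⟩ := (hne k).csInf_mem (hfin k)
    rw [minSize, ← e]
    exact hg.real_pos hQ
  obtain ⟨c₁, c₂, h1, _, h2, h2', hgeo⟩ := hG.geometric
  obtain ⟨δ, hδ, hδ1, hcomp⟩ := hG.comparable
  refine ⟨hg, ⟨c₂, h2, h2', hmaxpos, fun k => (div_le_iff₀ (hmaxpos k)).1 (hgeo k).2⟩,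
    ⟨1 / c₁, by positivity, fun k => ?_⟩, ⟨1 / δ, by positivity, fun k Q hQ => ⟨?_, ?_⟩⟩⟩
  · have := (le_div_iff₀ (hmaxpos k)).1 (hgeo k).1
    rw [one_div, ← div_eq_inv_mul, le_div_iff₀ h1]
    linarith
  · refine ((div_le_iff₀ (hminpos k)).1 (hcomp k).2).trans ?_
    gcongr
    exact hmin k Q hQ
  · refine (hmax k Q hQ).trans (le_mul_of_one_le_left (hmaxpos k).le ?_)
    rw [one_le_div hδ]
    exact hδ1.le

end GridBesov

namespace GridBesov

variable {I : Type*} [mI : MeasurableSpace I] {m : Measure I} [IsProbabilityMeasure m]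
  {P : ℕ → Finset (Set I)}

/-- The exponents of atoms and blocks may have either sign, so both comparisons are needed and the
constant involves |t|. -/
theorem rpow_le_of_comparable {A τ x : ℝ} (hA : 0 < A) (hτ : 0 < τ) (hx : 0 < x)
    (h1 : τ ≤ A * x) (h2 : x ≤ A * τ) (t : ℝ) : x ^ t ≤ A ^ |t| * τ ^ t := by
  rcases le_total 0 t with ht | ht
  · rw [abs_of_nonneg ht, ← Real.mul_rpow hA.le hτ.le]
    exact Real.rpow_le_rpow hx.le h2 ht
  · rw [abs_of_nonpos ht, Real.rpow_neg hA.le, ← div_eq_inv_mul, ← Real.div_rpow hτ.le hA.le]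
    exact Real.rpow_le_rpow_of_nonpos (by positivity) ((div_le_iff₀' hA).2 h1) ht

/-! ### Blocks with bounded overlap -/

/-- At each point at most N terms are nonzero, so the p-th power of the sum is at most N^(p-1) times
the sum of the p-th powers; then integrate. -/
theorem eLpNorm_le_of_overlap {W : ℕ → Finset (Set I)} {p : ℝ} (hp : 1 ≤ p) (c : ℕ → Set I → ℂ)
    (k : ℕ) {B : Set I → Set I} (hB : ∀ Q, MeasurableSet (B Q)) {N V M : ℝ} (hN0 : 0 ≤ N)
    (hV0 : 0 ≤ V) (hM0 : 0 ≤ M)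
    (hN : ∀ x, ∀ S ⊆ W k, (∀ Q ∈ S, x ∈ B Q) → (S.card : ℝ) ≤ N)
    (hV : ∀ Q ∈ W k, m.real (B Q) ≤ V) {u : I → ℂ}
    (hu : ∀ᵐ x ∂m, ‖u x‖ ≤ M * ∑ Q ∈ W k, (B Q).indicator (fun _ => ‖c k Q‖) x) :
    eLpNorm u (ENNReal.ofReal p) m ≤
      ENNReal.ofReal (M * (N ^ (p - 1) * V) ^ (1 / p)) * levelCoeff W p c k := by
  classical
  have hp0 : 0 < p := by linarith
  have hpt : ∀ x, ENNReal.ofReal (∑ Q ∈ W k, (B Q).indicator (fun _ => ‖c k Q‖) x) ^ p ≤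
      ENNReal.ofReal (N ^ (p - 1)) *
        ∑ Q ∈ W k, (B Q).indicator (fun _ => ‖c k Q‖ₑ ^ p) x := fun x => by
    set S := (W k).filter fun Q => x ∈ B Q with hS
    have e1 : ENNReal.ofReal (∑ Q ∈ W k, (B Q).indicator (fun _ => ‖c k Q‖) x) =
        ∑ Q ∈ S, ‖c k Q‖ₑ := by
      rw [ENNReal.ofReal_sum_of_nonneg fun Q _ =>
        Set.indicator_nonneg (fun _ _ => norm_nonneg _) x, hS, Finset.sum_filter]
      refine Finset.sum_congr rfl fun Q _ => ?_
      by_cases hx : x ∈ B Q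
      · simp [hx]
      · simp [hx]
    have e2 : ∑ Q ∈ W k, (B Q).indicator (fun _ => ‖c k Q‖ₑ ^ p) x = ∑ Q ∈ S, ‖c k Q‖ₑ ^ p := by
      rw [hS, Finset.sum_filter]
      exact Finset.sum_congr rfl fun Q _ => rfl
    rw [e1, e2]
    refine (ENNReal.rpow_sum_le_const_mul_sum_rpow _ _ hp).trans ?_
    gcongr
    rw [← ENNReal.ofReal_rpow_of_nonneg hN0 (by linarith)]
    refine ENNReal.rpow_le_rpow ?_ (by linarith)
    rw [← ENNReal.ofReal_natCast]
    exact ENNReal.ofReal_le_ofReal (hN x S (Finset.filter_subset _ _)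
      fun Q hQ => (Finset.mem_filter.1 hQ).2)
  rw [eLpNorm_ofReal_eq hp]
  have hint : ∫⁻ x, ‖u x‖ₑ ^ p ∂m ≤
      ENNReal.ofReal (M ^ p * (N ^ (p - 1) * V)) * ∑ Q ∈ W k, ‖c k Q‖ₑ ^ p := by
    calc ∫⁻ x, ‖u x‖ₑ ^ p ∂m ≤ ∫⁻ x, ENNReal.ofReal (M ^ p) * (ENNReal.ofReal (N ^ (p - 1)) *
          ∑ Q ∈ W k, (B Q).indicator (fun _ => ‖c k Q‖ₑ ^ p) x) ∂m := by
          refine lintegral_mono_ae ?_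
          filter_upwards [hu] with x hx
          calc ‖u x‖ₑ ^ p ≤
              ENNReal.ofReal (M * ∑ Q ∈ W k, (B Q).indicator (fun _ => ‖c k Q‖) x) ^ p := by
                refine ENNReal.rpow_le_rpow ?_ hp0.le
                rw [← ofReal_norm]
                exact ENNReal.ofReal_le_ofReal hx
            _ ≤ _ := by
                rw [ENNReal.ofReal_mul hM0, ENNReal.mul_rpow_of_nonneg _ _ hp0.le,
                  ENNReal.ofReal_rpow_of_nonneg hM0 hp0.le]
                gcongr
                exact hpt x
      _ = ENNReal.ofReal (M ^ p) * (ENNReal.ofReal (N ^ (p - 1)) *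
          ∑ Q ∈ W k, ‖c k Q‖ₑ ^ p * m (B Q)) := by
          rw [lintegral_const_mul, lintegral_const_mul, lintegral_finsetSum]
          · simp only [lintegral_indicator_const (hB _)]
          · exact fun Q _ => measurable_const.indicator (hB Q)
          · exact Finset.measurable_fun_sum _ fun Q _ => measurable_const.indicator (hB Q)
          · exact (Finset.measurable_fun_sum _ fun Q _ =>
              measurable_const.indicator (hB Q)).const_mul _
      _ ≤ ENNReal.ofReal (M ^ p) * (ENNReal.ofReal (N ^ (p - 1)) *
          ∑ Q ∈ W k, ‖c k Q‖ₑ ^ p * ENNReal.ofReal V) := by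
          gcongr with Q hQ
          rw [← ofReal_measureReal (measure_ne_top m (B Q))]
          exact ENNReal.ofReal_le_ofReal (hV Q hQ)
      _ = _ := by
          rw [← Finset.sum_mul, ENNReal.ofReal_mul (by positivity),
            ENNReal.ofReal_mul (by positivity)]
          ring
  calc _ ≤ (ENNReal.ofReal (M ^ p * (N ^ (p - 1) * V)) * ∑ Q ∈ W k, ‖c k Q‖ₑ ^ p) ^ (1 / p) :=
        ENNReal.rpow_le_rpow hint (by positivity)
    _ = _ := by
        rw [ENNReal.mul_rpow_of_nonneg _ _ (by positivity),
          ENNReal.ofReal_rpow_of_nonneg (by positivity) (by positivity),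
          Real.mul_rpow (by positivity) (by positivity), ← Real.rpow_mul hM0,
          mul_one_div_cancel hp0.ne', Real.rpow_one]
        rfl

/-- A packing argument: the sets Q in question are disjoint, of measure at least τ/A, and all lie in
the ball of radius (c + D) τ about x, whose measure is below its radius. -/
theorem IsRootedGrid.card_overlap_le (h : IsRootedGrid m P) {W : ℕ → Finset (Set I)}
    (hW : IsPartitionGrid m W) {k : ℕ} {A D c τ : ℝ} (hA : 0 < A) (hD : 0 < D) (hc : 0 < c)
    (hτ : 0 < τ) (hsize : ∀ Q ∈ W k, τ ≤ A * m.real Q) {z : Set I → I}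
    (hz : ∀ Q ∈ W k, z Q ∈ Q)
    (hdiam : ∀ Q ∈ W k, ∀ x ∈ Q, ∀ y ∈ Q, gridMetric m P x y ≤ D * τ) (x : I)
    (S : Finset (Set I)) (hS : S ⊆ W k) (hx : ∀ Q ∈ S, x ∈ qball (gridMetric m P) (z Q) (c * τ)) :
    (S.card : ℝ) ≤ A * (c + D) := by
  obtain ⟨a, ha, ha1, hb⟩ := h.exists_real_qball
  have hsub : ⋃ Q ∈ S, id Q ⊆ qball (gridMetric m P) x ((c + D) * τ) := by
    refine Set.iUnion₂_subset fun Q hQ y hy => ?_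
    have h1 : gridMetric m P (z Q) x < c * τ := hx Q hQ
    have h2 := hdiam Q (hS hQ) (z Q) (hz Q (hS hQ)) y hy
    refine (h.gridMetric_ultra x (z Q) y).trans_lt (max_lt ?_ ?_)
    · rw [IsRootedGrid.gridMetric_comm]
      nlinarith
    · nlinarith
  have h1 : ∑ Q ∈ S, m.real Q = m.real (⋃ Q ∈ S, id Q) :=
    (measureReal_biUnion_finset (fun Q hQ R hR hne => hW.disjoint k Q (hS hQ) R (hS hR) hne)
      (fun Q hQ => hW.measurable k Q (hS hQ))).symm
  have h2 := (measureReal_mono (μ := m) hsub).trans (hb x _ (by positivity)).2.le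
  have h3 : (S.card : ℝ) * τ ≤ A * ∑ Q ∈ S, m.real Q := by
    rw [Finset.mul_sum, ← nsmul_eq_mul]
    exact Finset.card_nsmul_le_sum _ _ _ fun Q hQ => hsize Q (hS hQ)
  refine le_of_mul_le_mul_right (h3.trans ?_) hτ
  rw [h1, mul_assoc]
  gcongr

/-! ### Han-Lu-Yang blocks -/

/-- Preimages of open sets are ρ-open, hence measurable. This is how blocks, given only by
inequalities, become measurable. -/
theorem IsRootedGrid.measurable_of_holder (h : IsRootedGrid m P) {a : I → ℂ} {L γ : ℝ}
    (hL : 0 ≤ L) (hγ : 0 < γ) (ha : ∀ x y, ‖a x - a y‖ ≤ L * gridMetric m P x y ^ γ) :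
    Measurable a := by
  refine measurable_of_isOpen fun U hU => h.measurableSet_of_open fun x hx => ?_
  obtain ⟨ε, hε, hεU⟩ := Metric.isOpen_iff.1 hU (a x) hx
  refine ⟨(ε / (L + 1)) ^ γ⁻¹, by positivity, fun y hy => hεU ?_⟩
  rw [qball, mem_ofPred_eq, Real.lt_rpow_inv_iff_of_pos
    (IsRootedGrid.gridMetric_nonneg _ _ _ _) (by positivity) hγ, lt_div_iff₀ (by positivity)] at hy
  rw [Metric.mem_ball, dist_comm, dist_eq_norm]
  have h0 := Real.rpow_nonneg (IsRootedGrid.gridMetric_nonneg m P x y) γ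
  calc ‖a x - a y‖ ≤ L * gridMetric m P x y ^ γ := ha x y
    _ ≤ gridMetric m P x y ^ γ * (L + 1) := by nlinarith
    _ < ε := hy

theorem IsHLYSetup.exists_adapted (h : IsRootedGrid m P) {s : ℝ} {W : ℕ → Finset (Set I)}
    {z : Set I → I} {K R lam γ : ℝ} (hW : IsHLYSetup (gridMetric m P) m s W z K R lam γ) :
    0 < R ∧ 0 < lam ∧ lam < 1 ∧ (∀ k, ∀ Q ∈ W k, z Q ∈ Q) ∧
      (∀ k, 1 ≤ k → ∀ Q ∈ W k, ∀ x ∈ Q, ∀ y ∈ Q, gridMetric m P x y ≤ R * lam ^ k) ∧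
      IsScaledGrid m W (fun k => lam ^ k) ∧
      DiamBound (gridMetric m P) W (fun k => lam ^ k) := by
  obtain ⟨η, C₁, C₃, C₄, hA⟩ := hW.adapted
  rw [h.measureMetric_eq] at hA
  have he : MetricEquiv (gridMetric m P) (gridMetric m P) := ⟨1, one_pos, fun x y => by simp⟩
  exact ⟨hA.C₂_pos, hA.lam_pos, hA.lam_lt_one, hA.center_mem, hA.diam_le,
    hA.isScaledGrid h he, hA.diamBound h he⟩

/-- On a cell of H j the k-th level sum oscillates by at most a multiple of σ_j^γ times the sum of
|c_Q| |Q|^(s-1/p-γ) over the blocks present there, and d_(j+1) is a difference of two averages over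
such a cell. Bounded overlap turns this into L^p decay (σ_j/lam^k)^γ, with γ > s. -/
theorem hlyBesov_embeds_scaledGT (h : IsRootedGrid m P) {H W : ℕ → Finset (Set I)} {σ : ℕ → ℝ}
    (hH : IsScaledGrid m H σ) (hHm : ∀ k, ∀ Q ∈ H k, ∃ j, Q ∈ P j) {s p : ℝ} {q : ℝ≥0∞}
    (hs : 0 < s) (hp : 1 ≤ p) (hq : 1 ≤ q) {z : Set I → I} {K R lam γ : ℝ}
    (hW : IsHLYSetup (gridMetric m P) m s W z K R lam γ) :
    Embeds (hlyBesov (gridMetric m P) m W z K R lam γ s p q) (scaledGT m H σ s p q) := by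
  obtain ⟨hR, hlam, hlam1, hz, _, hWs, D, hD, hdiam⟩ := hW.exists_adapted h
  obtain ⟨A, hA, hsize⟩ := hWs.size
  obtain ⟨A', hA', hsize'⟩ := hH.size
  obtain ⟨a₀, ha₀, ha₁, hball⟩ := h.exists_real_qball
  have hp0 : 0 < p := by linarith
  have hp1 : (1 : ℝ≥0∞) ≤ ENNReal.ofReal p := by simpa using hp
  have hK : 0 < K := by linarith [hW.one_le_K]
  have hγ := hW.γ_pos
  set r := 3 * K * R with hr
  have hr0 : 0 < r := by positivity
  set N := A * (r + D) with hN
  have hN0 : 0 < N := by positivity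
  set L := (N ^ (p - 1) * r) ^ (1 / p) with hL
  have hL0 : 0 < L := by positivity
  set E₁ := A ^ |s - 1 / p| with hE₁
  set E₂ := 2 * (A ^ |s - 1 / p - γ| * A' ^ γ) with hE₂
  have hE₁0 : 0 < E₁ := by positivity
  have hE₂0 : 0 < E₂ := by positivity
  set C := (2 * E₁ + E₂ + 2 * E₁ * (A' / r) ^ γ) * L with hC
  obtain ⟨C', hC'⟩ := scaledGT_size_le_of_atoms hH hWs.decay (q := q) hs hp hq hW.s_lt_γ C
    (by positivity)
  refine embeds_of_representation C' fun f hf c a hrep hcoef => ?_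
  have hblock := hrep.atom
  simp only [hlyBlocks, h.measureMetric_eq, mem_ofPred_eq] at hblock
  set g := levelSum W c a with hg
  set B : ℕ → Set I → Set I := fun k Q => qball (gridMetric m P) (z Q) (r * lam ^ k) with hBdef
  have hlk : ∀ k : ℕ, 0 < lam ^ k := fun k => by positivity
  have hzero : ∀ k, ∀ Q ∈ W k, ∀ x, x ∉ B k Q → a k Q x = 0 := fun k Q hQ x hx => by
    by_contra hne
    exact hx ((hblock k Q hQ).1 hne)
  have hameas : ∀ k, ∀ Q ∈ W k, Measurable (a k Q) := fun k Q hQ =>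
    h.measurable_of_holder (Real.rpow_nonneg measureReal_nonneg _) hγ (hblock k Q hQ).2.2
  have hgm : ∀ k, Measurable (g k) := fun k =>
    Finset.measurable_fun_sum _ fun Q hQ => (hameas k Q hQ).const_mul _
  have hgp : ∀ k, MemLp (g k) (ENNReal.ofReal p) m := fun k =>
    ⟨(hgm k).aestronglyMeasurable, (ENNReal.le_tsum k).trans_lt hrep.absolute⟩
  have hover : ∀ k (M : ℝ) (u : I → ℂ), 0 ≤ M →
      (∀ᵐ x ∂m, ‖u x‖ ≤ M * ∑ Q ∈ W k, (B k Q).indicator (fun _ => ‖c k Q‖) x) →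
      eLpNorm u (ENNReal.ofReal p) m ≤
        ENNReal.ofReal (M * (L * (lam ^ k) ^ (1 / p))) * levelCoeff W p c k := by
    intro k M u hM hu
    have := eLpNorm_le_of_overlap (N := N) (V := r * lam ^ k) hp c k (B := B k)
      (fun Q => h.measurableSet_qball _ _) hN0.le (by positivity) hM
      (fun x S hS hx => h.card_overlap_le hWs.toIsPartitionGrid hA hD hr0 (hlk k)
        (fun Q hQ => (hsize k Q hQ).1) (hz k) (hdiam k) x S hS hx)
      (fun Q _ => (hball _ _ (by positivity)).2.le) hu
    rwa [← mul_assoc, Real.mul_rpow (by positivity) (by positivity)] at this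
  have hpow : ∀ (k : ℕ) (t : ℝ), (lam ^ k) ^ (t - 1 / p) * (lam ^ k) ^ (1 / p) = (lam ^ k) ^ t :=
    fun k t => by rw [← Real.rpow_add (hlk k), sub_add_cancel]
  have hgnorm : ∀ k, eLpNorm (g k) (ENNReal.ofReal p) m ≤
      ENNReal.ofReal (E₁ * L * (lam ^ k) ^ s) * levelCoeff W p c k := fun k => by
    have hlkk := hlk k
    refine (hover k (E₁ * (lam ^ k) ^ (s - 1 / p)) (g k) (by positivity)
      (Eventually.of_forall fun x => ?_)).trans (le_of_eq ?_)
    · refine (norm_sum_le _ _).trans ?_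
      rw [Finset.mul_sum]
      refine Finset.sum_le_sum fun Q hQ => ?_
      by_cases hx : x ∈ B k Q
      · rw [Set.indicator_of_mem hx, norm_mul, mul_comm]
        gcongr
        exact ((hblock k Q hQ).2.1 x).trans (rpow_le_of_comparable hA (hlk k)
          (hWs.real_pos hQ) (hsize k Q hQ).1 (hsize k Q hQ).2 _)
      · rw [Set.indicator_of_notMem hx, hzero k Q hQ x hx]
        simp
    · rw [← hpow k s]
      congr 2
      ring
  have hsz : (scaledGT m H σ s p q).size f ≤ C' * coeffNorm W p q c := by
    refine hC' f g (levelCoeff W p c) hf hgp hrep.tendsto (fun j k => ?_) fun j k => ?_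
    · have hlkk := hlk k
      refine (hH.eLpNorm_martingaleDiff_le (hgp k).1 hp j).trans ?_
      calc _ ≤ ENNReal.ofReal 2 * (ENNReal.ofReal (E₁ * L * (lam ^ k) ^ s) *
            levelCoeff W p c k) := by
            rw [ENNReal.ofReal_ofNat]; gcongr; exact hgnorm k
        _ ≤ _ := by
            rw [← mul_assoc, ← ENNReal.ofReal_mul (by positivity)]
            gcongr ENNReal.ofReal ?_ * _
            have h1 : 0 ≤ E₂ * L * (lam ^ k) ^ s := by positivity
            have h2 : 0 ≤ 2 * E₁ * (A' / r) ^ γ * L * (lam ^ k) ^ s := by positivity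
            rw [hC]
            linarith
    · have hlkk := hlk k
      have hσj := hH.scale_pos j
      -- If the cells can be as wide as the block balls, σ_j/lam^k is bounded below and the crude
      -- bound suffices. Otherwise a cell lies inside a block ball or misses it, so the block balls
      -- containing x control the whole cell.
      rcases le_or_gt (r * lam ^ k) (A' * σ j) with hle | hlt
      · refine (hH.eLpNorm_martingaleDiff_le (hgp k).1 hp (j + 1)).trans ?_
        have hge : 1 ≤ (A' / r) ^ γ * (σ j / lam ^ k) ^ γ := by
          rw [← Real.mul_rpow (by positivity) (by positivity)]
          refine Real.one_le_rpow ?_ hγ.le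
          rw [div_mul_div_comm, one_le_div (by positivity)]
          exact hle
        calc _ ≤ ENNReal.ofReal 2 * (ENNReal.ofReal (E₁ * L * (lam ^ k) ^ s) *
              levelCoeff W p c k) := by
              rw [ENNReal.ofReal_ofNat]; gcongr; exact hgnorm k
          _ ≤ _ := by
              rw [← mul_assoc, ← ENNReal.ofReal_mul (by positivity)]
              gcongr ENNReal.ofReal ?_ * _
              have h1 : 0 ≤ 2 * E₁ * L * ((lam ^ k) ^ s * (σ j / lam ^ k) ^ γ) := by positivity
              have h2 : 0 ≤ E₂ * L * ((lam ^ k) ^ s * (σ j / lam ^ k) ^ γ) := by positivity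
              calc 2 * (E₁ * L * (lam ^ k) ^ s) = 2 * E₁ * L * (lam ^ k) ^ s * 1 := by ring
                _ ≤ 2 * E₁ * L * (lam ^ k) ^ s * ((A' / r) ^ γ * (σ j / lam ^ k) ^ γ) := by
                    gcongr
                _ ≤ _ := by
                    rw [hC]
                    linarith
      · refine (hover k (E₂ * ((lam ^ k) ^ (s - 1 / p) * (σ j / lam ^ k) ^ γ)) _ (by positivity)
          ?_).trans ?_
        · filter_upwards [hH.ae_mem (j + 1)] with x ⟨Q', hQ', hx⟩
          obtain ⟨R', hR', hQR⟩ := hH.nested j Q' hQ'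
          rw [hH.martingaleDiff_succ_eq _ hQ' hR' hQR hx]
          set T := A ^ |s - 1 / p - γ| * (lam ^ k) ^ (s - 1 / p - γ) * (A' * σ j) ^ γ *
            ∑ Q ∈ W k, (B k Q).indicator (fun _ => ‖c k Q‖) x with hT
          have hosc : ∀ y ∈ R', ‖g k y - g k x‖ ≤ T := fun y hy => by
            obtain ⟨i, hi⟩ := hHm j R' hR'
            have hxy : gridMetric m P y x ≤ A' * σ j :=
              (IsRootedGrid.gridMetric_le hi hy (hQR hx)).trans (hsize' j R' hR').2
            have hnn := IsRootedGrid.gridMetric_nonneg m P y x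
            rw [hg, levelSum, levelSum, ← Finset.sum_sub_distrib, hT, Finset.mul_sum]
            refine (norm_sum_le _ _).trans (Finset.sum_le_sum fun Q hQ => ?_)
            rw [← mul_sub, norm_mul]
            by_cases hxB : x ∈ B k Q
            · rw [Set.indicator_of_mem hxB, mul_comm]
              gcongr
              refine ((hblock k Q hQ).2.2 y x).trans ?_
              gcongr
              exact rpow_le_of_comparable hA (hlk k) (hWs.real_pos hQ) (hsize k Q hQ).1
                (hsize k Q hQ).2 _
            · have hyB : y ∉ B k Q := fun hyB => hxB (by
                have hxy' : x ∈ qball (gridMetric m P) y (r * lam ^ k) := hxy.trans_lt hlt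
                rwa [h.qball_eq_of_mem hyB] at hxy')
              rw [hzero k Q hQ x hxB, hzero k Q hQ y hyB, Set.indicator_of_notMem hxB]
              simp
          have hgi := (hgp k).integrable hp1
          have h1 := norm_setAverage_sub_le hgi (hH.pos _ Q' hQ') fun y hy => hosc y (hQR hy)
          have h2 := norm_setAverage_sub_le hgi (hH.pos _ R' hR') hosc
          have h3 : ‖(⨍ y in Q', g k y ∂m) - ⨍ y in R', g k y ∂m‖ ≤ 2 * T := by
            have := norm_sub_le ((⨍ y in Q', g k y ∂m) - g k x) ((⨍ y in R', g k y ∂m) - g k x)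
            rw [sub_sub_sub_cancel_right] at this
            linarith
          refine h3.trans (le_of_eq ?_)
          rw [hT, hE₂, Real.rpow_sub hlkk, Real.mul_rpow hA'.le hσj.le,
            Real.div_rpow hσj.le hlkk.le]
          ring
        · gcongr ENNReal.ofReal ?_ * _
          rw [hC]
          have h1 : 0 ≤ 2 * E₁ * L * ((lam ^ k) ^ s * (σ j / lam ^ k) ^ γ) := by positivity
          have h2 : 0 ≤ 2 * E₁ * (A' / r) ^ γ * L * ((lam ^ k) ^ s * (σ j / lam ^ k) ^ γ) := by
            positivity
          calc E₂ * ((lam ^ k) ^ (s - 1 / p) * (σ j / lam ^ k) ^ γ) *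
                (L * (lam ^ k) ^ (1 / p))
              = E₂ * L * (((lam ^ k) ^ (s - 1 / p) * (lam ^ k) ^ (1 / p)) *
                (σ j / lam ^ k) ^ γ) := by ring
            _ = E₂ * L * ((lam ^ k) ^ s * (σ j / lam ^ k) ^ γ) := by rw [hpow]
            _ ≤ _ := by linarith
  exact ⟨⟨hf.integrable hp1, hsz.trans_lt (ENNReal.mul_lt_top ENNReal.coe_lt_top hcoef)⟩, hsz⟩

end GridBesov

/-! ### From martingale differences to blocks. -/

namespace GridBesov

variable {I : Type*} [mI : MeasurableSpace I] {m : Measure I} [IsProbabilityMeasure m]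
  {P : ℕ → Finset (Set I)}

/-- Normalized indicators of the balls `B(z_Q, 2 R lam ^ k)` are blocks. -/
theorem IsRootedGrid.indicator_qball_mem_hlyBlocks (h : IsRootedGrid m P)
    {s p K R lam γ A E : ℝ} {z : Set I → I} {k : ℕ} {Q : Set I} (hK : 1 ≤ K) (hR : 0 < R)
    (hlam : 0 < lam) (hγ : 0 < γ) (hA : 0 < A) (hQ : 0 < m.real Q)
    (hQA : m.real Q ≤ A * lam ^ k) (hE1 : 1 ≤ E) (hE : (A / (2 * R)) ^ γ ≤ E) :
    (qball (gridMetric m P) (z Q) (2 * R * lam ^ k)).indicator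
        (fun _ => ((E⁻¹ * m.real Q ^ (s - 1 / p) : ℝ) : ℂ)) ∈
      hlyBlocks (gridMetric m P) m s p z K R lam γ k Q := by
  set B := qball (gridMetric m P) (z Q) (2 * R * lam ^ k) with hB
  have hE0 : 0 < E := by linarith
  have hlk : 0 < lam ^ k := by positivity
  have hv : ‖((E⁻¹ * m.real Q ^ (s - 1 / p) : ℝ) : ℂ)‖ = E⁻¹ * m.real Q ^ (s - 1 / p) := by
    rw [Complex.norm_real, Real.norm_of_nonneg (by positivity)]
  simp only [hlyBlocks, h.measureMetric_eq, mem_ofPred_eq]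
  -- Points inside and outside an ultrametric ball are at distance at least its radius. So the jump
  -- of the indicator respects the Hölder bound once it is divided by E, which absorbs the ratio of
  -- |Q| to the radius.
  have hfar : ∀ x y, x ∈ B → y ∉ B → E⁻¹ * m.real Q ^ (s - 1 / p) ≤
      m.real Q ^ (s - 1 / p - γ) * gridMetric m P x y ^ γ := fun x y hx hy => by
    have hxy : 2 * R * lam ^ k ≤ gridMetric m P x y := by
      by_contra! hlt
      have hy' : y ∈ qball (gridMetric m P) x (2 * R * lam ^ k) := hlt
      rw [h.qball_eq_of_mem hx] at hy'
      exact hy hy'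
    have h1 : m.real Q ^ γ ≤ E * gridMetric m P x y ^ γ := by
      calc m.real Q ^ γ ≤ (A / (2 * R) * (2 * R * lam ^ k)) ^ γ := by
            gcongr
            refine hQA.trans (le_of_eq ?_)
            field_simp
        _ = (A / (2 * R)) ^ γ * (2 * R * lam ^ k) ^ γ :=
            Real.mul_rpow (by positivity) (by positivity)
        _ ≤ _ := by gcongr
    rw [Real.rpow_sub hQ _ γ, div_mul_eq_mul_div, le_div_iff₀ (by positivity)]
    have h2 := mul_le_mul_of_nonneg_left h1
      (show 0 ≤ E⁻¹ * m.real Q ^ (s - 1 / p) by positivity)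
    refine h2.trans (le_of_eq ?_)
    field_simp
  refine ⟨fun x hx => ?_, fun x => ?_, fun x y => ?_⟩
  · have hxB : x ∈ B := by
      by_contra hne
      exact hx (Set.indicator_of_notMem hne _)
    refine IsRootedGrid.qball_subset_qball _ ?_ hxB
    gcongr
    nlinarith
  · refine (norm_indicator_le_norm_self _ x).trans ?_
    rw [hv]
    exact mul_le_of_le_one_left (by positivity) (inv_le_one_of_one_le₀ hE1)
  · by_cases hx : x ∈ B <;> by_cases hy : y ∈ B
    · rw [Set.indicator_of_mem hx, Set.indicator_of_mem hy, sub_self, norm_zero]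
      exact mul_nonneg (by positivity) (Real.rpow_nonneg
        (IsRootedGrid.gridMetric_nonneg _ _ _ _) _)
    · rw [Set.indicator_of_mem hx, Set.indicator_of_notMem hy, sub_zero, hv]
      exact hfar x y hx hy
    · rw [Set.indicator_of_notMem hx, Set.indicator_of_mem hy, zero_sub, norm_neg, hv,
        IsRootedGrid.gridMetric_comm]
      exact hfar y x hy hx
    · rw [Set.indicator_of_notMem hx, Set.indicator_of_notMem hy, sub_self, norm_zero]
      exact mul_nonneg (by positivity) (Real.rpow_nonneg
        (IsRootedGrid.gridMetric_nonneg _ _ _ _) _)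

/-- The k-th difference is constant on balls of radius 2R lam^(k+1), and each such ball is centred
at z_Q for some Q in W (k + 1), where its normalized indicator is a block. The shift by one level is
needed because the diameter bound starts at level 1; level 0 receives zero coefficients. -/
theorem scaledGT_embeds_hlyBesov (h : IsRootedGrid m P) {W : ℕ → Finset (Set I)} {s p : ℝ}
    {q : ℝ≥0∞} (hs : 0 < s) (hp : 1 ≤ p) (hq : 1 ≤ q) {z : Set I → I} {K R lam γ : ℝ}
    (hW : IsHLYSetup (gridMetric m P) m s W z K R lam γ) :
    Embeds (scaledGT m (fun k => ballPartition m P (2 * R * lam * lam ^ k))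
        (fun k => 2 * R * lam * lam ^ k) s p q)
      (hlyBesov (gridMetric m P) m W z K R lam γ s p q) := by
  classical
  obtain ⟨hR, hlam, hlam1, hz, hdiam, hWs, _⟩ := hW.exists_adapted h
  obtain ⟨A, hA, hsize⟩ := hWs.size
  have hγ := hW.γ_pos
  have hp0 : 0 < p := by linarith
  set H : ℕ → Finset (Set I) := fun k => ballPartition m P (2 * R * lam * lam ^ k) with hHdef
  set σ : ℕ → ℝ := fun k => 2 * R * lam * lam ^ k with hσdef
  have hH : IsScaledGrid m H σ := h.isScaledGrid_ballPartition (by positivity) hlam hlam1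
  obtain ⟨A', hA', hsize'⟩ := hH.size
  have hσ : ∀ k, 0 < σ k := hH.scale_pos
  have hσ' : ∀ k, σ k = 2 * R * lam ^ (k + 1) := fun k => by simp only [hσdef]; ring
  have hHmem : ∀ k B, B ∈ H k ↔ ∃ x, qball (gridMetric m P) x (σ k) = B := fun k B =>
    h.mem_ballPartition (hσ k)
  set ball : ℕ → Set I → Set I := fun k Q => qball (gridMetric m P) (z Q) (σ k) with hball
  have hballmem : ∀ k Q, ball k Q ∈ H k := fun k Q => (hHmem k _).2 ⟨z Q, rfl⟩
  -- Any Q meeting B works: z_Q is within R lam^(k+1), half the radius, of a point of B, hence lies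
  -- in B and is a centre of it.
  have hsel : ∀ k, ∀ B ∈ H k, ∃ Q ∈ W (k + 1), ball k Q = B := fun k B hB => by
    obtain ⟨Q, hQ, x, hxQ, hxB⟩ := hWs.exists_mem_inter (k + 1) (hH.pos k B hB)
    obtain ⟨y, rfl⟩ := (hHmem k B).1 hB
    refine ⟨Q, hQ, h.qball_eq_of_mem ?_⟩
    rw [← h.qball_eq_of_mem hxB]
    refine (hdiam (k + 1) (by omega) Q hQ x hxQ (z Q) (hz _ Q hQ)).trans_lt ?_
    rw [hσ']
    have : 0 < R * lam ^ (k + 1) := by positivity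
    linarith
  choose! sel hselW hselB using hsel
  set E := (A / (2 * R)) ^ γ + 1 with hE
  have hE1 : 1 ≤ E := by
    have : 0 ≤ (A / (2 * R)) ^ γ := by positivity
    linarith
  have hE0 : 0 < E := by linarith
  -- E undoes the normalization of the blocks, 2RA compares |Q|^(-s) with σ_k^(-s), and AA'/(2R)
  -- compares |Q| with |B|.
  set D := E * ((2 * R * A) ^ s * (A * A' / (2 * R)) ^ (1 / p)) with hD
  refine embeds_atomicSpace D.toNNReal fun f hf => ⟨hf.2, memLp_of_scaledGT hH hs hp hq hf, ?_⟩
  have hsum := tsum_eLpNorm_martingaleDiff_lt_top hH hs hq hf.2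
  set v := diffValue m H f with hv
  -- Several Q may generate the same ball; only the selected one carries a coefficient, so each ball
  -- is counted once.
  set c : ℕ → Set I → ℂ := fun k Q => match k with
    | 0 => 0
    | k + 1 => if sel k (ball k Q) = Q then
        ((E * m.real Q ^ (1 / p - s) : ℝ) : ℂ) * v k (ball k Q) else 0 with hc
  set a : ℕ → Set I → I → ℂ := fun k Q => match k with
    | 0 => 0
    | k + 1 => (ball k Q).indicator fun _ => ((E⁻¹ * m.real Q ^ (s - 1 / p) : ℝ) : ℂ) with ha
  have hlev0 : levelSum W c a 0 = 0 := by
    ext x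
    simp [levelSum, hc]
  have hlev : ∀ k, levelSum W c a (k + 1) =ᵐ[m] martingaleDiff m H f k := fun k => by
    filter_upwards [hH.ae_mem k] with x ⟨B, hB, hx⟩
    have hQW := hselW k B hB
    have hQB := hselB k B hB
    have hQpos := hWs.real_pos hQW
    rw [hH.martingaleDiff_eq_diffValue f hB hx, levelSum,
      Finset.sum_eq_single_of_mem (sel k B) hQW]
    · simp only [hc, ha]
      rw [hQB, if_pos rfl, Set.indicator_of_mem hx]
      have : ((E * m.real (sel k B) ^ (1 / p - s) : ℝ) : ℂ) *
          ((E⁻¹ * m.real (sel k B) ^ (s - 1 / p) : ℝ) : ℂ) = 1 := by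
        rw [← Complex.ofReal_mul, mul_mul_mul_comm, mul_inv_cancel₀ hE0.ne',
          ← Real.rpow_add hQpos]
        simp
      linear_combination (v k B) * this
    · intro Q _ hne
      simp only [hc, ha]
      by_cases hxB : x ∈ ball k Q
      · have e : ball k Q = B := hH.eq_of_mem (hballmem k Q) hB hxB hx
        rw [e, if_neg (Ne.symm hne), zero_mul]
      · rw [Set.indicator_of_notMem hxB, mul_zero]
  refine ⟨c, a, ⟨fun k Q hQ => ?_, ?_, ?_⟩, ?_⟩
  · cases k with
    | zero =>
      refine ⟨by simp [ha], fun x => ?_, fun x y => ?_⟩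
      · simp only [ha, Pi.zero_apply, norm_zero]
        exact Real.rpow_nonneg measureReal_nonneg _
      · simp only [ha, Pi.zero_apply, sub_self, norm_zero, h.measureMetric_eq]
        exact mul_nonneg (Real.rpow_nonneg measureReal_nonneg _) (Real.rpow_nonneg
          (IsRootedGrid.gridMetric_nonneg _ _ _ _) _)
    | succ k =>
      have := h.indicator_qball_mem_hlyBlocks (s := s) (p := p) (z := z) (E := E) (k := k + 1)
        hW.one_le_K hR hlam hγ hA (hWs.real_pos hQ) (hsize _ Q hQ).2 hE1
        (by rw [hE]; linarith)
      rw [← hσ'] at this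
      exact this
  · rw [tsum_eq_zero_add' ENNReal.summable, hlev0, eLpNorm_zero, zero_add]
    simpa only [eLpNorm_congr_ae (hlev _)] using hsum
  · rw [← tendsto_add_atTop_iff_nat 1]
    refine (hH.tendsto_sum_martingaleDiff hf.1 hp hsum).congr fun n => eLpNorm_congr_ae ?_
    filter_upwards [ae_all_iff.2 hlev] with x hx
    rw [Finset.sum_range_succ', hlev0]
    simp [hx]
  · change lqNorm q (levelCoeff W p c) ≤ _ * lqNorm q _
    have h0 : levelCoeff W p c 0 = 0 := by simp [levelCoeff, hc, hp0]
    rw [lqNorm_shift hq h0 (fun k => rfl), ← lqNorm_const_mul hq]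
    refine lqNorm_mono q fun k => ?_
    have hσk := hσ k
    have hlk : 0 < lam ^ (k + 1) := by positivity
    have hσl : lam ^ (k + 1) = σ k / (2 * R) := by rw [hσ']; field_simp
    have hint : ∑ Q ∈ W (k + 1), ‖c (k + 1) Q‖ₑ ^ p ≤
        ENNReal.ofReal (E ^ p * ((2 * R * A) ^ (s * p) * (A * A' / (2 * R))) * σ k ^ (-(s * p))) *
          ∫⁻ x, ‖martingaleDiff m H f k x‖ₑ ^ p ∂m := by
      set G : Set I → ℝ≥0∞ := fun B =>
        ‖((E * m.real (sel k B) ^ (1 / p - s) : ℝ) : ℂ) * v k B‖ₑ ^ p with hG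
      set S := (W (k + 1)).filter fun Q => sel k (ball k Q) = Q with hS
      have e1 : ∑ Q ∈ W (k + 1), ‖c (k + 1) Q‖ₑ ^ p = ∑ Q ∈ S, G (ball k Q) := by
        rw [hS, Finset.sum_filter]
        refine Finset.sum_congr rfl fun Q _ => ?_
        simp only [hc, hG]
        split_ifs with hQ
        · rw [hQ]
        · simp [hp0]
      -- On the selected sets Q ↦ `ball k Q` is injective, as `sel k` inverts it there.
      have e2 : ∑ Q ∈ S, G (ball k Q) = ∑ B ∈ S.image (ball k), G B := by
        refine (Finset.sum_image fun Q hQ Q' hQ' e => ?_).symm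
        rw [← (Finset.mem_filter.1 hQ).2, ← (Finset.mem_filter.1 hQ').2, e]
      have e3 : ∑ B ∈ S.image (ball k), G B ≤ ∑ B ∈ H k, G B :=
        Finset.sum_le_sum_of_subset (Finset.image_subset_iff.2 fun Q _ => hballmem k Q)
      rw [hH.lintegral_rpow_of_const
        (fun B hB x hx => hH.martingaleDiff_eq_diffValue f hB hx) p, Finset.mul_sum, e1, e2]
      refine e3.trans (Finset.sum_le_sum fun B hB => ?_)
      have hQW := hselW k B hB
      set Q := sel k B with hQdef
      have hQpos := hWs.real_pos hQW
      have hQs := hsize _ Q hQW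
      have hBs := hsize' k B hB
      simp only [hG]
      rw [enorm_mul, ENNReal.mul_rpow_of_nonneg _ _ hp0.le, ← mul_assoc]
      gcongr ?_ * _
      rw [← ofReal_norm, Complex.norm_real, Real.norm_of_nonneg (by positivity),
        ENNReal.ofReal_rpow_of_nonneg (by positivity) hp0.le,
        ← ofReal_measureReal (measure_ne_top m B), ← ENNReal.ofReal_mul (by positivity)]
      refine ENNReal.ofReal_le_ofReal ?_
      have hQ1 : m.real Q ^ (-(s * p)) ≤ (2 * R * A) ^ (s * p) * σ k ^ (-(s * p)) := by
        calc m.real Q ^ (-(s * p)) ≤ (lam ^ (k + 1) / A) ^ (-(s * p)) :=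
              Real.rpow_le_rpow_of_nonpos (by positivity) ((div_le_iff₀' hA).2 hQs.1)
                (by have := mul_pos hs hp0; linarith)
          _ = (σ k / (2 * R * A)) ^ (-(s * p)) := by rw [hσl, div_div]
          _ = _ := by
              rw [Real.div_rpow hσk.le (by positivity), Real.rpow_neg (by positivity) (s * p),
                Real.rpow_neg (x := 2 * R * A) (by positivity), div_inv_eq_mul, mul_comm]
      have hQ2 : m.real Q ≤ A * A' / (2 * R) * m.real B := by
        calc m.real Q ≤ A * lam ^ (k + 1) := hQs.2
          _ = A * (σ k / (2 * R)) := by rw [hσl]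
          _ ≤ A * (A' * m.real B / (2 * R)) := by gcongr; exact hBs.1
          _ = _ := by ring
      calc (E * m.real Q ^ (1 / p - s)) ^ p
          = E ^ p * (m.real Q ^ (-(s * p)) * m.real Q) := by
            rw [Real.mul_rpow hE0.le (by positivity), ← Real.rpow_mul hQpos.le]
            congr 1
            nth_rw 3 [← Real.rpow_one (m.real Q)]
            rw [← Real.rpow_add hQpos]
            congr 1
            field_simp
            ring
        _ ≤ E ^ p * (((2 * R * A) ^ (s * p) * σ k ^ (-(s * p))) *
            (A * A' / (2 * R) * m.real B)) := by gcongr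
        _ = _ := by ring
    rw [eLpNorm_ofReal_eq hp]
    calc levelCoeff W p c (k + 1) ≤ (ENNReal.ofReal (E ^ p * ((2 * R * A) ^ (s * p) *
          (A * A' / (2 * R))) * σ k ^ (-(s * p))) *
          ∫⁻ x, ‖martingaleDiff m H f k x‖ₑ ^ p ∂m) ^ (1 / p) :=
          ENNReal.rpow_le_rpow hint (by positivity)
      _ = _ := by
          rw [ENNReal.mul_rpow_of_nonneg _ _ (by positivity),
            ENNReal.ofReal_rpow_of_nonneg (by positivity) (by positivity),
            Real.mul_rpow (by positivity) (by positivity),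
            Real.mul_rpow (by positivity) (by positivity),
            Real.mul_rpow (by positivity) (by positivity),
            ← Real.rpow_mul hE0.le, ← Real.rpow_mul (by positivity), ← Real.rpow_mul hσk.le,
            mul_one_div_cancel hp0.ne', Real.rpow_one,
            ENNReal.ofReal_mul (by positivity), ← mul_assoc]
          have e4 : s * p * (1 / p) = s := by field_simp
          have e5 : -(s * p) * (1 / p) = -s := by field_simp
          rw [e4, e5, hD, mul_assoc E, mul_assoc (ENNReal.ofReal _)]
          rfl

end GridBesov

/-! ### The theorem. -/

open GridBesov
theorem mainTheorem1 {I : Type*} [TopologicalSpace I] [CompactSpace I] [T2Space I]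
    [MeasurableSpace I] [BorelSpace I] (m : Measure I) [IsProbabilityMeasure m]
    (P : ℕ → Finset (Set I)) (hP : IsGoodGrid m P) (hP_top : P 0 = {Set.univ})
    (hP_cover : ∀ k, ∀ x : I, ∃ Q ∈ P k, x ∈ Q)
    (s p : ℝ) (q : ℝ≥0∞) (hs : 0 < s) (hp : 1 ≤ p) (hsp : s < 1 / p) (hq : 1 ≤ q) :
    IsHomogeneousSpace (gridMetric m P) m ∧
    IsAhlforsRegular (gridMetric m P) m 1 ∧
    ∀ G : ℕ → Finset (Set I), IsRecalibration m P G →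
      (∀ G' : ℕ → Finset (Set I), IsRecalibration m P G' →
        SameSpace (guTaibleson m G s p q) (guTaibleson m G' s p q)) ∧
      SameSpace (guTaibleson m G s p q) (gridBesov m G s p q) ∧
      ((∃ W : ℕ → Finset (Set I), IsBesovGrid (gridMetric m P) m s p W) ∧
        ∀ W : ℕ → Finset (Set I), IsBesovGrid (gridMetric m P) m s p W →
          SameSpace (guTaibleson m G s p q) (gridBesov m W s p q)) ∧
      ((∃ (W : ℕ → Finset (Set I)) (z : Set I → I) (K R lam γ : ℝ),
          IsHLYSetup (gridMetric m P) m s W z K R lam γ) ∧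
        ∀ (W : ℕ → Finset (Set I)) (z : Set I → I) (K R lam γ : ℝ),
          IsHLYSetup (gridMetric m P) m s W z K R lam γ →
            SameSpace (guTaibleson m G s p q)
              (hlyBesov (gridMetric m P) m W z K R lam γ s p q)) := by
  have h := hP.isRootedGrid hP_top hP_cover
  refine ⟨h.isHomogeneousSpace, h.isAhlforsRegular, fun G hG => ?_⟩
  have hGs := hG.isScaledGrid
  have hGB : Embeds (guTaibleson m G s p q) (gridBesov m G s p q) :=
    scaledGT_embeds_gridBesov hGs hs hp hq
  have hGD : DiamBound (gridMetric m P) G (maxSize m G) := diamBound_of_mem_grid hGs hG.mem_grid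
  -- Any exponent above s p would do: sets of P satisfy the collar bound for every positive
  -- exponent.
  have hη : s * p < s * p + 1 := by linarith
  have hη0 : 0 < s * p + 1 := by positivity
  -- A change of grid passes through Souza atoms: differences along a recalibration are sums of
  -- atoms on sets of P, whose collars cause no loss along any H of small diameter.
  have hto : ∀ (G₁ H : ℕ → Finset (Set I)) (σ : ℕ → ℝ), IsRecalibration m P G₁ →
      IsScaledGrid m H σ → DiamBound (gridMetric m P) H σ →
      Embeds (guTaibleson m G₁ s p q) (scaledGT m H σ s p q) := fun G₁ H σ hG₁ hH hHD =>
    (scaledGT_embeds_gridBesov hG₁.isScaledGrid hs hp hq).trans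
      (gridBesov_embeds_scaledGT hH hG₁.isScaledGrid hs hp hq hη
        (h.collarBound hH.scale_pos hHD hG₁.isScaledGrid hG₁.mem_grid hη0))
  have hrec : ∀ G₁ G₂ : ℕ → Finset (Set I), IsRecalibration m P G₁ → IsRecalibration m P G₂ →
      Embeds (guTaibleson m G₁ s p q) (guTaibleson m G₂ s p q) := fun G₁ G₂ h₁ h₂ =>
    hto G₁ G₂ _ h₁ h₂.isScaledGrid (diamBound_of_mem_grid h₂.isScaledGrid h₂.mem_grid)
  refine ⟨fun G' hG' => sameSpace_of_embeds (hrec G G' hG hG') (hrec G' G hG' hG),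
    sameSpace_of_embeds hGB (gridBesov_embeds_scaledGT hGs hGs hs hp hq hη
      (h.collarBound hGs.scale_pos hGD hGs hG.mem_grid hη0)),
    ⟨h.exists_isBesovGrid hs hp, fun W hW => ?_⟩,
    h.exists_isHLYSetup s hs, fun W z K R lam γ hW => ?_⟩
  · obtain ⟨d, hd, hpow, hreg, z, η, C₁, C₂, C₃, C₄, lam, hA, hsη⟩ := hW
    have he := h.metricEquiv_of_powerLawEquiv hpow hreg
    have hWs := hA.isScaledGrid h he
    have hd0 : ∀ x y, 0 ≤ d x y := fun x y => by
      rcases eq_or_ne x y with rfl | hne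
      · exact (hd.self_eq_zero x).ge
      · exact (hd.pos x y hne).le
    exact sameSpace_of_embeds
      ((hto G W _ hG hWs (hA.diamBound h he)).trans (scaledGT_embeds_gridBesov hWs hs hp hq))
      (gridBesov_embeds_scaledGT hGs hWs hs hp hq hsη (hA.collarBound hd0 he hGs.scale_pos hGD))
  · obtain ⟨hR, hlam, hlam1, _⟩ := hW.exists_adapted h
    -- The constant 2R lam gives the radii 2R lam^(k+1) that match the centres of the level k + 1
    -- sets of W.
    have hH := h.isScaledGrid_ballPartition (c := 2 * R * lam) (by positivity) hlam hlam1
    have hHD : DiamBound (gridMetric m P) (fun k => ballPartition m P (2 * R * lam * lam ^ k))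
        (fun k => 2 * R * lam * lam ^ k) := diamBound_of_mem_grid hH fun k Q hQ => by
      obtain ⟨x, rfl⟩ := (h.mem_ballPartition (by positivity)).1 hQ
      exact h.qball_mem x (by positivity)
    exact sameSpace_of_embeds
      ((hto G _ _ hG hH hHD).trans (scaledGT_embeds_hlyBesov h hs hp hq hW))
      (hlyBesov_embeds_scaledGT h hGs hG.mem_grid hs hp hq hW)
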